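/- **Theorem (automatic subsolution).** Let $M$ be a connected smooth Riemannian manifold without boundary, of dimension $n\ge 2$ (not necessarily complete), and let $\Omega\subset M$ be a locally Lipschitz domain: a connected open set such that every $x\in\partial\Omega$ lies in a smooth coordinate chart in which, near $x$, $\Omega$ is the sub-graph of a Lipschitz function. Write $A\Subset B$ if the closure of $A$ is compact and contained in $B$. Let $u\in \mathrm{Lip}_{\mathrm{loc}}(\Omega)$, and put $E_t=\{x\in\Omega: u(x)<t\}$, viewed as a subset of $M$. For a domain (connected open set) $K\Subset M$ and a measurable set $E\subset\Omega$ put $$J_u^K(E)=P(E;K)-\int_{E\cap K}|\nabla u|,$$ where $P(E;K)\in[0,\infty]$ is the perimeter of $E$ in $K$ (the total variation of $\chi_E$ in the open set $K\subset M$, which includes the part carried by $\partial\Omega\cap K$); this is defined whenever the two terms are not both infinite. Suppose that $u$ is a (weak, interior) subsolution of the inverse mean curvature flow in $\Omega$, i.e. for every $t\in\mathbb R$, every measurable $F$ with $E_t\subset F\subset\Omega$, and every domain $K$ with $E_t\Delta F\Subset K\Subset\Omega$, $$J_u^K(E_t)\le J_u^K(F).$$ Then $u$ is a subsolution of the inverse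 mean curvature flow in $\Omega$ with outer obstacle $\partial\Omega$, i.e. for every $t\in\mathbb R$, every measurable $F$ with $E_t\subset F\subset\Omega$, and every domain $K$ with $E_t\Delta F\Subset K\Subset M$ (so that $E_t\Delta F$ may touch $\partial\Omega$), one has $$J_u^K(E_t)\le J_u^K(F)$$ whenever both energies are defined. -/

import Mathlib

open Set MeasureTheory Manifold Bundle Topology
open scoped ENNReal NNReal ContDiff

noncomputable section

namespace WeakIMCF

variable {n : ℕ} {M : Type*} [EMetricSpace M] [ChartedSpace (EuclideanSpace ℝ (Fin n)) M]

/-! ### Topological conventions -/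

/-- `A ⋐ B`: the closure of `A` is compact and contained in `B`. -/
def CompactlyContained {X : Type*} [TopologicalSpace X] (A B : Set X) : Prop :=
  IsCompact (closure A) ∧ closure A ⊆ B

/-- A domain: a connected (nonempty) open subset. -/
def IsDomainSet {X : Type*} [TopologicalSpace X] (U : Set X) : Prop :=
  IsOpen U ∧ IsConnected U

/-- A locally Lipschitz domain: a domain `Ω` such that around each boundary point there are smooth
coordinates `φ` of the manifold in which, near that point, `Ω` is the subgraph `{z_k < f(z')}` of a
Lipschitz function `f` of the remaining `n - 1` coordinates `z' = (z_i)_{i ≠ k}`. -/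
def IsLocallyLipschitzDomain (Ω : Set M) : Prop :=
  IsDomainSet Ω ∧
    ∀ x ∈ frontier Ω, ∃ φ ∈ IsManifold.maximalAtlas (𝓡 n) ∞ M, x ∈ φ.source ∧
      ∃ (k : Fin n) (f : ({i : Fin n // i ≠ k} → ℝ) → ℝ) (C : ℝ≥0), LipschitzWith C f ∧
        ∀ᶠ y in 𝓝 x, (y ∈ Ω ↔ φ y k < f (fun i => φ y i.1))

/-- `u ∈ Lip_loc(Ω)`: `u` is Lipschitz on every compact subset of `Ω`
(only the values of `u` on `Ω` matter). -/
def LipLoc {X : Type*} [EMetricSpace X] (Ω : Set X) (u : X → ℝ) : Prop :=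
  ∀ K ⊆ Ω, IsCompact K → ∃ C : ℝ≥0, LipschitzOnWith C u K

/-- The sub-level set `E_t(u) = {u < t}` of a function on `Ω`, as a subset of the ambient space. -/
def subLevel {X : Type*} (Ω : Set X) (u : X → ℝ) (t : ℝ) : Set X := {x ∈ Ω | u x < t}

/-! ### Riemannian volume, divergence, gradient -/

/-- The coordinate vector field `∂_i` of the preferred chart at `p`, at the point of `M` with
coordinates `z`. -/
def coordVec (p : M) (z : EuclideanSpace ℝ (Fin n)) (i : Fin n) :
    TangentSpace (𝓡 n) ((chartAt (EuclideanSpace ℝ (Fin n)) p).symm z) :=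
  mfderiv 𝓘(ℝ, EuclideanSpace ℝ (Fin n)) (𝓡 n)
    (chartAt (EuclideanSpace ℝ (Fin n)) p).symm z (EuclideanSpace.single i (1 : ℝ))

/-- The components `X^i` of a vector field `X` in the preferred chart at `p`, as functions of the
coordinates `z`. -/
def coordComp (X : (x : M) → TangentSpace (𝓡 n) x) (p : M) (i : Fin n)
    (z : EuclideanSpace ℝ (Fin n)) : ℝ :=
  let Y : EuclideanSpace ℝ (Fin n) :=
    mfderiv (𝓡 n) 𝓘(ℝ, EuclideanSpace ℝ (Fin n)) (chartAt (EuclideanSpace ℝ (Fin n)) p)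
      ((chartAt (EuclideanSpace ℝ (Fin n)) p).symm z)
      (X ((chartAt (EuclideanSpace ℝ (Fin n)) p).symm z))
  Y i

variable [RiemannianBundle (fun x : M => TangentSpace (𝓡 n) x)]

/-- The matrix `(g_ij)` of the Riemannian metric in the preferred chart at `p`. -/
def gram (p : M) (z : EuclideanSpace ℝ (Fin n)) : Matrix (Fin n) (Fin n) ℝ :=
  Matrix.of fun i j => inner ℝ (coordVec p z i) (coordVec p z j)

/-- The Riemannian volume density `√(det g_ij)` in the preferred chart at `p`. -/
def volDensity (p : M) (z : EuclideanSpace ℝ (Fin n)) : ℝ :=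
  √(gram p z).det

variable (n) in
/-- The Riemannian volume on the domain of the preferred chart at `p` (extended by zero): the
measure `√(det g_ij) dz` in coordinates. -/
def chartVolume [MeasurableSpace M] (p : M) : Measure M :=
  ((volume.restrict (chartAt (EuclideanSpace ℝ (Fin n)) p).target).withDensity
    fun z => ENNReal.ofReal (volDensity p z)).map (chartAt (EuclideanSpace ℝ (Fin n)) p).symm

variable (n) in
/-- The Riemannian volume measure of `M`: the smallest measure which dominates the measures
`√(det g_ij) dz` of all preferred charts. As these agree on overlaps, and countably many charts
cover `M`, it is the unique measure whose restriction to each chart domain is `√(det g_ij) dz`. -/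
def riemannianVolume [MeasurableSpace M] : Measure M :=
  ⨆ p : M, chartVolume n p

/-- The divergence `(det g)^{-1/2} ∑ i, ∂_i ((det g)^{1/2} X^i)` of a vector field `X` at `x`,
computed in the preferred chart at `x`. -/
def divergence (X : (x : M) → TangentSpace (𝓡 n) x) (x : M) : ℝ :=
  (volDensity x (chartAt (EuclideanSpace ℝ (Fin n)) x x))⁻¹ *
    ∑ i : Fin n, fderiv ℝ (fun z => volDensity x z * coordComp X x i z)
      (chartAt (EuclideanSpace ℝ (Fin n)) x x) (EuclideanSpace.single i (1 : ℝ))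

variable (n) in
/-- The norm `|∇u|` of the gradient at `x`, that is the norm of the differential `du` dual to the
Riemannian norm on the tangent space. By Rademacher's theorem a locally Lipschitz function is
differentiable at almost every point. -/
def gradNorm (u : M → ℝ) (x : M) : ℝ≥0∞ :=
  ‖mfderiv (𝓡 n) 𝓘(ℝ, ℝ) u x‖ₑ

/-! ### Perimeter and energy -/

variable [IsManifold (𝓡 n) ∞ M]

/-- `X` is a test vector field in `U`: of class `C^1`, with compact support in `U`, and with
`|X| ≤ 1`. -/
def IsTestField (U : Set M) (X : (x : M) → TangentSpace (𝓡 n) x) : Prop :=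
  ContMDiff (𝓡 n) (𝓡 n).tangent 1 (fun x => (⟨x, X x⟩ : TangentBundle (𝓡 n) M)) ∧
    (∃ C ⊆ U, IsCompact C ∧ ∀ x ∉ C, X x = 0) ∧ ∀ x, ‖X x‖ ≤ 1

variable (n) in
/-- The perimeter `P(E; U) = |Dχ_E|(U)` of a set `E` in an open set `U`, i.e. the total variation of
`χ_E` in `U`; it is `∞` if `E` does not have finite perimeter in `U`. -/
def perimeter [MeasurableSpace M] (E U : Set M) : ℝ≥0∞ :=
  ⨆ (X : (x : M) → TangentSpace (𝓡 n) x) (_ : IsTestField U X),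
    ENNReal.ofReal (∫ x in E, divergence X x ∂(riemannianVolume n))

variable (n) in
/-- The bulk term `∫_{E ∩ K} |∇u|`. -/
def bulk [MeasurableSpace M] (u : M → ℝ) (K E : Set M) : ℝ≥0∞ :=
  ∫⁻ x in E ∩ K, gradNorm n u x ∂(riemannianVolume n)

variable (n) in
/-- The energy `J_u^K(E) = P(E; K) - ∫_{E ∩ K} |∇u|`, as an extended real number. For `E ⊆ Ω` and
`K` a domain in `M` the perimeter includes the part carried by `∂Ω ∩ K`. -/
def energy [MeasurableSpace M] (u : M → ℝ) (K E : Set M) : EReal :=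
  (perimeter n E K : EReal) - (bulk n u K E : EReal)

variable (n) in
/-- The energy `J_u^K(E)` is defined when its two terms are not both infinite. -/
def EnergyDefined [MeasurableSpace M] (u : M → ℝ) (K E : Set M) : Prop :=
  ¬ (perimeter n E K = ⊤ ∧ bulk n u K E = ⊤)

/-! ### Subsolutions -/

variable (n) in
/-- `E` locally minimizes `J_u` from outside in `Ω`: `J_u^K(E) ≤ J_u^K(F)` for all `F ⊇ E` and all
domains `K` with `E Δ F ⋐ K ⋐ Ω`. -/
def MinimizesFromOutside [MeasurableSpace M] (Ω : Set M) (u : M → ℝ) (E : Set M) : Prop :=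
  ∀ F K : Set M, NullMeasurableSet F (riemannianVolume n) → F ⊆ Ω → E ⊆ F → IsDomainSet K →
    CompactlyContained (symmDiff E F) K → CompactlyContained K Ω →
      energy n u K E ≤ energy n u K F

variable (n) in
/-- `E ⊆ Ω` locally minimizes the obstacle energy from outside: `J_u^K(E) ≤ J_u^K(F)` for all `F`
with `E ⊆ F ⊆ Ω` and all domains `K` with `E Δ F ⋐ K ⋐ M`, whenever both energies are defined. Here
`E Δ F` may touch `∂Ω`, and the perimeters include the part on `∂Ω`. -/
def MinimizesFromOutsideObstacle [MeasurableSpace M] (Ω : Set M) (u : M → ℝ) (E : Set M) : Prop :=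
  ∀ F K : Set M, NullMeasurableSet F (riemannianVolume n) → F ⊆ Ω → E ⊆ F → IsDomainSet K →
    CompactlyContained (symmDiff E F) K → CompactlyContained K univ →
      EnergyDefined n u K E → EnergyDefined n u K F →
        energy n u K E ≤ energy n u K F

variable (n) in
/-- `u ∈ Lip_loc(Ω)` is a (weak, interior) subsolution of the inverse mean curvature flow in `Ω`:
every sub-level set locally minimizes `J_u` from outside in `Ω`. -/
def IsSubsolution [MeasurableSpace M] (Ω : Set M) (u : M → ℝ) : Prop :=
  LipLoc Ω u ∧ ∀ t : ℝ, MinimizesFromOutside n Ω u (subLevel Ω u t)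

variable (n) in
/-- `u ∈ Lip_loc(Ω)` is a subsolution of the inverse mean curvature flow in `Ω` with outer obstacle
`∂Ω`. -/
def IsSubsolutionWithObstacle [MeasurableSpace M] (Ω : Set M) (u : M → ℝ) : Prop :=
  LipLoc Ω u ∧ ∀ t : ℝ, MinimizesFromOutsideObstacle n Ω u (subLevel Ω u t)

end WeakIMCF

end

set_option linter.unusedSectionVars false

noncomputable section

namespace WeakIMCF

/-! ### Calculus in a chart -/

/-! A competitor touching `∂Ω` can be replaced by one that stays away from `∂Ω`, at arbitrarily
small cost in perimeter. Write `E` for the sub-level set and assume `P(F;K) < ∞`. What has to be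
shown is `P(E;K) + ∫_{F \ E} |∇u| ≤ P(F;K)`.

Near a boundary point `Ω` lies below a Lipschitz graph, so a small vertical shear, cut off near that
point, moves subsets of `Ω` off the boundary there. Such shears are `C^1`-close to the identity.
Hence the images `G_j` of `F` converge to `F` in volume and satisfy `P(G_j;K) ≤ (1 + δ) P(F;K)` for
large `j` (`exists_push`). As `G_j` need not contain `E` nor lie in `F`, the new competitor is `F' =
E ∪ (F ∩ G_j)`. Submodularity (`perimeter_union_add_perimeter_inter_le`) gives `P(F ∩ G_j) ≤ P(F) +
P(G_j) - P(F ∪ G_j)` and `P(E ∪ (F ∩ G_j)) ≤ P(E) + P(F ∩ G_j) - P(E ∩ G_j)`. By lower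
semicontinuity (`eventually_lt_perimeter`) the subtracted terms are in the limit at least `P(F)` and
`P(E)`, so that `P(F') ≤ P(F) + ε`. Near the boundary point `F' \ E ⊆ G_j` keeps away from `∂Ω`.
Finitely many such points suffice by compactness (`exists_interior_competitor`). The interior
inequality for `F'` then gives the claim as `ε → 0`, first for the bulk term on compact subsets of
`Ω`, where `|∇u|` is bounded, and then by monotone convergence
(`perimeter_subLevel_add_le_obstacle`).

These subtractions need `P(E;K) < ∞`. Almost every sub-level set has locally finite perimeter in
`Ω`, by a weak form of the coarea formula. For these levels, comparing `E` with `E ∪ A` and using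
submodularity gives `P(E ∩ A) ≤ P(A)` for all measurable `A ⋐ Ω`. The bound does not involve the
level, so approximation from below extends local finiteness to every level
(`locallyFinitePerimeter_subLevel`). The same bound with `A = F ∩ G_j ∩ B`, for a small
neighbourhood `B` of a boundary point, yields finiteness up to `∂Ω` (`perimeter_subLevel_lt_top`).

The perimeter being a supremum over `C^1` fields, each property of it is proved by transforming
fields. Components multiplied by the volume density turn divergence integrals in a chart into
Euclidean ones. Submodularity then comes from mollification, the effect of a shear from the Piola
transform, and localization from cut-off functions. -/

/-- The coordinate space `ℝⁿ`. -/
abbrev Coord (n : ℕ) := EuclideanSpace ℝ (Fin n)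

/-- The Euclidean divergence of a vector field on the coordinate space. -/
def ediv {n : ℕ} (W : Coord n → Coord n) (z : Coord n) : ℝ :=
  ∑ i, (fderiv ℝ W z (EuclideanSpace.single i (1 : ℝ))) i

lemma one_add_one_le_infty : (1 + 1 : WithTop ℕ∞) ≤ ((⊤ : ℕ∞) : WithTop ℕ∞) := by
  rw [one_add_one_eq_two]
  exact WithTop.coe_le_coe.2 (le_top : (2 : ℕ∞) ≤ ⊤)

section Charts

variable {n : ℕ} {M : Type*} [EMetricSpace M] [ChartedSpace (Coord n) M]

/-- `dφ⁻¹`. -/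
def frame (φ : OpenPartialHomeomorph M (Coord n)) (z : Coord n) :
    Coord n →L[ℝ] TangentSpace (𝓡 n) (φ.symm z) :=
  mfderiv 𝓘(ℝ, Coord n) (𝓡 n) φ.symm z

/-- `dφ`. -/
def coframe (φ : OpenPartialHomeomorph M (Coord n)) (x : M) :
    TangentSpace (𝓡 n) x →L[ℝ] Coord n :=
  mfderiv (𝓡 n) 𝓘(ℝ, Coord n) φ x

/-- The components of a vector field in a chart. -/
def compIn (φ : OpenPartialHomeomorph M (Coord n)) (X : (x : M) → TangentSpace (𝓡 n) x)
    (z : Coord n) : Coord n :=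
  coframe φ (φ.symm z) (X (φ.symm z))

lemma coframe_frame [IsManifold (𝓡 n) ∞ M] {φ : OpenPartialHomeomorph M (Coord n)}
    (hφ : φ ∈ IsManifold.maximalAtlas (𝓡 n) ∞ M)
    {z : Coord n} (hz : z ∈ φ.target) (w : Coord n) :
    coframe φ (φ.symm z) (frame φ z w) = w := by
  have h : φ.MDifferentiable (𝓡 n) (𝓡 n) :=
    ⟨(contMDiffOn_of_mem_maximalAtlas hφ).mdifferentiableOn (by simp),
      (contMDiffOn_symm_of_mem_maximalAtlas hφ).mdifferentiableOn (by simp)⟩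
  have := h.comp_symm_deriv hz
  exact congrArg (fun L => L w) this

lemma frame_coframe [IsManifold (𝓡 n) ∞ M] {φ : OpenPartialHomeomorph M (Coord n)}
    (hφ : φ ∈ IsManifold.maximalAtlas (𝓡 n) ∞ M)
    {z : Coord n} (hz : z ∈ φ.target) (v : TangentSpace (𝓡 n) (φ.symm z)) :
    frame φ z (coframe φ (φ.symm z) v) = v := by
  have h : φ.MDifferentiable (𝓡 n) (𝓡 n) :=
    ⟨(contMDiffOn_of_mem_maximalAtlas hφ).mdifferentiableOn (by simp),
      (contMDiffOn_symm_of_mem_maximalAtlas hφ).mdifferentiableOn (by simp)⟩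
  have h1 := h.symm_comp_deriv (φ.map_target hz)
  have h2 := congrArg (fun L => L v) h1
  have h3 : φ (φ.symm z) = z := φ.right_inv hz
  -- The base point also enters the type of the derivative, so `φ (φ.symm z) = z` can only be
  -- substituted after generalizing to a free point.
  have h4 : ∀ y : Coord n, y = z →
      (mfderiv 𝓘(ℝ, Coord n) (𝓡 n) φ.symm y : Coord n → Coord n) (coframe φ (φ.symm z) v)
      = (mfderiv 𝓘(ℝ, Coord n) (𝓡 n) φ.symm z : Coord n → Coord n) (coframe φ (φ.symm z) v) := by
    rintro y rfl; rfl
  exact (h4 _ h3).symm.trans h2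

lemma isInvertible_coframe [IsManifold (𝓡 n) ∞ M] {φ : OpenPartialHomeomorph M (Coord n)}
    (hφ : φ ∈ IsManifold.maximalAtlas (𝓡 n) ∞ M) {x : M} (hx : x ∈ φ.source) :
    (coframe φ x).IsInvertible := by
  have h : φ.MDifferentiable (𝓡 n) (𝓡 n) :=
    ⟨(contMDiffOn_of_mem_maximalAtlas hφ).mdifferentiableOn (by simp),
      (contMDiffOn_symm_of_mem_maximalAtlas hφ).mdifferentiableOn (by simp)⟩
  exact ⟨h.mfderiv hx, rfl⟩

lemma isInvertible_frame [IsManifold (𝓡 n) ∞ M] {φ : OpenPartialHomeomorph M (Coord n)}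
    (hφ : φ ∈ IsManifold.maximalAtlas (𝓡 n) ∞ M) {z : Coord n} (hz : z ∈ φ.target) :
    (frame φ z).IsInvertible := by
  have h : φ.MDifferentiable (𝓡 n) (𝓡 n) :=
    ⟨(contMDiffOn_of_mem_maximalAtlas hφ).mdifferentiableOn (by simp),
      (contMDiffOn_symm_of_mem_maximalAtlas hφ).mdifferentiableOn (by simp)⟩
  exact ⟨h.symm.mfderiv (x := z) hz, rfl⟩

lemma inverse_frame [IsManifold (𝓡 n) ∞ M] {φ : OpenPartialHomeomorph M (Coord n)}
    (hφ : φ ∈ IsManifold.maximalAtlas (𝓡 n) ∞ M) {z : Coord n} (hz : z ∈ φ.target)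
    (v : TangentSpace (𝓡 n) (φ.symm z)) :
    (frame φ z).inverse v = coframe φ (φ.symm z) v := by
  conv_lhs => rw [← frame_coframe hφ hz v]
  exact (isInvertible_frame hφ hz).inverse_apply_eq.2 rfl

lemma inverse_coframe [IsManifold (𝓡 n) ∞ M] {φ : OpenPartialHomeomorph M (Coord n)}
    (hφ : φ ∈ IsManifold.maximalAtlas (𝓡 n) ∞ M) {z : Coord n} (hz : z ∈ φ.target)
    (w : Coord n) :
    (coframe φ (φ.symm z)).inverse w = frame φ z w :=
  (isInvertible_coframe hφ (φ.map_target hz)).inverse_apply_eq.2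
    (coframe_frame hφ hz w).symm

/-- The components of a `C^1` field are `C^1`. -/
lemma contDiffOn_compIn [IsManifold (𝓡 n) ∞ M] {φ : OpenPartialHomeomorph M (Coord n)}
    (hφ : φ ∈ IsManifold.maximalAtlas (𝓡 n) ∞ M) {X : (x : M) → TangentSpace (𝓡 n) x}
    (hX : ContMDiff (𝓡 n) (𝓡 n).tangent 1 (fun x => (⟨x, X x⟩ : TangentBundle (𝓡 n) M))) :
    ContDiffOn ℝ 1 (compIn φ X) φ.target := by
  intro z hz
  -- The component field is the pullback of `X` under `φ.symm`. Pulling back costs one derivative of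
  -- the map, which the smooth atlas provides.
  have h1 : ContMDiffAt 𝓘(ℝ, Coord n) 𝓘(ℝ, Coord n).tangent 1
      (fun y => (⟨y, VectorField.mpullback 𝓘(ℝ, Coord n) (𝓡 n) φ.symm X y⟩ :
        TangentBundle 𝓘(ℝ, Coord n) (Coord n))) z :=
    ContMDiffAt.mpullback_vectorField_preimage (n := ∞) (hX _)
      (contMDiffAt_symm_of_mem_maximalAtlas hφ hz) (isInvertible_frame hφ hz) one_add_one_le_infty
  have h2 := (contMDiffAt_vectorSpace_iff_contDiffAt).1 h1
  refine (h2.congr_of_eventuallyEq ?_).contDiffWithinAt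
  filter_upwards [φ.open_target.mem_nhds hz] with y hy
  exact (inverse_frame hφ hy _).symm

end Charts

/-! ### The metric, the volume density and fields with density-weighted components -/

section Metric

variable {n : ℕ} {M : Type*} [EMetricSpace M] [ChartedSpace (Coord n) M]
  [RiemannianBundle (fun x : M => TangentSpace (𝓡 n) x)]

/-- The metric in a chart. -/
def gramIn (φ : OpenPartialHomeomorph M (Coord n)) (z : Coord n) : Matrix (Fin n) (Fin n) ℝ :=
  Matrix.of fun i j => inner ℝ (frame φ z (EuclideanSpace.single i (1 : ℝ)))
    (frame φ z (EuclideanSpace.single j (1 : ℝ)))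

/-- The volume density in a chart. -/
def densIn (φ : OpenPartialHomeomorph M (Coord n)) (z : Coord n) : ℝ := √(gramIn φ z).det

/-- The norm of the vector field with weighted components `w` at the point with coordinates `z`. -/
def chartNorm (φ : OpenPartialHomeomorph M (Coord n)) (z w : Coord n) : ℝ :=
  ‖frame φ z ((densIn φ z)⁻¹ • w)‖

/-- The vector field on the domain of a chart, extended by zero, with given components multiplied
by the volume density. -/
def fieldOf (φ : OpenPartialHomeomorph M (Coord n)) (W : Coord n → Coord n) (x : M) :
    TangentSpace (𝓡 n) x :=
  open Classical in
  if x ∈ φ.source then (coframe φ x).inverse ((densIn φ (φ x))⁻¹ • W (φ x)) else 0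

/-- The components of a vector field in a chart, multiplied by the volume density. -/
def weighted (φ : OpenPartialHomeomorph M (Coord n)) (X : (x : M) → TangentSpace (𝓡 n) x)
    (z : Coord n) : Coord n :=
  densIn φ z • compIn φ X z

variable [IsManifold (𝓡 n) ∞ M]

/-- The matrix is the Gram matrix of the images of the standard basis under `frame φ z`, which is
injective because `coframe` is a left inverse. -/
lemma gramIn_posDef {φ : OpenPartialHomeomorph M (Coord n)}
    (hφ : φ ∈ IsManifold.maximalAtlas (𝓡 n) ∞ M) {z : Coord n} (hz : z ∈ φ.target) :
    (gramIn φ z).PosDef := by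
  have h : LinearIndependent ℝ fun i => frame φ z (EuclideanSpace.single i (1 : ℝ)) := by
    have h0 : LinearIndependent ℝ fun i : Fin n => (EuclideanSpace.single i (1 : ℝ) : Coord n) := by
      have := (EuclideanSpace.basisFun (Fin n) ℝ).toBasis.linearIndependent
      have e : (fun i : Fin n => (EuclideanSpace.single i (1 : ℝ) : Coord n)) =
          ⇑(EuclideanSpace.basisFun (Fin n) ℝ).toBasis := by
        funext i; simp
      rw [e]
      exact this
    refine h0.map' (frame φ z).toLinearMap (LinearMap.ker_eq_bot.2 ?_)
    intro a b hab
    have := congrArg (coframe φ (φ.symm z)) hab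
    exact (coframe_frame hφ hz a).symm.trans (this.trans (coframe_frame hφ hz b))
  exact Matrix.posDef_gram_of_linearIndependent h

lemma densIn_pos {φ : OpenPartialHomeomorph M (Coord n)}
    (hφ : φ ∈ IsManifold.maximalAtlas (𝓡 n) ∞ M) {z : Coord n} (hz : z ∈ φ.target) :
    0 < densIn φ z :=
  Real.sqrt_pos.2 (gramIn_posDef hφ hz).det_pos

variable [IsContMDiffRiemannianBundle (𝓡 n) ∞ (Coord n) (fun x : M => TangentSpace (𝓡 n) x)]

/-- The coordinate fields come from the tangent map of `φ.symm` on constant fields, so they are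
`C^1` along `φ.symm`, and the bundle metric of two such fields is `C^1`. -/
lemma contDiffOn_gramIn {φ : OpenPartialHomeomorph M (Coord n)}
    (hφ : φ ∈ IsManifold.maximalAtlas (𝓡 n) ∞ M) (i j : Fin n) :
    ContDiffOn ℝ 1 (fun z => gramIn φ z i j) φ.target := by
  have key : ∀ v : Coord n, ContMDiffOn 𝓘(ℝ, Coord n) ((𝓡 n).prod 𝓘(ℝ, Coord n)) 1
      (fun z => (⟨φ.symm z, frame φ z v⟩ : TotalSpace (Coord n) (fun x : M => TangentSpace (𝓡 n) x)))
      φ.target := by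
    intro v
    have h1 : ContMDiffOn 𝓘(ℝ, Coord n).tangent (𝓡 n).tangent 1
        (tangentMapWithin 𝓘(ℝ, Coord n) (𝓡 n) φ.symm φ.target)
        (TotalSpace.proj ⁻¹' φ.target) :=
      (contMDiffOn_symm_of_mem_maximalAtlas hφ).contMDiffOn_tangentMapWithin one_add_one_le_infty
        φ.open_target.uniqueMDiffOn
    have h2 : ContMDiff 𝓘(ℝ, Coord n) 𝓘(ℝ, Coord n).tangent 1
        (fun z => (⟨z, v⟩ : TangentBundle 𝓘(ℝ, Coord n) (Coord n))) := by
      intro z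
      exact contMDiffAt_vectorSpace_iff_contDiffAt.2 contDiffAt_const
    refine (h1.comp h2.contMDiffOn (fun z hz => hz)).congr ?_
    intro z hz
    simp only [Function.comp, tangentMapWithin]
    rw [mfderivWithin_of_mem_nhds (φ.open_target.mem_nhds hz)]
    rfl
  have : IsContMDiffRiemannianBundle (𝓡 n) 1 (Coord n) (fun x : M => TangentSpace (𝓡 n) x) :=
    IsContMDiffRiemannianBundle.of_le (n := ∞) (by exact mod_cast le_top)
  have := ContMDiffOn.inner_bundle (key (EuclideanSpace.single i 1)) (key (EuclideanSpace.single j 1))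
  exact this.contDiffOn

lemma contDiffOn_densIn {φ : OpenPartialHomeomorph M (Coord n)}
    (hφ : φ ∈ IsManifold.maximalAtlas (𝓡 n) ∞ M) : ContDiffOn ℝ 1 (densIn φ) φ.target := by
  refine ContDiffOn.sqrt ?_ (fun z hz => (gramIn_posDef hφ hz).det_pos.ne')
  simp only [Matrix.det_apply]
  refine ContDiffOn.sum fun σ _ => ?_
  refine ContDiffOn.const_smul _ ?_
  exact contDiffOn_prod fun i _ => contDiffOn_gramIn hφ _ _


lemma fieldOf_of_notMem {φ : OpenPartialHomeomorph M (Coord n)} {W : Coord n → Coord n} {x : M}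
    (hx : x ∉ φ.symm '' tsupport W) : fieldOf φ W x = 0 := by
  unfold fieldOf
  split_ifs with h
  · have : W (φ x) = 0 := by
      by_contra h0
      exact hx ⟨φ x, subset_tsupport _ h0, φ.left_inv h⟩
    simp [this]
  · rfl

lemma fieldOf_symm {φ : OpenPartialHomeomorph M (Coord n)}
    (hφ : φ ∈ IsManifold.maximalAtlas (𝓡 n) ∞ M) {W : Coord n → Coord n} {z : Coord n}
    (hz : z ∈ φ.target) : fieldOf φ W (φ.symm z) = frame φ z ((densIn φ z)⁻¹ • W z) := by
  unfold fieldOf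
  rw [if_pos (φ.map_target hz), inverse_coframe hφ hz, φ.right_inv hz]

lemma norm_fieldOf_symm {φ : OpenPartialHomeomorph M (Coord n)}
    (hφ : φ ∈ IsManifold.maximalAtlas (𝓡 n) ∞ M) {W : Coord n → Coord n} {z : Coord n}
    (hz : z ∈ φ.target) : ‖fieldOf φ W (φ.symm z)‖ = chartNorm φ z (W z) := by
  rw [fieldOf_symm hφ hz, chartNorm]

/-- Dividing by the density in `fieldOf` makes the weighted components equal to `W` itself. The
Riemannian divergence times the density is then the Euclidean divergence of `W`. -/
lemma weighted_fieldOf {φ : OpenPartialHomeomorph M (Coord n)}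
    (hφ : φ ∈ IsManifold.maximalAtlas (𝓡 n) ∞ M) {W : Coord n → Coord n} {z : Coord n}
    (hz : z ∈ φ.target) : weighted φ (fieldOf φ W) z = W z := by
  unfold weighted compIn
  rw [fieldOf_symm hφ hz, coframe_frame hφ hz, smul_inv_smul₀ (densIn_pos hφ hz).ne']

lemma isCompact_symm_image_tsupport {φ : OpenPartialHomeomorph M (Coord n)}
    {W : Coord n → Coord n} (hc : HasCompactSupport W) (hW : tsupport W ⊆ φ.target) :
    IsCompact (φ.symm '' tsupport W) :=
  hc.isCompact.image_of_continuousOn (φ.continuousOn_symm.mono hW)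

/-- Inside the chart the field is a pullback of a `C^1` field. The image of the support is compact,
hence closed in `M`, so the extension by zero vanishes near every other point. -/
lemma contMDiff_fieldOf {φ : OpenPartialHomeomorph M (Coord n)}
    (hφ : φ ∈ IsManifold.maximalAtlas (𝓡 n) ∞ M) {W : Coord n → Coord n}
    (hW1 : ContDiff ℝ 1 W) (hc : HasCompactSupport W) (hW : tsupport W ⊆ φ.target) :
    ContMDiff (𝓡 n) (𝓡 n).tangent 1
      (fun x => (⟨x, fieldOf φ W x⟩ : TangentBundle (𝓡 n) M)) := by
  intro x
  by_cases hx : x ∈ φ.symm '' tsupport W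
  · have hxs : x ∈ φ.source := by
      obtain ⟨z, hz, rfl⟩ := hx
      exact φ.map_target (hW hz)
    have hV : ContMDiffAt 𝓘(ℝ, Coord n) 𝓘(ℝ, Coord n).tangent 1
        (fun y => (⟨y, (densIn φ y)⁻¹ • W y⟩ : TangentBundle 𝓘(ℝ, Coord n) (Coord n))) (φ x) := by
      refine contMDiffAt_vectorSpace_iff_contDiffAt.2 ?_
      have h1 := (contDiffOn_densIn hφ).contDiffAt (φ.open_target.mem_nhds (φ.map_source hxs))
      exact (h1.inv (densIn_pos hφ (φ.map_source hxs)).ne').smul hW1.contDiffAt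
    have h1 : ContMDiffAt (𝓡 n) (𝓡 n).tangent 1
        (fun y => (⟨y, VectorField.mpullback (𝓡 n) 𝓘(ℝ, Coord n) φ
          (fun y => (densIn φ y)⁻¹ • W y) y⟩ : TangentBundle (𝓡 n) M)) x :=
      ContMDiffAt.mpullback_vectorField_preimage (n := ∞) hV
        (contMDiffAt_of_mem_maximalAtlas hφ hxs) (isInvertible_coframe hφ hxs)
        one_add_one_le_infty
    refine h1.congr_of_eventuallyEq ?_
    filter_upwards [φ.open_source.mem_nhds hxs] with y hy
    unfold fieldOf
    rw [if_pos hy]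
    rfl
  · have h0 : ContMDiff (𝓡 n) (𝓡 n).tangent 1
        (fun y => (⟨y, 0⟩ : TangentBundle (𝓡 n) M)) :=
      Bundle.contMDiff_zeroSection ℝ (fun x : M => TangentSpace (𝓡 n) x)
    refine h0.contMDiffAt.congr_of_eventuallyEq ?_
    filter_upwards [(isCompact_symm_image_tsupport hc hW).isClosed.isOpen_compl.mem_nhds hx] with y hy
    rw [fieldOf_of_notMem hy]

/-- A `C^1` field with compact support in the domain of a chart comes from weighted components. -/
lemma exists_eq_fieldOf {φ : OpenPartialHomeomorph M (Coord n)}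
    (hφ : φ ∈ IsManifold.maximalAtlas (𝓡 n) ∞ M) {X : (x : M) → TangentSpace (𝓡 n) x}
    (hX : ContMDiff (𝓡 n) (𝓡 n).tangent 1 (fun x => (⟨x, X x⟩ : TangentBundle (𝓡 n) M)))
    {C : Set M} (hC : IsCompact C) (hCs : C ⊆ φ.source) (h0 : ∀ x ∉ C, X x = 0) :
    ∃ W : Coord n → Coord n, ContDiff ℝ 1 W ∧ HasCompactSupport W ∧ tsupport W ⊆ φ '' C ∧
      tsupport W ⊆ φ.target ∧ fieldOf φ W = X := by
  classical
  set W : Coord n → Coord n := fun z => if z ∈ φ.target then weighted φ X z else 0 with hWdef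
  have hCt : φ '' C ⊆ φ.target := by
    rintro _ ⟨x, hx, rfl⟩; exact φ.map_source (hCs hx)
  have hCc : IsCompact (φ '' C) := hC.image_of_continuousOn (φ.continuousOn.mono hCs)
  have hW0 : ∀ z ∉ φ '' C, W z = 0 := by
    intro z hz
    by_cases hzt : z ∈ φ.target
    · have : X (φ.symm z) = 0 := h0 _ fun h => hz ⟨_, h, φ.right_inv hzt⟩
      simp only [hWdef, if_pos hzt, weighted, compIn, this, map_zero, smul_zero]
    · simp only [hWdef, if_neg hzt]
  have hts : tsupport W ⊆ φ '' C :=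
    closure_minimal (fun z hz => by_contra fun h => hz (hW0 z h)) hCc.isClosed
  refine ⟨W, ?_, hCc.of_isClosed_subset (isClosed_tsupport _) hts, hts, hts.trans hCt, ?_⟩
  · rw [contDiff_iff_contDiffAt]
    intro z
    by_cases hz : z ∈ φ '' C
    · have hn := φ.open_target.mem_nhds (hCt hz)
      have h1 : ContDiffAt ℝ 1 (weighted φ X) z :=
        ((contDiffOn_densIn hφ).contDiffAt hn).smul ((contDiffOn_compIn hφ hX).contDiffAt hn)
      refine h1.congr_of_eventuallyEq ?_
      filter_upwards [hn] with y hy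
      simp only [hWdef, if_pos hy]
    · refine (contDiffAt_const (c := (0 : Coord n))).congr_of_eventuallyEq ?_
      filter_upwards [hCc.isClosed.isOpen_compl.mem_nhds hz] with y hy
      exact hW0 y hy
  · funext x
    by_cases hx : x ∈ φ.source
    · have hz := φ.map_source hx
      have h2 : φ.symm (φ x) = x := φ.left_inv hx
      rw [← h2, fieldOf_symm hφ hz]
      simp only [hWdef, if_pos hz, weighted]
      rw [inv_smul_smul₀ (densIn_pos hφ hz).ne']
      exact frame_coframe hφ hz _
    · unfold fieldOf
      rw [if_neg hx, h0 x fun h => hx (hCs h)]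

/-! ### The norm in a chart -/

lemma chartNorm_nonneg (φ : OpenPartialHomeomorph M (Coord n)) (z w : Coord n) :
    0 ≤ chartNorm φ z w := norm_nonneg _

lemma chartNorm_add_le (φ : OpenPartialHomeomorph M (Coord n)) (z w w' : Coord n) :
    chartNorm φ z (w + w') ≤ chartNorm φ z w + chartNorm φ z w' := by
  unfold chartNorm
  rw [smul_add, map_add]
  exact norm_add_le _ _

lemma chartNorm_smul (φ : OpenPartialHomeomorph M (Coord n)) (z w : Coord n) (c : ℝ) :
    chartNorm φ z (c • w) = |c| * chartNorm φ z w := by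
  unfold chartNorm
  rw [smul_comm, map_smul, norm_smul, Real.norm_eq_abs]

/-- Expressing the norm by coefficient functions gives its joint continuity in `z` and `w` without
comparing different tangent spaces. -/
lemma chartNorm_sq (φ : OpenPartialHomeomorph M (Coord n)) (z w : Coord n) :
    chartNorm φ z w ^ 2 = (densIn φ z)⁻¹ ^ 2 * ∑ i, ∑ j, w i * w j * gramIn φ z i j := by
  have hw : w = ∑ i, w i • (EuclideanSpace.single i (1 : ℝ) : Coord n) := by
    simpa using ((EuclideanSpace.basisFun (Fin n) ℝ).sum_repr w).symm
  unfold chartNorm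
  rw [map_smul, norm_smul, mul_pow, Real.norm_eq_abs, sq_abs, ← real_inner_self_eq_norm_sq]
  congr 1
  conv_lhs => rw [hw]
  simp only [map_sum, map_smul, sum_inner, inner_sum, real_inner_smul_left, real_inner_smul_right,
    gramIn, Matrix.of_apply]
  refine Finset.sum_congr rfl fun i _ => Finset.sum_congr rfl fun j _ => ?_
  rw [real_inner_comm]
  ring

lemma continuousOn_chartNorm {φ : OpenPartialHomeomorph M (Coord n)}
    (hφ : φ ∈ IsManifold.maximalAtlas (𝓡 n) ∞ M) :
    ContinuousOn (fun p : Coord n × Coord n => chartNorm φ p.1 p.2) (φ.target ×ˢ univ) := by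
  have h : ContinuousOn (fun p : Coord n × Coord n => √((densIn φ p.1)⁻¹ ^ 2 *
      ∑ i, ∑ j, p.2 i * p.2 j * gramIn φ p.1 i j)) (φ.target ×ˢ univ) := by
    have hfst : MapsTo Prod.fst (φ.target ×ˢ (univ : Set (Coord n))) φ.target := fun p hp => hp.1
    refine ContinuousOn.sqrt (ContinuousOn.mul (ContinuousOn.pow (ContinuousOn.inv₀ ?_ ?_) 2) ?_)
    · exact (contDiffOn_densIn hφ).continuousOn.comp continuousOn_fst hfst
    · exact fun p hp => (densIn_pos hφ hp.1).ne'
    · refine continuousOn_finsetSum _ fun i _ => continuousOn_finsetSum _ fun j _ => ?_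
      refine ContinuousOn.mul (by fun_prop) ?_
      exact (contDiffOn_gramIn hφ i j).continuousOn.comp continuousOn_fst hfst
  refine h.congr fun p _ => ?_
  simp only [← chartNorm_sq]
  rw [Real.sqrt_sq (chartNorm_nonneg _ _ _)]

lemma chartNorm_pos {φ : OpenPartialHomeomorph M (Coord n)}
    (hφ : φ ∈ IsManifold.maximalAtlas (𝓡 n) ∞ M) {z w : Coord n} (hz : z ∈ φ.target)
    (hw : w ≠ 0) : 0 < chartNorm φ z w := by
  refine norm_pos_iff.2 fun h => hw ?_
  have h1 := coframe_frame hφ hz ((densIn φ z)⁻¹ • w)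
  rw [h, map_zero] at h1
  exact (smul_eq_zero.1 h1.symm).resolve_left (inv_ne_zero (densIn_pos hφ hz).ne')

/-- The norms in a chart are comparable to the Euclidean one on compact sets. -/
lemma exists_le_chartNorm {φ : OpenPartialHomeomorph M (Coord n)}
    (hφ : φ ∈ IsManifold.maximalAtlas (𝓡 n) ∞ M) {C : Set (Coord n)} (hC : IsCompact C)
    (hCt : C ⊆ φ.target) : ∃ c > 0, ∀ z ∈ C, ∀ w, c * ‖w‖ ≤ chartNorm φ z w := by
  -- The constant is the minimum over unit vectors; homogeneity extends the bound to all `w`.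
  have hK : IsCompact (C ×ˢ Metric.sphere (0 : Coord n) 1) := hC.prod (isCompact_sphere 0 1)
  have hcont := (continuousOn_chartNorm hφ).mono
    (s := φ.target ×ˢ univ) (t := C ×ˢ Metric.sphere (0 : Coord n) 1)
    (prod_mono hCt (subset_univ _))
  obtain ⟨c, hc, hcb⟩ : ∃ c > 0, ∀ p ∈ C ×ˢ Metric.sphere (0 : Coord n) 1,
      c ≤ chartNorm φ p.1 p.2 := by
    rcases (C ×ˢ Metric.sphere (0 : Coord n) 1).eq_empty_or_nonempty with he | hne
    · exact ⟨1, one_pos, by simp [he]⟩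
    · obtain ⟨p, hp, hmin⟩ := hK.exists_isMinOn hne hcont
      refine ⟨_, chartNorm_pos hφ (hCt hp.1) ?_, fun q hq => hmin hq⟩
      intro h
      have := hp.2
      simp [h] at this
  refine ⟨c, hc, fun z hz w => ?_⟩
  rcases eq_or_ne w 0 with rfl | hw
  · simp [chartNorm_nonneg]
  have h1 := hcb (z, ‖w‖⁻¹ • w) ⟨hz, by simp [norm_smul, hw]⟩
  simp only [chartNorm_smul, abs_inv, abs_norm] at h1
  have hw' : 0 < ‖w‖ := norm_pos_iff.2 hw
  calc c * ‖w‖ ≤ (‖w‖⁻¹ * chartNorm φ z w) * ‖w‖ := by gcongr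
    _ = chartNorm φ z w := by field_simp

/-- Small perturbations of the point and of the vector change the norm by a factor close to `1`. -/
lemma exists_chartNorm_le {φ : OpenPartialHomeomorph M (Coord n)}
    (hφ : φ ∈ IsManifold.maximalAtlas (𝓡 n) ∞ M) {C : Set (Coord n)} (hC : IsCompact C)
    (hCt : C ⊆ φ.target) {δ : ℝ} (hδ : 0 < δ) :
    ∃ r > 0, ∀ z ∈ C, ∀ y, dist y z ≤ r → y ∈ φ.target ∧
      ∀ w w', ‖w' - w‖ ≤ r * ‖w‖ → chartNorm φ y w' ≤ (1 + δ) * chartNorm φ z w := by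
  obtain ⟨c, hc, hcb⟩ := exists_le_chartNorm hφ hC hCt
  obtain ⟨r₀, hr₀, hr₀t⟩ := hC.exists_cthickening_subset_open φ.open_target hCt
  have hK : IsCompact (Metric.cthickening r₀ C ×ˢ Metric.closedBall (0 : Coord n) 2) :=
    hC.cthickening.prod (isCompact_closedBall 0 2)
  have huc := hK.uniformContinuousOn_of_continuous ((continuousOn_chartNorm hφ).mono
    (prod_mono hr₀t (subset_univ _)))
  -- Unit vectors have norm at least `c`, so an additive error `δ * c` is at most a relative error
  -- `δ`.
  obtain ⟨η, hη, huc⟩ := Metric.uniformContinuousOn_iff.1 huc (δ * c) (by positivity)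
  -- Here `r₀` keeps `y` in the target, `η / 2` makes the distances strictly less than `η`, and `1`
  -- keeps the rescaled `w'` in the ball of radius `2`.
  refine ⟨min (min r₀ (η / 2)) 1, by positivity, fun z hz y hy => ?_⟩
  have hyr : y ∈ Metric.cthickening r₀ C :=
    Metric.mem_cthickening_of_dist_le y z r₀ C hz
      (hy.trans ((min_le_left _ _).trans (min_le_left _ _)))
  refine ⟨hr₀t hyr, fun w w' hww => ?_⟩
  rcases eq_or_ne w 0 with rfl | hw
  · have : w' = 0 := by simpa using hww
    subst this
    simp [chartNorm]
  have hw' : 0 < ‖w‖ := norm_pos_iff.2 hw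
  have hd : dist (‖w‖⁻¹ • w') (‖w‖⁻¹ • w) ≤ min (min r₀ (η / 2)) 1 := by
    rw [dist_eq_norm, ← smul_sub, norm_smul, norm_inv, norm_norm, inv_mul_le_iff₀ hw', mul_comm]
    exact hww
  have hn1 : ‖‖w‖⁻¹ • w‖ = 1 := by simp [norm_smul, hw]
  have hn2 : ‖‖w‖⁻¹ • w'‖ ≤ 2 := by
    have := norm_le_norm_add_norm_sub' (‖w‖⁻¹ • w') (‖w‖⁻¹ • w)
    rw [dist_eq_norm] at hd
    have := hd.trans (min_le_right _ _)
    linarith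
  have h1 := huc (y, ‖w‖⁻¹ • w') ⟨hyr, by simpa using hn2⟩ (z, ‖w‖⁻¹ • w)
    ⟨Metric.self_subset_cthickening C hz, by simp [hn1]⟩ (by
      rw [Prod.dist_eq, max_lt_iff]
      exact ⟨(hy.trans ((min_le_left _ _).trans (min_le_right _ _))).trans_lt (by linarith),
        (hd.trans ((min_le_left _ _).trans (min_le_right _ _))).trans_lt (by linarith)⟩)
  rw [Real.dist_eq, chartNorm_smul, chartNorm_smul, abs_inv, abs_norm, ← mul_sub, abs_mul,
    abs_inv, abs_norm, inv_mul_lt_iff₀ hw'] at h1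
  have h2 := hcb z hz w
  have h3 := (abs_lt.1 h1).2
  nlinarith

end Metric

end WeakIMCF
end

noncomputable section

namespace WeakIMCF

/-! ### The Riemannian volume in a chart -/

section Volume

variable {n : ℕ} {M : Type*} [EMetricSpace M] [ChartedSpace (Coord n) M]
  [RiemannianBundle (fun x : M => TangentSpace (𝓡 n) x)] [IsManifold (𝓡 n) ∞ M]
  [IsContMDiffRiemannianBundle (𝓡 n) ∞ (Coord n) (fun x : M => TangentSpace (𝓡 n) x)]

lemma inner_frame (φ : OpenPartialHomeomorph M (Coord n)) (z a b : Coord n) :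
    inner ℝ (frame φ z a) (frame φ z b) = ∑ k, ∑ l, a k * gramIn φ z k l * b l := by
  have hw : ∀ w : Coord n, w = ∑ i, w i • (EuclideanSpace.single i (1 : ℝ) : Coord n) := fun w => by
    simpa using ((EuclideanSpace.basisFun (Fin n) ℝ).sum_repr w).symm
  conv_lhs => rw [hw a, hw b]
  simp only [map_sum, map_smul, sum_inner, inner_sum, real_inner_smul_left, real_inner_smul_right,
    gramIn, Matrix.of_apply]
  rw [Finset.sum_comm]
  refine Finset.sum_congr rfl fun i _ => Finset.sum_congr rfl fun j _ => ?_
  ring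

lemma inner_eq_inner_frame {ψ : OpenPartialHomeomorph M (Coord n)}
    (hψ : ψ ∈ IsManifold.maximalAtlas (𝓡 n) ∞ M) {x : M} (hx : x ∈ ψ.source)
    (v w : TangentSpace (𝓡 n) x) :
    inner ℝ v w = inner ℝ (frame ψ (ψ x) (coframe ψ x v)) (frame ψ (ψ x) (coframe ψ x w)) := by
  obtain ⟨y, hy, rfl⟩ : ∃ y ∈ ψ.target, x = ψ.symm y := ⟨ψ x, ψ.map_source hx, (ψ.left_inv hx).symm⟩
  rw [ψ.right_inv hy, frame_coframe hψ hy, frame_coframe hψ hy]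

/-- The derivative of the transition map between two charts. -/
def transDeriv (φ ψ : OpenPartialHomeomorph M (Coord n)) (z : Coord n) : Coord n →L[ℝ] Coord n :=
  (coframe ψ (φ.symm z)).comp (frame φ z)

lemma hasFDerivAt_transition {φ ψ : OpenPartialHomeomorph M (Coord n)}
    (hφ : φ ∈ IsManifold.maximalAtlas (𝓡 n) ∞ M) (hψ : ψ ∈ IsManifold.maximalAtlas (𝓡 n) ∞ M)
    {z : Coord n} (hz : z ∈ φ.target) (hz' : φ.symm z ∈ ψ.source) :
    HasFDerivAt (ψ ∘ φ.symm) (transDeriv φ ψ z) z := by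
  have h1 : HasMFDerivAt 𝓘(ℝ, Coord n) (𝓡 n) φ.symm z (frame φ z) :=
    ((contMDiffAt_symm_of_mem_maximalAtlas hφ hz).mdifferentiableAt (by simp)).hasMFDerivAt
  have h2 : HasMFDerivAt (𝓡 n) 𝓘(ℝ, Coord n) ψ (φ.symm z) (coframe ψ (φ.symm z)) :=
    ((contMDiffAt_of_mem_maximalAtlas hψ hz').mdifferentiableAt (by simp)).hasMFDerivAt
  exact (h2.comp z h1).hasFDerivAt

/-- With the Jacobian matrix `T` of the transition map, the metric transforms as `Tᵀ g T`. Its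
determinant picks up `(det T)²`. -/
lemma densIn_transition {φ ψ : OpenPartialHomeomorph M (Coord n)}
    (hψ : ψ ∈ IsManifold.maximalAtlas (𝓡 n) ∞ M)
    {z : Coord n} (hz' : φ.symm z ∈ ψ.source) :
    densIn φ z = |(transDeriv φ ψ z).det| * densIn ψ (ψ (φ.symm z)) := by
  set T : Matrix (Fin n) (Fin n) ℝ := Matrix.of fun k i =>
    (transDeriv φ ψ z (EuclideanSpace.single i (1 : ℝ))) k with hT
  have hdet : (transDeriv φ ψ z).det = T.det := by
    have := LinearMap.det_toMatrix (EuclideanSpace.basisFun (Fin n) ℝ).toBasis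
      (transDeriv φ ψ z : Coord n →ₗ[ℝ] Coord n)
    rw [ContinuousLinearMap.det, ← this]
    congr 1
  have hg : gramIn φ z = T.transpose * gramIn ψ (ψ (φ.symm z)) * T := by
    ext i j
    have : gramIn φ z i j = inner ℝ (frame φ z (EuclideanSpace.single i (1 : ℝ)))
      (frame φ z (EuclideanSpace.single j (1 : ℝ))) := rfl
    rw [this, inner_eq_inner_frame hψ hz', inner_frame]
    simp only [Matrix.mul_apply, Matrix.transpose_apply, hT, Matrix.of_apply, Finset.sum_mul]
    rw [Finset.sum_comm]
    rfl
  unfold densIn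
  rw [hg, Matrix.det_mul, Matrix.det_mul, Matrix.det_transpose, hdet,
    show T.det * (gramIn ψ (ψ (φ.symm z))).det * T.det
      = T.det ^ 2 * (gramIn ψ (ψ (φ.symm z))).det by ring,
    Real.sqrt_mul (sq_nonneg _), Real.sqrt_sq_eq_abs]

variable [MeasurableSpace M] [BorelSpace M]

/-- The Riemannian volume on the domain of a chart. -/
def chartMeasure (φ : OpenPartialHomeomorph M (Coord n)) : Measure M :=
  ((volume.restrict φ.target).withDensity fun z => ENNReal.ofReal (densIn φ z)).map φ.symm

lemma chartVolume_eq_chartMeasure (p : M) :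
    chartVolume n p = chartMeasure (chartAt (Coord n) p) := rfl

lemma aemeasurable_symm (φ : OpenPartialHomeomorph M (Coord n)) :
    AEMeasurable φ.symm
      ((volume.restrict φ.target).withDensity fun z => ENNReal.ofReal (densIn φ z)) :=
  (φ.continuousOn_symm.aemeasurable φ.open_target.measurableSet).mono_ac
    (withDensity_absolutelyContinuous _ _)

lemma measurableSet_target_inter (φ : OpenPartialHomeomorph M (Coord n)) {A : Set M}
    (hA : MeasurableSet A) : MeasurableSet (φ.target ∩ φ.symm ⁻¹' A) := by
  have h := (φ.continuousOn_symm.domRestrict.measurable) hA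
  have h2 := φ.open_target.measurableSet.subtype_image h
  convert h2 using 1
  ext z
  simp [and_comm]

lemma chartMeasure_apply (φ : OpenPartialHomeomorph M (Coord n)) {A : Set M}
    (hA : MeasurableSet A) :
    chartMeasure φ A = ∫⁻ z in φ.target ∩ φ.symm ⁻¹' A, ENNReal.ofReal (densIn φ z) := by
  unfold chartMeasure
  have h := aemeasurable_symm φ
  rw [Measure.map_apply_of_aemeasurable h hA]
  have h0 : ((volume.restrict φ.target).withDensity fun z => ENNReal.ofReal (densIn φ z))
      (φ.symm ⁻¹' A) = ((volume.restrict φ.target).withDensity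
        fun z => ENNReal.ofReal (densIn φ z)) (φ.target ∩ φ.symm ⁻¹' A) := by
    refine measure_congr ?_
    have : ∀ᵐ z ∂((volume.restrict φ.target).withDensity fun z => ENNReal.ofReal (densIn φ z)),
        z ∈ φ.target := (withDensity_absolutelyContinuous _ _).ae_le
          (ae_restrict_mem φ.open_target.measurableSet)
    filter_upwards [this] with z hz
    exact propext ⟨fun h => ⟨hz, h⟩, fun h => h.2⟩
  rw [h0, withDensity_apply _ (measurableSet_target_inter φ hA),
    Measure.restrict_restrict (measurableSet_target_inter φ hA),
    inter_eq_self_of_subset_left inter_subset_left]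

lemma chartMeasure_compl_source (φ : OpenPartialHomeomorph M (Coord n)) :
    chartMeasure φ φ.sourceᶜ = 0 := by
  rw [chartMeasure_apply φ φ.open_source.measurableSet.compl]
  have : φ.target ∩ φ.symm ⁻¹' φ.sourceᶜ = ∅ := by
    ext z
    simp only [mem_inter_iff, mem_preimage, mem_compl_iff, mem_empty_iff_false, iff_false, not_and,
      not_not]
    exact fun h => φ.map_target h
  rw [this]
  simp

lemma chartMeasure_eq_of_subset {φ ψ : OpenPartialHomeomorph M (Coord n)}
    (hφ : φ ∈ IsManifold.maximalAtlas (𝓡 n) ∞ M) (hψ : ψ ∈ IsManifold.maximalAtlas (𝓡 n) ∞ M)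
    {A : Set M} (hA : MeasurableSet A) (hAφ : A ⊆ φ.source) (hAψ : A ⊆ ψ.source) :
    chartMeasure φ A = chartMeasure ψ A := by
  rw [chartMeasure_apply φ hA, chartMeasure_apply ψ hA]
  have him : (ψ ∘ φ.symm) '' (φ.target ∩ φ.symm ⁻¹' A) = ψ.target ∩ ψ.symm ⁻¹' A := by
    ext y
    constructor
    · rintro ⟨z, ⟨hz, hzA⟩, rfl⟩
      refine ⟨ψ.map_source (hAψ hzA), ?_⟩
      simp only [Function.comp, mem_preimage]
      rwa [ψ.left_inv (hAψ hzA)]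
    · rintro ⟨hy, hyA⟩
      refine ⟨φ (ψ.symm y), ⟨φ.map_source (hAφ hyA), ?_⟩, ?_⟩
      · simp only [mem_preimage]
        rwa [φ.left_inv (hAφ hyA)]
      · simp only [Function.comp]
        rw [φ.left_inv (hAφ hyA), ψ.right_inv hy]
  have hinj : InjOn (ψ ∘ φ.symm) (φ.target ∩ φ.symm ⁻¹' A) := by
    intro z hz y hy h
    have h1 := ψ.injOn (hAψ hz.2) (hAψ hy.2) h
    exact φ.symm.injOn hz.1 hy.1 h1
  rw [← him, lintegral_image_eq_lintegral_abs_det_fderiv_mul volume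
    (measurableSet_target_inter φ hA) (f' := transDeriv φ ψ)
    (fun z hz => (hasFDerivAt_transition hφ hψ hz.1 (hAψ hz.2)).hasFDerivWithinAt) hinj]
  refine setLIntegral_congr_fun (measurableSet_target_inter φ hA) fun z hz => ?_
  simp only [Function.comp]
  rw [densIn_transition hψ (hAψ hz.2), ENNReal.ofReal_mul (abs_nonneg _)]

/-- A supremum of measures is not computed setwise. The upper bound therefore uses one measure
dominating all chart volumes: that of the given chart plus the full volume off its domain. The
charts agree on overlaps by the change of variables formula. -/
lemma riemannianVolume_apply_of_subset_chartAt (p : M) {A : Set M} (hA : MeasurableSet A)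
    (hAp : A ⊆ (chartAt (Coord n) p).source) :
    riemannianVolume n A = chartMeasure (chartAt (Coord n) p) A := by
  refine le_antisymm ?_ (Measure.le_iff'.1 (le_iSup (chartVolume n) p) A)
  set φ := chartAt (Coord n) p
  have hφ : φ ∈ IsManifold.maximalAtlas (𝓡 n) ∞ M := IsManifold.chart_mem_maximalAtlas p
  have hle : (riemannianVolume n : Measure M) ≤
      chartMeasure φ + (riemannianVolume n : Measure M).restrict φ.sourceᶜ := by
    refine iSup_le fun q => Measure.le_iff.2 fun s hs => ?_
    rw [← measure_inter_add_sdiff s φ.open_source.measurableSet, Measure.add_apply]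
    have hq : chartAt (Coord n) q ∈ IsManifold.maximalAtlas (𝓡 n) ∞ M :=
      IsManifold.chart_mem_maximalAtlas q
    refine add_le_add ?_ ?_
    · rw [chartVolume_eq_chartMeasure]
      have hm : MeasurableSet (s ∩ φ.source ∩ (chartAt (Coord n) q).source) :=
        (hs.inter φ.open_source.measurableSet).inter (chartAt (Coord n) q).open_source.measurableSet
      calc chartMeasure (chartAt (Coord n) q) (s ∩ φ.source)
          ≤ chartMeasure (chartAt (Coord n) q) (s ∩ φ.source ∩ (chartAt (Coord n) q).source)
            + chartMeasure (chartAt (Coord n) q) ((chartAt (Coord n) q).source)ᶜ := by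
              refine (measure_mono ?_).trans (measure_union_le _ _)
              intro x hx
              by_cases h : x ∈ (chartAt (Coord n) q).source
              · exact Or.inl ⟨hx, h⟩
              · exact Or.inr h
        _ = chartMeasure φ (s ∩ φ.source ∩ (chartAt (Coord n) q).source) := by
              rw [chartMeasure_compl_source, add_zero,
                chartMeasure_eq_of_subset hq hφ hm inter_subset_right
                  (inter_subset_left.trans inter_subset_right)]
        _ ≤ chartMeasure φ s := measure_mono (inter_subset_left.trans inter_subset_left)
    · rw [Measure.restrict_apply hs, ← sdiff_eq]
      exact Measure.le_iff'.1 (le_iSup (chartVolume n) q) _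
  calc riemannianVolume n A ≤ _ := Measure.le_iff'.1 hle A
    _ = chartMeasure φ A := by
      rw [Measure.add_apply, Measure.restrict_apply hA, ← sdiff_eq, sdiff_eq_empty.2 hAp]
      simp

/-- In every smooth chart the Riemannian volume is `√(det g) dz`. -/
lemma restrict_riemannianVolume [SecondCountableTopology M]
    {φ : OpenPartialHomeomorph M (Coord n)} (hφ : φ ∈ IsManifold.maximalAtlas (𝓡 n) ∞ M) :
    (riemannianVolume n : Measure M).restrict φ.source = chartMeasure φ := by
  -- The value on subsets of preferred charts is known. A measure is determined by its restrictions
  -- to countably many of them, and on each the chart `φ` gives the same value.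
  obtain ⟨s, hs, hcov⟩ := TopologicalSpace.countable_cover_nhds
    (fun x : M => (chartAt (Coord n) x).open_source.mem_nhds (mem_chart_source (Coord n) x))
  have := hs.to_subtype
  have hcov' : ⋃ p : s, (chartAt (Coord n) (p : M)).source = univ := by
    rw [← hcov, biUnion_eq_iUnion]
  refine (Measure.ext_iff_of_iUnion_eq_univ hcov').2 fun p => Measure.ext fun A hA => ?_
  have hp : chartAt (Coord n) (p : M) ∈ IsManifold.maximalAtlas (𝓡 n) ∞ M :=
    IsManifold.chart_mem_maximalAtlas (p : M)
  have hm := hA.inter (chartAt (Coord n) (p : M)).open_source.measurableSet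
  rw [Measure.restrict_apply hA, Measure.restrict_apply hA, Measure.restrict_apply hm,
    riemannianVolume_apply_of_subset_chartAt (p : M) (hm.inter φ.open_source.measurableSet)
      (inter_subset_left.trans inter_subset_right),
    chartMeasure_eq_of_subset hp hφ (hm.inter φ.open_source.measurableSet)
      (inter_subset_left.trans inter_subset_right) inter_subset_right]
  refine le_antisymm (measure_mono inter_subset_left) ?_
  calc _ ≤ chartMeasure φ (A ∩ (chartAt (Coord n) (p : M)).source ∩ φ.source)
        + chartMeasure φ φ.sourceᶜ := by
          refine (measure_mono ?_).trans (measure_union_le _ _)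
          intro x hx
          by_cases h : x ∈ φ.source
          · exact Or.inl ⟨hx, h⟩
          · exact Or.inr h
    _ = _ := by rw [chartMeasure_compl_source, add_zero]

variable [SecondCountableTopology M]

lemma riemannianVolume_apply_of_subset {φ : OpenPartialHomeomorph M (Coord n)}
    (hφ : φ ∈ IsManifold.maximalAtlas (𝓡 n) ∞ M) {A : Set M} (hA : MeasurableSet A)
    (hAs : A ⊆ φ.source) :
    riemannianVolume n A = ∫⁻ z in φ.target ∩ φ.symm ⁻¹' A, ENNReal.ofReal (densIn φ z) := by
  rw [← chartMeasure_apply φ hA, ← restrict_riemannianVolume hφ, Measure.restrict_apply hA,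
    inter_eq_self_of_subset_left hAs]

/-- The integral of a function vanishing outside of a chart. -/
lemma setIntegral_riemannianVolume {φ : OpenPartialHomeomorph M (Coord n)}
    (hφ : φ ∈ IsManifold.maximalAtlas (𝓡 n) ∞ M) {A : Set M} (hA : MeasurableSet A) {g : M → ℝ}
    (hg : AEStronglyMeasurable g (riemannianVolume n)) (h0 : ∀ x ∉ φ.source, g x = 0) :
    ∫ x in A, g x ∂(riemannianVolume n)
      = ∫ z in φ.target ∩ φ.symm ⁻¹' A, densIn φ z * g (φ.symm z) := by
  have h1 : ∫ x in A, g x ∂(riemannianVolume n) = ∫ x in A, g x ∂(chartMeasure φ) := by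
    rw [← restrict_riemannianVolume hφ, Measure.restrict_restrict hA]
    refine (setIntegral_eq_of_subset_of_forall_sdiff_eq_zero hA inter_subset_left ?_)
    intro x hx
    exact h0 x fun h => hx.2 ⟨hx.1, h⟩
  have hg' : AEStronglyMeasurable g (chartMeasure φ) := by
    rw [← restrict_riemannianVolume hφ]; exact hg.restrict
  have hdm : AEMeasurable (fun z => Real.toNNReal (densIn φ z)) (volume.restrict φ.target) :=
    ((contDiffOn_densIn hφ).continuousOn.aemeasurable φ.open_target.measurableSet).real_toNNReal
  rw [h1, ← integral_indicator hA]
  unfold chartMeasure at hg' ⊢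
  rw [integral_map (aemeasurable_symm φ) (hg'.indicator hA)]
  have h2 := integral_withDensity_eq_integral_smul₀ hdm
    (fun z => A.indicator g (φ.symm z))
  refine h2.trans ?_
  rw [← integral_indicator φ.open_target.measurableSet,
    ← integral_indicator (measurableSet_target_inter φ hA)]
  congr 1
  funext z
  by_cases hz : z ∈ φ.target <;> by_cases hzA : φ.symm z ∈ A
  · rw [indicator_of_mem hz, indicator_of_mem hzA, indicator_of_mem (by exact ⟨hz, hzA⟩),
      NNReal.smul_def, Real.coe_toNNReal _ (densIn_pos hφ hz).le, smul_eq_mul]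
  · rw [indicator_of_mem hz, indicator_of_notMem hzA, indicator_of_notMem (fun h => hzA h.2),
      smul_zero]
  · rw [indicator_of_notMem hz, indicator_of_notMem (fun h => hz h.1)]
  · rw [indicator_of_notMem hz, indicator_of_notMem (fun h => hz h.1)]

instance instIsLocallyFiniteMeasure :
    IsLocallyFiniteMeasure (riemannianVolume n : Measure M) := by
  refine ⟨fun x => ?_⟩
  set φ := chartAt (Coord n) x
  have hφ : φ ∈ IsManifold.maximalAtlas (𝓡 n) ∞ M := IsManifold.chart_mem_maximalAtlas x
  have hxs : x ∈ φ.source := mem_chart_source _ x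
  obtain ⟨r, hr, hrt⟩ := Metric.nhds_basis_closedBall.mem_iff.1
    (φ.open_target.mem_nhds (φ.map_source hxs))
  have hU : φ.source ∩ φ ⁻¹' Metric.ball (φ x) r ∈ 𝓝 x :=
    (φ.isOpen_inter_preimage Metric.isOpen_ball).mem_nhds ⟨hxs, Metric.mem_ball_self hr⟩
  refine ⟨_, hU, ?_⟩
  rw [riemannianVolume_apply_of_subset hφ (φ.isOpen_inter_preimage Metric.isOpen_ball).measurableSet
    inter_subset_left]
  have hsub : φ.target ∩ φ.symm ⁻¹' (φ.source ∩ φ ⁻¹' Metric.ball (φ x) r)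
      ⊆ Metric.closedBall (φ x) r := by
    rintro z ⟨hz, -, h2⟩
    simp only [mem_preimage] at h2
    rw [φ.right_inv hz] at h2
    exact Metric.ball_subset_closedBall h2
  refine (lintegral_mono_set hsub).trans_lt ?_
  obtain ⟨B, hB⟩ := (isCompact_closedBall (φ x) r).exists_bound_of_continuousOn
    ((contDiffOn_densIn hφ).continuousOn.mono hrt)
  calc _ ≤ ∫⁻ z in Metric.closedBall (φ x) r, ENNReal.ofReal B := by
        refine setLIntegral_mono measurable_const fun z hz => ?_
        exact ENNReal.ofReal_le_ofReal ((le_abs_self _).trans (hB z hz))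
    _ < ⊤ := by
        rw [lintegral_const]
        refine ENNReal.mul_lt_top ENNReal.ofReal_lt_top ?_
        rw [Measure.restrict_apply_univ]
        exact (isCompact_closedBall (φ x) r).measure_lt_top

/-- This lets continuous functions that agree almost everywhere be identified, as in the chart
independence of the divergence. -/
instance instIsOpenPosMeasure :
    (riemannianVolume n : Measure M).IsOpenPosMeasure := by
  refine ⟨fun U hU hne h0 => ?_⟩
  obtain ⟨x, hx⟩ := hne
  set φ := chartAt (Coord n) x
  have hφ : φ ∈ IsManifold.maximalAtlas (𝓡 n) ∞ M := IsManifold.chart_mem_maximalAtlas x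
  have hxs : x ∈ φ.source := mem_chart_source _ x
  have hO : IsOpen (φ.target ∩ φ.symm ⁻¹' (U ∩ φ.source)) :=
    φ.symm.isOpen_inter_preimage (hU.inter φ.open_source)
  have h1 := measure_mono_null (inter_subset_left : U ∩ φ.source ⊆ U) h0
  rw [riemannianVolume_apply_of_subset hφ (hU.inter φ.open_source).measurableSet
    inter_subset_right] at h1
  have hdm : AEMeasurable (fun z => ENNReal.ofReal (densIn φ z))
      (volume.restrict (φ.target ∩ φ.symm ⁻¹' (U ∩ φ.source))) :=
    (((contDiffOn_densIn hφ).continuousOn.mono inter_subset_left).aemeasurable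
      hO.measurableSet).ennreal_ofReal
  have h2 := (lintegral_eq_zero_iff' hdm).1 h1
  have h3 : ∀ᵐ z ∂(volume.restrict (φ.target ∩ φ.symm ⁻¹' (U ∩ φ.source))), False := by
    filter_upwards [h2, ae_restrict_mem hO.measurableSet] with z hz hzO
    exact (ENNReal.ofReal_pos.2 (densIn_pos hφ hzO.1)).ne' hz
  rw [ae_iff] at h3
  simp only [not_false_eq_true, ofPred_true, Measure.restrict_apply_univ] at h3
  have hne : (φ.target ∩ φ.symm ⁻¹' (U ∩ φ.source)).Nonempty :=
    ⟨φ x, φ.map_source hxs, by simpa [φ.left_inv hxs] using ⟨hx, hxs⟩⟩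
  exact (hO.measure_pos volume hne).ne' h3

end Volume

end WeakIMCF
end

noncomputable section

namespace WeakIMCF

/-! ### The divergence in a chart -/

section Euclidean

variable {n : ℕ}

lemma ediv_eq_zero_of_notMem_tsupport {W : Coord n → Coord n} {z : Coord n}
    (hz : z ∉ tsupport W) : ediv W z = 0 := by
  unfold ediv
  refine Finset.sum_eq_zero fun i _ => ?_
  have h : W =ᶠ[𝓝 z] 0 := notMem_tsupport_iff_eventuallyEq.1 hz
  rw [h.fderiv_eq]
  simp

lemma continuous_ediv {W : Coord n → Coord n} (hW : ContDiff ℝ 1 W) : Continuous (ediv W) := by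
  unfold ediv
  refine continuous_finsetSum _ fun i _ => ?_
  have h : Continuous fun z => fderiv ℝ W z (EuclideanSpace.single i (1 : ℝ)) :=
    (hW.continuous_fderiv one_ne_zero).clm_apply continuous_const
  fun_prop

lemma hasCompactSupport_ediv {W : Coord n → Coord n} (hc : HasCompactSupport W) :
    HasCompactSupport (ediv W) :=
  HasCompactSupport.intro hc fun _ hz => ediv_eq_zero_of_notMem_tsupport hz

lemma integrable_ediv {W : Coord n → Coord n} (hW : ContDiff ℝ 1 W) (hc : HasCompactSupport W) :
    Integrable (ediv W) :=
  (continuous_ediv hW).integrable_of_hasCompactSupport (hasCompactSupport_ediv hc)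

lemma ediv_add {W V : Coord n → Coord n} {z : Coord n} (hW : DifferentiableAt ℝ W z)
    (hV : DifferentiableAt ℝ V z) : ediv (fun y => W y + V y) z = ediv W z + ediv V z := by
  unfold ediv
  rw [← Finset.sum_add_distrib]
  refine Finset.sum_congr rfl fun i _ => ?_
  rw [fderiv_fun_add hW hV]
  simp

lemma ediv_smul {h : Coord n → ℝ} {W : Coord n → Coord n} {z : Coord n}
    (hh : DifferentiableAt ℝ h z) (hW : DifferentiableAt ℝ W z) :
    ediv (fun y => h y • W y) z = h z * ediv W z + fderiv ℝ h z (W z) := by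
  unfold ediv
  have hw : W z = ∑ i, W z i • (EuclideanSpace.single i (1 : ℝ) : Coord n) := by
    simpa using ((EuclideanSpace.basisFun (Fin n) ℝ).sum_repr (W z)).symm
  conv_rhs => rw [hw]
  rw [map_sum, Finset.mul_sum, ← Finset.sum_add_distrib]
  refine Finset.sum_congr rfl fun i _ => ?_
  rw [fderiv_fun_smul hh hW, map_smul]
  simp [mul_comm]

lemma ediv_congr {W V : Coord n → Coord n} {z : Coord n} (h : W =ᶠ[𝓝 z] V) :
    ediv W z = ediv V z := by
  unfold ediv
  rw [h.fderiv_eq]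

lemma integral_ediv {W : Coord n → Coord n} (hW : ContDiff ℝ 1 W) (hc : HasCompactSupport W) :
    ∫ z, ediv W z = 0 := by
  have hi : ∀ i : Fin n, Integrable fun z =>
      (fderiv ℝ W z (EuclideanSpace.single i (1 : ℝ))) := fun i =>
    ((hW.continuous_fderiv one_ne_zero).clm_apply continuous_const).integrable_of_hasCompactSupport
      (hc.fderiv_apply (𝕜 := ℝ) _)
  have hi' : ∀ i : Fin n, Integrable fun z =>
      (fderiv ℝ W z (EuclideanSpace.single i (1 : ℝ))) i := fun i =>
    (EuclideanSpace.proj (𝕜 := ℝ) i).integrable_comp (hi i)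
  unfold ediv
  rw [integral_finsetSum _ fun i _ => hi' i]
  refine Finset.sum_eq_zero fun i _ => ?_
  have h1 := (EuclideanSpace.proj (𝕜 := ℝ) i).integral_comp_comm (hi i)
  refine h1.trans ?_
  -- Integration by parts against the constant `1`, whose derivative vanishes.
  have h2 := integral_smul_fderiv_eq_neg_fderiv_smul_of_integrable (μ := volume)
    (f := fun _ : Coord n => (1 : ℝ)) (g := W) (v := EuclideanSpace.single i (1 : ℝ))
    (by simp) (by simpa using hi i)
    (by simpa using hW.continuous.integrable_of_hasCompactSupport hc)
    (fun x _ => differentiableAt_const _) (fun x _ => hW.differentiable one_ne_zero x)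
  simp only [one_smul, fderiv_fun_const, Pi.zero_apply, zero_apply, zero_smul,
    integral_zero, neg_zero] at h2
  rw [h2]
  simp

end Euclidean

/-! ### The Riemannian divergence and its independence of the chart -/

section Divergence

variable {n : ℕ} {M : Type*} [EMetricSpace M] [ChartedSpace (Coord n) M]
  [RiemannianBundle (fun x : M => TangentSpace (𝓡 n) x)] [IsManifold (𝓡 n) ∞ M]
  [IsContMDiffRiemannianBundle (𝓡 n) ∞ (Coord n) (fun x : M => TangentSpace (𝓡 n) x)]

/-- A vector field of class `C^1`. -/
abbrev IsC1 (X : (x : M) → TangentSpace (𝓡 n) x) : Prop :=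
  ContMDiff (𝓡 n) (𝓡 n).tangent 1 (fun x => (⟨x, X x⟩ : TangentBundle (𝓡 n) M))

lemma IsC1.smul {X : (x : M) → TangentSpace (𝓡 n) x} (hX : IsC1 X) {h : M → ℝ}
    (hh : ContMDiff (𝓡 n) 𝓘(ℝ, ℝ) 1 h) : IsC1 (fun x => h x • X x) :=
  ContMDiff.smul_section hh hX

lemma IsC1.add {X Y : (x : M) → TangentSpace (𝓡 n) x} (hX : IsC1 X) (hY : IsC1 Y) :
    IsC1 (fun x => X x + Y x) :=
  ContMDiff.add_section hX hY

/-- The divergence computed in a given chart. -/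
def divIn (φ : OpenPartialHomeomorph M (Coord n)) (X : (x : M) → TangentSpace (𝓡 n) x) (x : M) :
    ℝ := (densIn φ (φ x))⁻¹ * ediv (weighted φ X) (φ x)

lemma contDiffOn_weighted {φ : OpenPartialHomeomorph M (Coord n)}
    (hφ : φ ∈ IsManifold.maximalAtlas (𝓡 n) ∞ M) {X : (x : M) → TangentSpace (𝓡 n) x}
    (hX : IsC1 X) : ContDiffOn ℝ 1 (weighted φ X) φ.target :=
  (contDiffOn_densIn hφ).smul (contDiffOn_compIn hφ hX)

lemma divergence_eq_divIn_chartAt {X : (x : M) → TangentSpace (𝓡 n) x} (hX : IsC1 X) (x : M) :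
    divergence X x = divIn (chartAt (Coord n) x) X x := by
  have hφ : chartAt (Coord n) x ∈ IsManifold.maximalAtlas (𝓡 n) ∞ M :=
    IsManifold.chart_mem_maximalAtlas x
  have hd : DifferentiableAt ℝ (weighted (chartAt (Coord n) x) X) (chartAt (Coord n) x x) :=
    ((contDiffOn_weighted hφ hX).contDiffAt ((chartAt (Coord n) x).open_target.mem_nhds
      (mem_chart_target (Coord n) x))).differentiableAt one_ne_zero
  unfold divergence divIn ediv
  congr 1
  refine Finset.sum_congr rfl fun i _ => ?_
  have h1 : HasFDerivAt (fun z => (weighted (chartAt (Coord n) x) X z) i)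
      ((EuclideanSpace.proj (𝕜 := ℝ) i).comp
        (fderiv ℝ (weighted (chartAt (Coord n) x) X) (chartAt (Coord n) x x)))
      (chartAt (Coord n) x x) :=
    (EuclideanSpace.proj (𝕜 := ℝ) i).hasFDerivAt.comp _ hd.hasFDerivAt
  have h2 : (fun z => volDensity x z * coordComp X x i z) =
      fun z => (weighted (chartAt (Coord n) x) X z) i := by
    funext z
    rfl
  rw [h2, h1.fderiv]
  rfl

lemma continuousOn_divIn {φ : OpenPartialHomeomorph M (Coord n)}
    (hφ : φ ∈ IsManifold.maximalAtlas (𝓡 n) ∞ M) {X : (x : M) → TangentSpace (𝓡 n) x}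
    (hX : IsC1 X) : ContinuousOn (divIn φ X) φ.source := by
  have h1 : ContinuousOn (ediv (weighted φ X)) φ.target := by
    unfold ediv
    refine continuousOn_finsetSum _ fun i _ => ?_
    have h : ContinuousOn (fun z => fderiv ℝ (weighted φ X) z (EuclideanSpace.single i (1 : ℝ)))
        φ.target :=
      ((contDiffOn_weighted hφ hX).continuousOn_fderiv_of_isOpen φ.open_target le_rfl).clm_apply
        continuousOn_const
    exact (EuclideanSpace.proj (𝕜 := ℝ) i).continuous.comp_continuousOn h
  have hm : MapsTo φ φ.source φ.target := φ.mapsTo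
  exact (((contDiffOn_densIn hφ).continuousOn.comp φ.continuousOn hm).inv₀
    (fun x hx => (densIn_pos hφ (φ.map_source hx)).ne')).mul (h1.comp φ.continuousOn hm)

/-- The derivative of a function in the direction of a vector field. -/
def dirDeriv (h : M → ℝ) (X : (x : M) → TangentSpace (𝓡 n) x) (x : M) : ℝ :=
  mfderiv (𝓡 n) 𝓘(ℝ, ℝ) h x (X x)

variable [MeasurableSpace M] [BorelSpace M] [SecondCountableTopology M]

/-- Integration by parts against a function supported in a chart. -/
lemma integral_smul_divIn {φ : OpenPartialHomeomorph M (Coord n)}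
    (hφ : φ ∈ IsManifold.maximalAtlas (𝓡 n) ∞ M) {X : (x : M) → TangentSpace (𝓡 n) x}
    (hX : IsC1 X) {h : M → ℝ} (hh : ContMDiff (𝓡 n) 𝓘(ℝ, ℝ) ∞ h) (hc : HasCompactSupport h)
    (hs : tsupport h ⊆ φ.source) :
    ∫ x, h x * divIn φ X x ∂(riemannianVolume n)
      = -∫ x, dirDeriv h X x ∂(riemannianVolume n) := by
  -- The field `h • X` has compact support in the chart, so the Euclidean divergence of its weighted
  -- components has integral zero. The product rule splits that integral into the two sides.
  obtain ⟨W, hW1, hWc, -, hWt, hWX⟩ := exists_eq_fieldOf hφ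
    (hX.smul (hh.of_le (by exact mod_cast le_top))) hc hs
    (fun x hx => by simp [image_eq_zero_of_notMem_tsupport hx])
  have hint := integral_ediv hW1 hWc
  have hWz : ∀ z ∈ φ.target, W =ᶠ[𝓝 z] fun y => (h ∘ φ.symm) y • weighted φ X y := by
    intro z hz
    filter_upwards [φ.open_target.mem_nhds hz] with y hy
    rw [← weighted_fieldOf hφ hy (W := W), hWX]
    simp only [weighted, compIn, map_smul, Function.comp]
    rw [smul_comm]
  have hmf : ∀ z ∈ φ.target, fderiv ℝ (h ∘ φ.symm) z (weighted φ X z)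
      = densIn φ z * dirDeriv h X (φ.symm z) := by
    intro z hz
    have h1 : HasMFDerivAt 𝓘(ℝ, Coord n) (𝓡 n) φ.symm z (frame φ z) :=
      ((contMDiffAt_symm_of_mem_maximalAtlas hφ hz).mdifferentiableAt (by simp)).hasMFDerivAt
    have h2 := ((hh (φ.symm z)).mdifferentiableAt (by simp)).hasMFDerivAt
    have h3 : HasFDerivAt (h ∘ φ.symm)
        ((mfderiv (𝓡 n) 𝓘(ℝ, ℝ) h (φ.symm z)).comp (frame φ z) : Coord n →L[ℝ] ℝ) z :=
      hasMFDerivAt_iff_hasFDerivAt.1 (HasMFDerivAt.comp z h2 h1)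
    have h4 : fderiv ℝ (h ∘ φ.symm) z =
        ((mfderiv (𝓡 n) 𝓘(ℝ, ℝ) h (φ.symm z)).comp (frame φ z) : Coord n →L[ℝ] ℝ) :=
      HasFDerivAt.fderiv (𝕜 := ℝ) (E := Coord n) (F := ℝ) h3
    rw [h4]
    refine (ContinuousLinearMap.map_smul
      ((mfderiv (𝓡 n) 𝓘(ℝ, ℝ) h (φ.symm z)).comp (frame φ z) : Coord n →L[ℝ] ℝ)
      (densIn φ z) (compIn φ X z)).trans ?_
    have h6 : mfderiv (𝓡 n) 𝓘(ℝ, ℝ) h (φ.symm z)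
        (frame φ z (coframe φ (φ.symm z) (X (φ.symm z)))) =
        mfderiv (𝓡 n) 𝓘(ℝ, ℝ) h (φ.symm z) (X (φ.symm z)) := by rw [frame_coframe hφ hz]
    exact congrArg (fun t : ℝ => densIn φ z * t) h6
  have hcont1 : Continuous fun x => h x * divIn φ X x := by
    refine ContinuousOn.continuous_of_tsupport_subset
      (hh.continuous.continuousOn.mul (continuousOn_divIn hφ hX)) φ.open_source ?_
    exact (tsupport_mul_subset_left).trans hs
  have hcont2 : Continuous fun x => dirDeriv h X x := by
    have h1 : ContMDiff (𝓡 n).tangent 𝓘(ℝ, ℝ).tangent 0 (tangentMap (𝓡 n) 𝓘(ℝ, ℝ) h) :=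
      hh.contMDiff_tangentMap (by simp)
    have h2 := h1.continuous.comp hX.continuous
    have h3 : Continuous fun v : TangentBundle 𝓘(ℝ, ℝ) ℝ => (v.2 : ℝ) :=
      continuous_snd.comp (tangentBundleModelSpaceHomeomorph 𝓘(ℝ, ℝ)).continuous
    exact h3.comp h2
  have hz2 : ∀ x ∉ tsupport h, dirDeriv h X x = 0 := fun x hx => by
    have : h =ᶠ[𝓝 x] fun _ => 0 := notMem_tsupport_iff_eventuallyEq.1 hx
    unfold dirDeriv
    rw [this.mfderiv_eq, mfderiv_const]
    rfl
  have e1 := setIntegral_riemannianVolume hφ MeasurableSet.univ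
    ((hcont1.add hcont2).aestronglyMeasurable (μ := riemannianVolume n)) (fun x hx => by
      change h x * divIn φ X x + dirDeriv h X x = (0 : ℝ)
      rw [image_eq_zero_of_notMem_tsupport fun h => hx (hs h), hz2 x fun h => hx (hs h), zero_mul,
        add_zero])
  simp only [Measure.restrict_univ, preimage_univ, inter_univ, Pi.add_apply] at e1
  have e3 : ∫ z in φ.target, ediv W z = 0 := by
    rw [setIntegral_eq_integral_of_forall_compl_eq_zero, hint]
    exact fun z hz => ediv_eq_zero_of_notMem_tsupport fun h => hz (hWt h)
  have e4 : ∀ z ∈ φ.target, densIn φ z * (h (φ.symm z) * divIn φ X (φ.symm z)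
      + dirDeriv h X (φ.symm z)) = ediv W z := by
    intro z hz
    have hd1 : DifferentiableAt ℝ (h ∘ φ.symm) z := by
      have h1 := (contMDiffAt_symm_of_mem_maximalAtlas hφ hz).mdifferentiableAt (by simp)
      exact (((hh (φ.symm z)).mdifferentiableAt (by simp)).comp z h1).differentiableAt
    have hd2 : DifferentiableAt ℝ (weighted φ X) z :=
      ((contDiffOn_weighted hφ hX).contDiffAt (φ.open_target.mem_nhds hz)).differentiableAt
        one_ne_zero
    rw [ediv_congr (hWz z hz), ediv_smul hd1 hd2, hmf z hz]
    unfold divIn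
    rw [φ.right_inv hz]
    have := (densIn_pos hφ hz).ne'
    simp only [Function.comp]
    rw [mul_add]
    field_simp
  rw [setIntegral_congr_fun φ.open_target.measurableSet e4, e3] at e1
  have hi1 : Integrable (fun x => h x * divIn φ X x) (riemannianVolume n) :=
    hcont1.integrable_of_hasCompactSupport hc.mul_right
  have hi2 : Integrable (fun x => dirDeriv h X x) (riemannianVolume n) :=
    hcont2.integrable_of_hasCompactSupport (HasCompactSupport.intro hc hz2)
  have e5 := (integral_add hi1 hi2).symm.trans e1
  linarith

/-- The divergence does not depend on the chart. -/
lemma divIn_eq_divIn {φ ψ : OpenPartialHomeomorph M (Coord n)}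
    (hφ : φ ∈ IsManifold.maximalAtlas (𝓡 n) ∞ M) (hψ : ψ ∈ IsManifold.maximalAtlas (𝓡 n) ∞ M)
    {X : (x : M) → TangentSpace (𝓡 n) x} (hX : IsC1 X) :
    EqOn (divIn φ X) (divIn ψ X) (φ.source ∩ ψ.source) := by
  have hO : IsOpen (φ.source ∩ ψ.source) := φ.open_source.inter ψ.open_source
  have hc1 := (continuousOn_divIn hφ hX).mono (inter_subset_left (t := ψ.source))
  have hc2 := (continuousOn_divIn hψ hX).mono (inter_subset_right (s := φ.source))
  have : LocallyCompactSpace M := ChartedSpace.locallyCompactSpace (Coord n) M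
  -- After integration by parts the integral against a test function is `-∫ dh(X)`, which involves
  -- no chart. This avoids transforming second derivatives of transition maps.
  have h1 := hO.ae_eq_zero_of_integral_contMDiff_smul_eq_zero (𝓡 n)
    (μ := (riemannianVolume n : Measure M)) (f := fun x => divIn φ X x - divIn ψ X x)
    ((hc1.sub hc2).locallyIntegrableOn hO.measurableSet) (fun g hg hgc hgs => by
      have a1 := integral_smul_divIn hφ hX hg hgc (hgs.trans inter_subset_left)
      have a2 := integral_smul_divIn hψ hX hg hgc (hgs.trans inter_subset_right)
      have b1 : Continuous fun x => g x * divIn φ X x :=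
        ContinuousOn.continuous_of_tsupport_subset
          (hg.continuous.continuousOn.mul (continuousOn_divIn hφ hX)) φ.open_source
          (tsupport_mul_subset_left.trans (hgs.trans inter_subset_left))
      have b2 : Continuous fun x => g x * divIn ψ X x :=
        ContinuousOn.continuous_of_tsupport_subset
          (hg.continuous.continuousOn.mul (continuousOn_divIn hψ hX)) ψ.open_source
          (tsupport_mul_subset_left.trans (hgs.trans inter_subset_right))
      simp only [smul_eq_mul, mul_sub]
      rw [integral_sub (b1.integrable_of_hasCompactSupport hgc.mul_right)
        (b2.integrable_of_hasCompactSupport hgc.mul_right), a1, a2, sub_self])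
  refine Measure.eqOn_open_of_ae_eq (μ := (riemannianVolume n : Measure M)) ?_ hO hc1 hc2
  refine (ae_restrict_iff' hO.measurableSet).2 ?_
  filter_upwards [h1] with x hx hxO
  exact sub_eq_zero.1 (hx hxO)

lemma divergence_eq_divIn {φ : OpenPartialHomeomorph M (Coord n)}
    (hφ : φ ∈ IsManifold.maximalAtlas (𝓡 n) ∞ M) {X : (x : M) → TangentSpace (𝓡 n) x}
    (hX : IsC1 X) {x : M} (hx : x ∈ φ.source) : divergence X x = divIn φ X x := by
  rw [divergence_eq_divIn_chartAt hX]
  exact divIn_eq_divIn (IsManifold.chart_mem_maximalAtlas x) hφ hX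
    ⟨mem_chart_source (Coord n) x, hx⟩

lemma continuous_divergence {X : (x : M) → TangentSpace (𝓡 n) x} (hX : IsC1 X) :
    Continuous (divergence X) := by
  rw [continuous_iff_continuousAt]
  intro x
  have hφ : chartAt (Coord n) x ∈ IsManifold.maximalAtlas (𝓡 n) ∞ M :=
    IsManifold.chart_mem_maximalAtlas x
  have hn := (chartAt (Coord n) x).open_source.mem_nhds (mem_chart_source (Coord n) x)
  refine ((continuousOn_divIn hφ hX).continuousAt hn).congr ?_
  filter_upwards [hn] with y hy
  exact (divergence_eq_divIn hφ hX hy).symm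

lemma divergence_add {X Y : (x : M) → TangentSpace (𝓡 n) x} (hX : IsC1 X) (hY : IsC1 Y) (x : M) :
    divergence (fun y => X y + Y y) x = divergence X x + divergence Y x := by
  have hφ : chartAt (Coord n) x ∈ IsManifold.maximalAtlas (𝓡 n) ∞ M :=
    IsManifold.chart_mem_maximalAtlas x
  rw [divergence_eq_divIn_chartAt (hX.add hY), divergence_eq_divIn_chartAt hX,
    divergence_eq_divIn_chartAt hY]
  unfold divIn
  have hd : ∀ {Z : (x : M) → TangentSpace (𝓡 n) x}, IsC1 Z → DifferentiableAt ℝ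
      (weighted (chartAt (Coord n) x) Z) (chartAt (Coord n) x x) := fun hZ =>
    ((contDiffOn_weighted hφ hZ).contDiffAt ((chartAt (Coord n) x).open_target.mem_nhds
      (mem_chart_target (Coord n) x))).differentiableAt one_ne_zero
  rw [← mul_add, ← ediv_add (hd hX) (hd hY)]
  congr 2
  funext z
  simp [weighted, compIn]

lemma divergence_const_smul {X : (x : M) → TangentSpace (𝓡 n) x} (hX : IsC1 X) (c : ℝ) (x : M) :
    divergence (fun y => c • X y) x = c * divergence X x := by
  have hφ : chartAt (Coord n) x ∈ IsManifold.maximalAtlas (𝓡 n) ∞ M :=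
    IsManifold.chart_mem_maximalAtlas x
  rw [divergence_eq_divIn_chartAt (hX.smul contMDiff_const), divergence_eq_divIn_chartAt hX]
  unfold divIn
  have hd : DifferentiableAt ℝ (weighted (chartAt (Coord n) x) X) (chartAt (Coord n) x x) :=
    ((contDiffOn_weighted hφ hX).contDiffAt ((chartAt (Coord n) x).open_target.mem_nhds
      (mem_chart_target (Coord n) x))).differentiableAt one_ne_zero
  have h1 := ediv_smul (h := fun _ => c) (differentiableAt_const c) hd
  simp only [fderiv_fun_const, Pi.zero_apply, zero_apply, add_zero] at h1
  have h2 : weighted (chartAt (Coord n) x) (fun y => c • X y) =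
      fun y => c • weighted (chartAt (Coord n) x) X y := by
    funext z
    simp only [weighted, compIn, map_smul]
    rw [smul_comm]
  rw [h2, h1]
  ring

lemma divergence_eq_zero {X : (x : M) → TangentSpace (𝓡 n) x} (hX : IsC1 X) {x : M}
    (h : ∀ᶠ y in 𝓝 x, X y = 0) : divergence X x = 0 := by
  rw [divergence_eq_divIn_chartAt hX]
  unfold divIn
  have ht := mem_chart_target (Coord n) x
  have hc : Filter.Tendsto (chartAt (Coord n) x).symm (𝓝 (chartAt (Coord n) x x)) (𝓝 x) := by
    have := (chartAt (Coord n) x).continuousAt_symm ht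
    rwa [ContinuousAt, (chartAt (Coord n) x).left_inv (mem_chart_source (Coord n) x)] at this
  have h1 : weighted (chartAt (Coord n) x) X =ᶠ[𝓝 (chartAt (Coord n) x x)] fun _ => 0 := by
    filter_upwards [hc.eventually h] with z hz
    simp [weighted, compIn, hz]
  rw [ediv_congr h1]
  simp [ediv]

lemma divergence_eq_zero_of_notMem {X : (x : M) → TangentSpace (𝓡 n) x} (hX : IsC1 X) {C : Set M}
    (hC : IsClosed C) (h0 : ∀ x ∉ C, X x = 0) {x : M} (hx : x ∉ C) : divergence X x = 0 :=
  divergence_eq_zero hX (Filter.mem_of_superset (hC.isOpen_compl.mem_nhds hx) h0)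

lemma integrable_divergence {X : (x : M) → TangentSpace (𝓡 n) x} (hX : IsC1 X) {C : Set M}
    (hC : IsCompact C) (h0 : ∀ x ∉ C, X x = 0) :
    Integrable (divergence X) (riemannianVolume n) :=
  (continuous_divergence hX).integrable_of_hasCompactSupport
    (HasCompactSupport.intro hC fun _ hx => divergence_eq_zero_of_notMem hX hC.isClosed h0 hx)

/-- The integral of the divergence of a field supported in a chart. -/
lemma setIntegral_divergence_fieldOf {φ : OpenPartialHomeomorph M (Coord n)}
    (hφ : φ ∈ IsManifold.maximalAtlas (𝓡 n) ∞ M) {W : Coord n → Coord n}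
    (hW1 : ContDiff ℝ 1 W) (hc : HasCompactSupport W) (hW : tsupport W ⊆ φ.target)
    {A : Set M} (hA : MeasurableSet A) :
    ∫ x in A, divergence (fieldOf φ W) x ∂(riemannianVolume n)
      = ∫ z in φ.target ∩ φ.symm ⁻¹' A, ediv W z := by
  have hX : IsC1 (fieldOf φ W) := contMDiff_fieldOf hφ hW1 hc hW
  rw [setIntegral_riemannianVolume hφ hA (continuous_divergence hX).aestronglyMeasurable]
  · refine setIntegral_congr_fun (measurableSet_target_inter φ hA) fun z hz => ?_
    rw [divergence_eq_divIn hφ hX (φ.map_target hz.1)]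
    unfold divIn
    rw [φ.right_inv hz.1, mul_inv_cancel_left₀ (densIn_pos hφ hz.1).ne']
    refine ediv_congr ?_
    filter_upwards [φ.open_target.mem_nhds hz.1] with y hy
    exact weighted_fieldOf hφ hy
  · intro x hx
    refine divergence_eq_zero_of_notMem hX (isCompact_symm_image_tsupport hc hW).isClosed
      (fun y hy => fieldOf_of_notMem hy) fun h => hx ?_
    obtain ⟨z, hz, rfl⟩ := h
    exact φ.map_target (hW hz)

end Divergence

end WeakIMCF
end

noncomputable section

namespace WeakIMCF

/-! ### Elementary properties of the perimeter -/

section Perimeter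

variable {n : ℕ} {M : Type*} [EMetricSpace M] [ChartedSpace (Coord n) M]
  [RiemannianBundle (fun x : M => TangentSpace (𝓡 n) x)] [IsManifold (𝓡 n) ∞ M]
  [IsContMDiffRiemannianBundle (𝓡 n) ∞ (Coord n) (fun x : M => TangentSpace (𝓡 n) x)]
  [MeasurableSpace M] [BorelSpace M] [SecondCountableTopology M]

/-- The integral of the divergence of a field over a set. -/
def divInt (A : Set M) (X : (x : M) → TangentSpace (𝓡 n) x) : ℝ :=
  ∫ x in A, divergence X x ∂(riemannianVolume n)

/-- The field vanishes outside of a compact subset of `U`. -/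
def SupportedIn (U : Set M) (X : (x : M) → TangentSpace (𝓡 n) x) : Prop :=
  ∃ C ⊆ U, IsCompact C ∧ ∀ x ∉ C, X x = 0

lemma SupportedIn.mono {U V : Set M} {X : (x : M) → TangentSpace (𝓡 n) x}
    (h : SupportedIn U X) (hUV : U ⊆ V) : SupportedIn V X :=
  let ⟨C, hC, h⟩ := h
  ⟨C, hC.trans hUV, h⟩

lemma SupportedIn.add {U : Set M} {X Y : (x : M) → TangentSpace (𝓡 n) x}
    (hX : SupportedIn U X) (hY : SupportedIn U Y) : SupportedIn U (fun x => X x + Y x) := by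
  obtain ⟨C, hC, hCc, hC0⟩ := hX
  obtain ⟨D, hD, hDc, hD0⟩ := hY
  refine ⟨C ∪ D, union_subset hC hD, hCc.union hDc, fun x hx => ?_⟩
  simp only
  rw [hC0 x fun h => hx (Or.inl h), hD0 x fun h => hx (Or.inr h), add_zero]

lemma SupportedIn.smul {U : Set M} {X : (x : M) → TangentSpace (𝓡 n) x}
    (hX : SupportedIn U X) (h : M → ℝ) : SupportedIn U (fun x => h x • X x) := by
  obtain ⟨C, hC, hCc, hC0⟩ := hX
  exact ⟨C, hC, hCc, fun x hx => by simp only [hC0 x hx, smul_zero]⟩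

lemma SupportedIn.smul_left {U C : Set M} (hC : IsCompact C) (hCU : C ⊆ U)
    (X : (x : M) → TangentSpace (𝓡 n) x) {h : M → ℝ} (h0 : ∀ x ∉ C, h x = 0) :
    SupportedIn U (fun x => h x • X x) :=
  ⟨C, hCU, hC, fun x hx => by simp only [h0 x hx, zero_smul]⟩

lemma SupportedIn.integrable {U : Set M} {X : (x : M) → TangentSpace (𝓡 n) x} (hX : IsC1 X)
    (h : SupportedIn U X) : Integrable (divergence X) (riemannianVolume n) :=
  let ⟨_, _, hC, h0⟩ := h
  integrable_divergence hX hC h0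

lemma divInt_add {U V : Set M} {X Y : (x : M) → TangentSpace (𝓡 n) x} (hX : IsC1 X)
    (hY : IsC1 Y) (sX : SupportedIn U X) (sY : SupportedIn V Y) (A : Set M) :
    divInt A (fun x => X x + Y x) = divInt A X + divInt A Y := by
  unfold divInt
  rw [← integral_add (sX.integrable hX).integrableOn (sY.integrable hY).integrableOn]
  simp only [divergence_add hX hY]

lemma divInt_const_smul {X : (x : M) → TangentSpace (𝓡 n) x} (hX : IsC1 X) (c : ℝ) (A : Set M) :
    divInt A (fun x => c • X x) = c * divInt A X := by
  unfold divInt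
  rw [← integral_const_mul]
  simp only [divergence_const_smul hX]

lemma isC1_zero : IsC1 (fun x : M => (0 : TangentSpace (𝓡 n) x)) :=
  Bundle.contMDiff_zeroSection ℝ (fun x : M => TangentSpace (𝓡 n) x)

lemma divInt_zero (A : Set M) : divInt (n := n) A (fun _ => 0) = 0 := by
  unfold divInt
  have : divergence (fun x : M => (0 : TangentSpace (𝓡 n) x)) = fun _ => 0 := by
    funext x
    exact divergence_eq_zero isC1_zero (Filter.Eventually.of_forall fun _ => rfl)
  rw [this, integral_zero]

lemma isTestField_zero (U : Set M) : IsTestField (n := n) U (fun _ => 0) :=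
  ⟨isC1_zero, ⟨∅, empty_subset _, isCompact_empty, fun _ _ => rfl⟩, by simp⟩

lemma ofReal_divInt_le_perimeter {A U : Set M} {X : (x : M) → TangentSpace (𝓡 n) x}
    (hX : IsTestField U X) : ENNReal.ofReal (divInt A X) ≤ perimeter n A U :=
  le_iSup₂_of_le X hX le_rfl

/-- Mollified and sheared fields only satisfy `‖X‖ ≤ 1 + δ`; rescaling turns this into a factor in
front of the perimeter. -/
lemma ofReal_divInt_le_mul_perimeter {A U : Set M} {X : (x : M) → TangentSpace (𝓡 n) x}
    (hX : IsC1 X) (hs : SupportedIn U X) {c : ℝ} (hc : 0 < c) (hn : ∀ x, ‖X x‖ ≤ c) :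
    ENNReal.ofReal (divInt A X) ≤ ENNReal.ofReal c * perimeter n A U := by
  have h1 : IsTestField U (fun x => c⁻¹ • X x) := by
    refine ⟨IsC1.smul hX contMDiff_const, hs.smul _, fun x => ?_⟩
    rw [norm_smul, norm_inv, Real.norm_eq_abs, abs_of_pos hc, inv_mul_le_iff₀ hc, mul_one]
    exact hn x
  have h2 := ofReal_divInt_le_perimeter (A := A) h1
  rw [divInt_const_smul hX] at h2
  calc ENNReal.ofReal (divInt A X) = ENNReal.ofReal c * ENNReal.ofReal (c⁻¹ * divInt A X) := by
        rw [← ENNReal.ofReal_mul hc.le, mul_inv_cancel_left₀ hc.ne']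
    _ ≤ _ := by gcongr

lemma perimeter_le {A U : Set M} {R : ℝ≥0∞}
    (h : ∀ X, IsTestField (n := n) U X → ENNReal.ofReal (divInt A X) ≤ R) :
    perimeter n A U ≤ R :=
  iSup₂_le h

lemma exists_lt_ofReal_divInt {A U : Set M} {a : ℝ≥0∞} (h : a < perimeter n A U) :
    ∃ X, IsTestField (n := n) U X ∧ 0 < divInt A X ∧ a < ENNReal.ofReal (divInt A X) := by
  unfold perimeter at h
  simp only [lt_iSup_iff] at h
  obtain ⟨X, hX, h⟩ := h
  exact ⟨X, hX, ENNReal.ofReal_pos.1 (bot_le.trans_lt h), h⟩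

/-- It reduces a bound on a sum of perimeters to pairs of fields. Since `ENNReal.ofReal` truncates,
a field with negative integral is first replaced by zero; otherwise the sum of the truncations could
exceed the truncation of the sum. -/
lemma perimeter_add_le {A B U V : Set M} {R : ℝ≥0∞}
    (h : ∀ X Y, IsTestField (n := n) U X → IsTestField (n := n) V Y →
      ENNReal.ofReal (divInt A X + divInt B Y) ≤ R) :
    perimeter n A U + perimeter n B V ≤ R := by
  refine le_of_forall_lt fun c hc => ?_
  by_contra! hR
  have key : ∀ X Y, IsTestField (n := n) U X → IsTestField (n := n) V Y →
      ENNReal.ofReal (divInt A X) + ENNReal.ofReal (divInt B Y) ≤ R := by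
    intro X Y hX hY
    rcases le_total (divInt A X) 0 with h1 | h1
    · have := h _ Y (isTestField_zero U) hY
      rw [divInt_zero, zero_add] at this
      rwa [ENNReal.ofReal_of_nonpos h1, zero_add]
    · rcases le_total (divInt B Y) 0 with h2 | h2
      · have := h X _ hX (isTestField_zero V)
        rw [divInt_zero, add_zero] at this
        rwa [ENNReal.ofReal_of_nonpos h2, add_zero]
      · rw [← ENNReal.ofReal_add h1 h2]
        exact h X Y hX hY
  have h2 : perimeter n A U + perimeter n B V ≤ R := by
    unfold perimeter
    refine ENNReal.iSup_add_iSup_le fun X Y => ?_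
    by_cases hX : IsTestField U X <;> by_cases hY : IsTestField V Y
    · rw [iSup_pos hX, iSup_pos hY]
      exact key X Y hX hY
    · rw [iSup_pos hX, iSup_neg hY]
      exact (add_le_add_right bot_le _).trans (key X _ hX (isTestField_zero V))
    · rw [iSup_neg hX, iSup_pos hY]
      exact (add_le_add_left bot_le _).trans (key _ Y (isTestField_zero U) hY)
    · rw [iSup_neg hX, iSup_neg hY]
      simp
  exact (hc.trans_le (h2.trans hR)).false

lemma perimeter_mono {U V : Set M} (A : Set M) (h : U ⊆ V) :
    perimeter n A U ≤ perimeter n A V :=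
  perimeter_le fun _ hX =>
    ofReal_divInt_le_perimeter ⟨hX.1, SupportedIn.mono hX.2.1 h, hX.2.2⟩

lemma divInt_congr {A B U : Set M} {X : (x : M) → TangentSpace (𝓡 n) x} (hX : IsC1 X)
    (hs : SupportedIn U X) (hA : MeasurableSet A) (hB : MeasurableSet B)
    (h : ∀ x ∈ U, (x ∈ A ↔ x ∈ B)) : divInt A X = divInt B X := by
  obtain ⟨C, hCU, hC, h0⟩ := hs
  unfold divInt
  rw [← integral_indicator hA, ← integral_indicator hB]
  congr 1
  funext x
  by_cases hx : x ∈ C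
  · have := h x (hCU hx)
    by_cases hA : x ∈ A
    · rw [indicator_of_mem hA, indicator_of_mem (this.1 hA)]
    · rw [indicator_of_notMem hA, indicator_of_notMem (fun h => hA (this.2 h))]
  · have := divergence_eq_zero_of_notMem hX hC.isClosed h0 hx
    simp [indicator, this]

lemma perimeter_congr_ae {A B : Set M} (h : A =ᵐ[riemannianVolume n] B) (U : Set M) :
    perimeter n A U = perimeter n B U := by
  unfold perimeter
  simp only [setIntegral_congr_set h]

lemma perimeter_congr {A B U : Set M} (hA : MeasurableSet A) (hB : MeasurableSet B)
    (h : ∀ x ∈ U, (x ∈ A ↔ x ∈ B)) : perimeter n A U = perimeter n B U := by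
  refine le_antisymm (perimeter_le fun X hX => ?_) (perimeter_le fun X hX => ?_)
  · rw [divInt_congr hX.1 hX.2.1 hA hB h]
    exact ofReal_divInt_le_perimeter hX
  · rw [← divInt_congr hX.1 hX.2.1 hA hB h]
    exact ofReal_divInt_le_perimeter hX

lemma perimeter_empty (U : Set M) : perimeter n (∅ : Set M) U = 0 := by
  refine le_antisymm (perimeter_le fun X _ => ?_) bot_le
  simp [divInt]

variable (n) in
lemma exists_cutoff {C V : Set M} (hC : IsCompact C) (hV : IsOpen V) (hCV : C ⊆ V) :
    ∃ η : M → ℝ, ContMDiff (𝓡 n) 𝓘(ℝ, ℝ) ∞ η ∧ (∀ x ∈ C, ∀ᶠ y in 𝓝 x, η y = 1) ∧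
      (∃ D ⊆ V, IsCompact D ∧ ∀ x ∉ D, η x = 0) ∧ ∀ x, η x ∈ Icc (0 : ℝ) 1 := by
  have : LocallyCompactSpace M := ChartedSpace.locallyCompactSpace (Coord n) M
  obtain ⟨D, hD, hCD, hDV⟩ := exists_compact_between hC hV hCV
  obtain ⟨f, h1, h2, h3⟩ := exists_contMDiffMap_one_nhds_of_subset_interior (n := ⊤) (𝓡 n)
    hC.isClosed hCD
  exact ⟨f, f.contMDiff, eventually_nhdsSet_iff_forall.1 h1, ⟨D, hDV, hD, h2⟩, h3⟩

/-- Interpolation between two test fields. -/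
lemma norm_interpolate_le {X Y : (x : M) → TangentSpace (𝓡 n) x} {x : M} {c t : ℝ}
    (hX : ‖X x‖ ≤ c) (hY : ‖Y x‖ ≤ c) (ht : t ∈ Icc (0 : ℝ) 1) :
    ‖t • X x + (1 - t) • Y x‖ ≤ c := by
  refine (norm_add_le _ _).trans ?_
  rw [norm_smul, norm_smul, Real.norm_eq_abs, Real.norm_eq_abs, abs_of_nonneg ht.1,
    abs_of_nonneg (sub_nonneg.2 ht.2)]
  nlinarith [ht.1, ht.2]

/-- The perimeters of two sets which agree outside of a compact subset of `V` differ in the same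
way in `U` and in `V`. -/
theorem perimeter_add_perimeter_le {E F C U V : Set M} (hE : MeasurableSet E)
    (hF : MeasurableSet F) (hC : IsCompact C) (hV : IsOpen V) (hCV : C ⊆ V) (hVU : V ⊆ U)
    (hEF : ∀ x ∉ C, (x ∈ E ↔ x ∈ F)) :
    perimeter n E U + perimeter n F V ≤ perimeter n F U + perimeter n E V := by
  obtain ⟨η, hη, hη1, ⟨D, hDV, hD, hη0⟩, hη01⟩ := exists_cutoff n hC hV hCV
  have hη' : ContMDiff (𝓡 n) 𝓘(ℝ, ℝ) 1 η := hη.of_le (by exact mod_cast le_top)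
  have hθ' : ContMDiff (𝓡 n) 𝓘(ℝ, ℝ) 1 fun x => 1 - η x := contMDiff_const.sub hη'
  refine perimeter_add_le fun X Y hX hY => ?_
  have sηX : SupportedIn V (fun x => η x • X x) := SupportedIn.smul_left hD hDV X hη0
  have sθX : SupportedIn U (fun x => (1 - η x) • X x) := SupportedIn.smul hX.2.1 _
  have sηY : SupportedIn V (fun x => η x • Y x) := SupportedIn.smul_left hD hDV Y hη0
  have sθY : SupportedIn V (fun x => (1 - η x) • Y x) := SupportedIn.smul hY.2.1 _
  have cηX := IsC1.smul hX.1 hη'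
  have cθX := IsC1.smul hX.1 hθ'
  have cηY := IsC1.smul hY.1 hη'
  have cθY := IsC1.smul hY.1 hθ'
  have eX : divInt E X = divInt E (fun x => η x • X x) + divInt E (fun x => (1 - η x) • X x) := by
    rw [← divInt_add cηX cθX sηX sθX]
    congr 1
    funext x
    rw [← add_smul, add_sub_cancel, one_smul]
  have eY : divInt F Y = divInt F (fun x => η x • Y x) + divInt F (fun x => (1 - η x) • Y x) := by
    rw [← divInt_add cηY cθY sηY sθY]
    congr 1
    funext x
    rw [← add_smul, add_sub_cancel, one_smul]
  -- The factor `1 - η` vanishes near `C`, the only place where `E` and `F` may differ.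
  have hswap : ∀ Z : (x : M) → TangentSpace (𝓡 n) x, IsC1 Z →
      divInt E (fun x => (1 - η x) • Z x) = divInt F (fun x => (1 - η x) • Z x) := by
    intro Z hZ
    unfold divInt
    rw [← integral_indicator hE, ← integral_indicator hF]
    congr 1
    funext x
    by_cases hx : x ∈ C
    · have : divergence (fun x => (1 - η x) • Z x) x = 0 := by
        refine divergence_eq_zero (IsC1.smul hZ hθ') ?_
        filter_upwards [hη1 x hx] with y hy
        rw [hy, sub_self, zero_smul]
      simp [indicator, this]
    · have := hEF x hx
      by_cases hxE : x ∈ E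
      · rw [indicator_of_mem hxE, indicator_of_mem (this.1 hxE)]
      · rw [indicator_of_notMem hxE, indicator_of_notMem fun h => hxE (this.2 h)]
  -- The outer parts of `X` and `Y` are exchanged. As both fields vanish off their supports, one
  -- combination is supported in `V` and is tested on `E`, the other is supported in `U` and is
  -- tested on `F`. Being pointwise convex combinations, they keep norm at most `1`.
  have h1 : IsTestField V (fun x => η x • X x + (1 - η x) • Y x) :=
    ⟨IsC1.add cηX cθY, sηX.add sθY, fun x => norm_interpolate_le (hX.2.2 x) (hY.2.2 x) (hη01 x)⟩
  have h2 : IsTestField U (fun x => η x • Y x + (1 - η x) • X x) :=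
    ⟨IsC1.add cηY cθX, (sηY.mono hVU).add sθX,
      fun x => norm_interpolate_le (hY.2.2 x) (hX.2.2 x) (hη01 x)⟩
  have e : divInt E X + divInt F Y = divInt F (fun x => η x • Y x + (1 - η x) • X x)
      + divInt E (fun x => η x • X x + (1 - η x) • Y x) := by
    rw [divInt_add cηY cθX sηY sθX, divInt_add cηX cθY sηX sθY, eX, eY, hswap X hX.1,
      hswap Y hY.1]
    ring
  rw [e]
  refine (ENNReal.ofReal_add_le).trans (add_le_add ?_ ?_)
  · exact ofReal_divInt_le_perimeter h2
  · exact ofReal_divInt_le_perimeter h1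

/-- The perimeter of a set compactly contained in `V` is seen in `V`. -/
lemma perimeter_le_of_compact {A C U V : Set M} (hA : MeasurableSet A) (hC : IsCompact C)
    (hV : IsOpen V) (hAC : A ⊆ C) (hCV : C ⊆ V) : perimeter n A U ≤ perimeter n A V := by
  -- The localization inequality for `A` and `∅`, which agree off `C`.
  have h := perimeter_add_perimeter_le (n := n) hA MeasurableSet.empty hC hV hCV (subset_univ V)
    (fun x hx => ⟨fun h => hx (hAC h), fun h => h.elim⟩)
  rw [perimeter_empty, perimeter_empty, add_zero, zero_add] at h
  exact (perimeter_mono A (subset_univ U)).trans h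

/-- A cut-off supported in `V` and equal to `1` near the part of the support outside `W` splits a
test field in `V ∪ W` into one test field for each set. -/
lemma perimeter_union_open_le {E V W : Set M} (hV : IsOpen V) (hW : IsOpen W) :
    perimeter n E (V ∪ W) ≤ perimeter n E V + perimeter n E W := by
  refine perimeter_le fun X hX => ?_
  obtain ⟨C, hCU, hC, h0⟩ := hX.2.1
  obtain ⟨η, hη, hη1, hη0, hη01⟩ := exists_cutoff n (hC.diff hW) hV
    (fun x hx => (hCU hx.1).resolve_right hx.2)
  obtain ⟨D, hDV, hD, hη0⟩ := hη0
  have hη' : ContMDiff (𝓡 n) 𝓘(ℝ, ℝ) 1 η := hη.of_le (by exact mod_cast le_top)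
  have hθ' : ContMDiff (𝓡 n) 𝓘(ℝ, ℝ) 1 fun x => 1 - η x := contMDiff_const.sub hη'
  have sηX : SupportedIn V (fun x => η x • X x) := SupportedIn.smul_left hD hDV X hη0
  have sθX : SupportedIn W (fun x => (1 - η x) • X x) := by
    refine ⟨C ∩ closure {x | η x ≠ 1}, ?_, hC.inter_right isClosed_closure, fun x hx => ?_⟩
    · rintro x ⟨hxC, hx⟩
      by_contra hxW
      have := mem_closure_iff_frequently.1 hx
      exact this ((hη1 x ⟨hxC, hxW⟩).mono fun y hy h => h hy)
    · by_cases hxC : x ∈ C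
      · have : η x = 1 := by
          by_contra h
          exact hx ⟨hxC, subset_closure h⟩
        simp only [this, sub_self, zero_smul]
      · simp only [h0 x hxC, smul_zero]
  have eX : divInt E X = divInt E (fun x => η x • X x) + divInt E (fun x => (1 - η x) • X x) := by
    rw [← divInt_add (IsC1.smul hX.1 hη') (IsC1.smul hX.1 hθ') sηX sθX]
    congr 1
    funext x
    rw [← add_smul, add_sub_cancel, one_smul]
  have hn : ∀ (t : ℝ), t ∈ Icc (0 : ℝ) 1 → ∀ x, ‖t • X x‖ ≤ 1 := fun t ht x => by
    rw [norm_smul, Real.norm_eq_abs, abs_of_nonneg ht.1]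
    exact mul_le_one₀ ht.2 (norm_nonneg _) (hX.2.2 x)
  rw [eX]
  refine ENNReal.ofReal_add_le.trans (add_le_add ?_ ?_)
  · exact ofReal_divInt_le_perimeter ⟨IsC1.smul hX.1 hη', sηX, fun x => hn _ (hη01 x) x⟩
  · exact ofReal_divInt_le_perimeter ⟨IsC1.smul hX.1 hθ', sθX,
      fun x => hn _ ⟨by linarith [(hη01 x).2], by linarith [(hη01 x).1]⟩ x⟩

/-- Lower semicontinuity of the perimeter. -/
theorem eventually_lt_perimeter {ι : Type*} {l : Filter ι} {A : ι → Set M} {B U : Set M}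
    (hA : ∀ i, MeasurableSet (A i)) (hB : MeasurableSet B)
    (h : ∀ C ⊆ U, IsCompact C →
      Filter.Tendsto (fun i => riemannianVolume n (symmDiff (A i) B ∩ C)) l (𝓝 0))
    {a : ℝ≥0∞} (ha : a < perimeter n B U) : ∀ᶠ i in l, a < perimeter n (A i) U := by
  obtain ⟨X, hX, -, haX⟩ := exists_lt_ofReal_divInt ha
  obtain ⟨C, hCU, hC, h0⟩ := hX.2.1
  obtain ⟨b, hb⟩ := hC.exists_bound_of_continuousOn (continuous_divergence hX.1).continuousOn
  have hint := integrable_divergence hX.1 hC h0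
  -- For one fixed almost optimal field the divergence is bounded and supported in `C`, so its
  -- integral depends continuously on the set with respect to volume in `C`.
  have key : ∀ i, |divInt (A i) X - divInt B X|
      ≤ b * (riemannianVolume n (symmDiff (A i) B ∩ C)).toReal := by
    intro i
    have hm : MeasurableSet (symmDiff (A i) B ∩ C) :=
      ((hA i).symmDiff hB).inter hC.isClosed.measurableSet
    have hfin : riemannianVolume n (symmDiff (A i) B ∩ C) ≠ ⊤ :=
      ((measure_mono inter_subset_right).trans_lt hC.measure_lt_top).ne
    unfold divInt
    rw [← integral_indicator (hA i), ← integral_indicator hB,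
      ← integral_sub (hint.indicator (hA i)) (hint.indicator hB)]
    have h1 : ∫ x, (symmDiff (A i) B ∩ C).indicator (fun _ => b) x ∂(riemannianVolume n)
        = b * (riemannianVolume n (symmDiff (A i) B ∩ C)).toReal := by
      rw [integral_indicator hm, setIntegral_const, smul_eq_mul, mul_comm, Measure.real]
    rw [← h1, ← Real.norm_eq_abs]
    refine norm_integral_le_of_norm_le ((integrable_indicator_iff hm).2 ?_) ?_
    · exact integrableOn_const hfin
    · refine Filter.Eventually.of_forall fun x => ?_
      by_cases hxC : x ∈ C
      · have := hb x hxC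
        by_cases h1 : x ∈ A i <;> by_cases h2 : x ∈ B <;>
          simp [indicator, mem_symmDiff, h1, h2, hxC] <;> simpa using this
      · have h2 := divergence_eq_zero_of_notMem hX.1 hC.isClosed h0 hxC
        simp [indicator, h2, hxC]
  have ht : Filter.Tendsto (fun i => divInt (A i) X) l (𝓝 (divInt B X)) := by
    rw [tendsto_iff_dist_tendsto_zero]
    have h1 : Filter.Tendsto
        (fun i => b * (riemannianVolume n (symmDiff (A i) B ∩ C)).toReal) l (𝓝 (b * 0)) :=
      ((ENNReal.tendsto_toReal ENNReal.zero_ne_top).comp (h C hCU hC)).const_mul b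
    rw [mul_zero] at h1
    exact squeeze_zero (fun _ => dist_nonneg) (fun i => by rw [Real.dist_eq]; exact key i) h1
  have ht' := (ENNReal.continuous_ofReal.tendsto _).comp ht
  filter_upwards [ht'.eventually (lt_mem_nhds haX)] with i hi
  exact hi.trans_le (ofReal_divInt_le_perimeter hX)

end Perimeter

end WeakIMCF
end

noncomputable section

namespace WeakIMCF

/-! ### Mollification -/

section Mollification

variable {n : ℕ}

/-- The mollification of a vector field. -/
def moll (ρ : ContDiffBump (0 : Coord n)) (W : Coord n → Coord n) : Coord n → Coord n :=
  convolution (ρ.normed volume) W (ContinuousLinearMap.lsmul ℝ ℝ) volume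

/-- The mollification of the indicator function of a set. -/
def mollInd (ρ : ContDiffBump (0 : Coord n)) (A : Set (Coord n)) : Coord n → ℝ :=
  convolution (ρ.normed volume) (A.indicator fun _ => (1 : ℝ)) (ContinuousLinearMap.lsmul ℝ ℝ)
    volume

lemma moll_apply (ρ : ContDiffBump (0 : Coord n)) (W : Coord n → Coord n) (z : Coord n) :
    moll ρ W z = ∫ t, ρ.normed volume t • W (z - t) := rfl

lemma mollInd_apply (ρ : ContDiffBump (0 : Coord n)) (A : Set (Coord n)) (z : Coord n) :
    mollInd ρ A z = ∫ t, ρ.normed volume t * A.indicator (fun _ => (1 : ℝ)) (z - t) := rfl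

lemma contDiff_moll (ρ : ContDiffBump (0 : Coord n)) {W : Coord n → Coord n}
    (hW : Continuous W) : ContDiff ℝ 1 (moll ρ W) :=
  ρ.hasCompactSupport_normed.contDiff_convolution_left _ ρ.contDiff_normed hW.locallyIntegrable

lemma locallyIntegrable_indicator_one {A : Set (Coord n)} (hA : MeasurableSet A) :
    LocallyIntegrable (A.indicator fun _ => (1 : ℝ)) :=
  (locallyIntegrable_const (1 : ℝ)).indicator hA

lemma contDiff_mollInd (ρ : ContDiffBump (0 : Coord n)) {A : Set (Coord n)}
    (hA : MeasurableSet A) : ContDiff ℝ 2 (mollInd ρ A) :=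
  ρ.hasCompactSupport_normed.contDiff_convolution_left _ ρ.contDiff_normed
    (locallyIntegrable_indicator_one hA)

lemma mollInd_mem_Icc (ρ : ContDiffBump (0 : Coord n)) (A : Set (Coord n))
    (z : Coord n) : mollInd ρ A z ∈ Icc (0 : ℝ) 1 := by
  rw [mollInd_apply]
  have h0 : ∀ t, 0 ≤ ρ.normed volume t * A.indicator (fun _ => (1 : ℝ)) (z - t) := fun t =>
    mul_nonneg (ρ.nonneg_normed t) (indicator_nonneg (fun _ _ => zero_le_one) _)
  refine ⟨integral_nonneg h0, ?_⟩
  calc _ ≤ ∫ t, ρ.normed volume t := by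
        refine integral_mono_of_nonneg (Filter.Eventually.of_forall h0) ρ.integrable_normed
          (Filter.Eventually.of_forall fun t => ?_)
        refine mul_le_of_le_one_right (ρ.nonneg_normed t) ?_
        exact indicator_le_self' (f := fun _ => (1 : ℝ)) (fun _ _ => zero_le_one) (z - t)
    _ = 1 := ρ.integral_normed

lemma tsupport_moll_subset (ρ : ContDiffBump (0 : Coord n)) {W : Coord n → Coord n}
    {K : Set (Coord n)} (hK : tsupport W ⊆ K) :
    tsupport (moll ρ W) ⊆ Metric.cthickening ρ.rOut K := by
  refine closure_minimal (fun z hz => ?_) Metric.isClosed_cthickening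
  by_contra h
  refine hz ?_
  rw [moll_apply]
  refine integral_eq_zero_of_ae (Filter.Eventually.of_forall fun t => ?_)
  by_cases ht : t ∈ Metric.ball (0 : Coord n) ρ.rOut
  · have : W (z - t) = 0 := by
      refine image_eq_zero_of_notMem_tsupport fun h1 => h ?_
      refine Metric.mem_cthickening_of_dist_le z (z - t) _ _ (hK h1) ?_
      rw [dist_eq_norm, sub_sub_cancel]
      exact (mem_ball_zero_iff.1 ht).le
    simp [this]
  · have : ρ.normed volume t = 0 := by
      have := ρ.support_normed_eq (μ := (volume : Measure (Coord n)))
      by_contra h2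
      exact ht (this ▸ Function.mem_support.2 h2)
    simp [this]

/-- Averages of a field stay in convex sets. -/
lemma moll_mem (ρ : ContDiffBump (0 : Coord n)) {W : Coord n → Coord n} (hW : Continuous W)
    {z : Coord n} {S : Set (Coord n)} (hS : Convex ℝ S) (hSc : IsClosed S)
    (h : ∀ t, ‖t‖ < ρ.rOut → W (z - t) ∈ S) : moll ρ W z ∈ S := by
  -- The normalized bump is the density of a probability measure, so the mollification is a mean of
  -- values of `W` and lies in any closed convex set containing them.
  set f : Coord n → ℝ≥0∞ := fun t => ENNReal.ofReal (ρ.normed volume t)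
  have hf : Measurable f := ρ.continuous_normed.measurable.ennreal_ofReal
  have hprob : IsProbabilityMeasure ((volume : Measure (Coord n)).withDensity f) := by
    refine ⟨?_⟩
    rw [withDensity_apply _ MeasurableSet.univ, Measure.restrict_univ,
      ← ofReal_integral_eq_lintegral_ofReal ρ.integrable_normed
        (Filter.Eventually.of_forall ρ.nonneg_normed), ρ.integral_normed, ENNReal.ofReal_one]
  have hsm : ∀ t, (f t).toReal • W (z - t) = ρ.normed volume t • W (z - t) := fun t => by
    simp only [f]
    rw [ENNReal.toReal_ofReal (ρ.nonneg_normed t)]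
  have e := integral_withDensity_eq_integral_toReal_smul (μ := volume) hf
    (Filter.Eventually.of_forall fun t => ENNReal.ofReal_lt_top) (fun t => W (z - t))
  simp only [hsm] at e
  rw [moll_apply, ← e]
  have hcont : Continuous fun t => ρ.normed volume t • W (z - t) := by
    have := ρ.continuous_normed (μ := (volume : Measure (Coord n)))
    fun_prop
  refine hS.integral_mem hSc ?_ ?_
  · rw [ae_withDensity_iff hf]
    refine Filter.Eventually.of_forall fun t ht => h t ?_
    have h1 : t ∈ Function.support (ρ.normed (volume : Measure (Coord n))) := by
      intro h0
      exact ht (by simp [f, h0])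
    rw [ρ.support_normed_eq] at h1
    exact mem_ball_zero_iff.1 h1
  · rw [integrable_withDensity_iff_integrable_smul' hf
      (Filter.Eventually.of_forall fun t => ENNReal.ofReal_lt_top)]
    simp only [hsm]
    exact hcont.integrable_of_hasCompactSupport ρ.hasCompactSupport_normed.smul_right

lemma ediv_moll (ρ : ContDiffBump (0 : Coord n)) {W : Coord n → Coord n}
    (hW : ContDiff ℝ 1 W) (hc : HasCompactSupport W) (z : Coord n) :
    ediv (moll ρ W) z = ∫ y, ediv W y * ρ.normed volume (z - y) := by
  have h1 : HasFDerivAt (moll ρ W) (convolution (ρ.normed volume) (fderiv ℝ W)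
      ((ContinuousLinearMap.lsmul ℝ ℝ).precompR (Coord n)) volume z) z :=
    hc.hasFDerivAt_convolution_right _ ρ.continuous_normed.locallyIntegrable hW z
  have hcont := hW.continuous_fderiv one_ne_zero
  have hex : Integrable (fun t => ((ContinuousLinearMap.lsmul ℝ ℝ).precompR (Coord n))
      (ρ.normed volume t) (fderiv ℝ W (z - t))) :=
    (hc.fderiv (𝕜 := ℝ)).convolutionExists_right _ ρ.continuous_normed.locallyIntegrable hcont z
  have h2 : ∀ i : Fin n, (fderiv ℝ (moll ρ W) z (EuclideanSpace.single i (1 : ℝ))) i =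
      ∫ t, ρ.normed volume t * (fderiv ℝ W (z - t) (EuclideanSpace.single i (1 : ℝ))) i := by
    intro i
    have h3 := ((EuclideanSpace.proj (𝕜 := ℝ) i).comp (ContinuousLinearMap.apply ℝ (Coord n)
      (EuclideanSpace.single i (1 : ℝ) : Coord n))).integral_comp_comm hex
    rw [h1.fderiv]
    refine h3.symm.trans (integral_congr_ae (Filter.Eventually.of_forall fun t => ?_))
    simp [ContinuousLinearMap.precompR_apply]
  unfold ediv
  simp only [h2]
  rw [← integral_finsetSum]
  · rw [← integral_sub_left_eq_self _ volume z]
    refine integral_congr_ae (Filter.Eventually.of_forall fun t => ?_)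
    simp only [sub_sub_cancel, Finset.sum_mul]
    exact Finset.sum_congr rfl fun i _ => mul_comm _ _
  · intro i _
    refine Continuous.integrable_of_hasCompactSupport ?_
      ρ.hasCompactSupport_normed.mul_right
    refine ρ.continuous_normed.mul ?_
    have h4 : Continuous fun t => fderiv ℝ W (z - t) (EuclideanSpace.single i (1 : ℝ)) :=
      (hcont.comp (continuous_const.sub continuous_id)).clm_apply continuous_const
    exact (EuclideanSpace.proj (𝕜 := ℝ) i).continuous.comp h4

/-- Mollification is self-adjoint. -/
lemma setIntegral_ediv_moll (ρ : ContDiffBump (0 : Coord n)) {W : Coord n → Coord n}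
    (hW : ContDiff ℝ 1 W) (hc : HasCompactSupport W) {A : Set (Coord n)} (hA : MeasurableSet A) :
    ∫ z in A, ediv (moll ρ W) z = ∫ z, mollInd ρ A z * ediv W z := by
  have hint : Integrable (fun p : Coord n × Coord n => ediv W p.2 * ρ.normed volume (p.1 - p.2))
      (volume.prod volume) :=
    (integrable_ediv hW hc).convolution_integrand (ContinuousLinearMap.mul ℝ ℝ)
      ρ.integrable_normed
  have hint' := hint.indicator (hA.prod (MeasurableSet.univ (α := Coord n)))
  -- By Fubini the kernel moves from the field to the indicator of `A`; its evenness enters below as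
  -- `hev`.
  have hsw := integral_integral_swap (f := fun z y => (A ×ˢ (univ : Set (Coord n))).indicator
    (fun p : Coord n × Coord n => ediv W p.2 * ρ.normed volume (p.1 - p.2)) (z, y)) hint'
  have e1 : ∫ z in A, ediv (moll ρ W) z = ∫ z, ∫ y, (A ×ˢ (univ : Set (Coord n))).indicator
      (fun p : Coord n × Coord n => ediv W p.2 * ρ.normed volume (p.1 - p.2)) (z, y) := by
    rw [← integral_indicator hA]
    refine integral_congr_ae (Filter.Eventually.of_forall fun z => ?_)
    by_cases hz : z ∈ A
    · simp [indicator, hz, ediv_moll ρ hW hc]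
    · simp [indicator, hz]
  rw [e1, hsw]
  refine integral_congr_ae (Filter.Eventually.of_forall fun y => ?_)
  simp only [mollInd_apply]
  have hsub := integral_sub_left_eq_self (fun t => ρ.normed volume t *
    A.indicator (fun _ => (1 : ℝ)) (y - t) * ediv W y) volume y
  rw [← integral_mul_const, ← hsub]
  refine integral_congr_ae (Filter.Eventually.of_forall fun z => ?_)
  simp only [sub_sub_cancel]
  have hev : ρ.normed volume (y - z) = ρ.normed volume (z - y) := by
    rw [← neg_sub z y, ρ.normed_neg]
  by_cases hz : z ∈ A
  · simp only [indicator, mem_prod, hz, mem_univ, and_self, if_true, hev]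
    ring
  · simp [indicator, hz]

/-- The algebraic identity behind the submodularity of the perimeter. -/
lemma ediv_identity {e f : Coord n → ℝ} {W V : Coord n → Coord n} (he : ContDiff ℝ 1 e)
    (hf : ContDiff ℝ 1 f) (hW : ContDiff ℝ 1 W) (hV : ContDiff ℝ 1 V) (z : Coord n) :
    e z * ediv (fun y => (1 - f y) • W y + f y • V y) z
      + f z * ediv (fun y => (1 - e y) • W y + e y • V y) z
    = (e z + f z - e z * f z) * ediv W z + e z * f z * ediv V z
      + ediv (fun y => (e y * f y) • (V y + (-1 : ℝ) • W y)) z := by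
  have de := (he.differentiable one_ne_zero) z
  have df := (hf.differentiable one_ne_zero) z
  have dW := (hW.differentiable one_ne_zero) z
  have dV := (hV.differentiable one_ne_zero) z
  have d1 : ∀ {g : Coord n → ℝ}, DifferentiableAt ℝ g z →
      DifferentiableAt ℝ (fun y => 1 - g y) z := fun hg => (differentiableAt_const _).sub hg
  have key : ∀ {g : Coord n → ℝ}, DifferentiableAt ℝ g z →
      ediv (fun y => (1 - g y) • W y + g y • V y) z =
        (1 - g z) * ediv W z - fderiv ℝ g z (W z) + (g z * ediv V z + fderiv ℝ g z (V z)) := by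
    intro g hg
    rw [ediv_add ((d1 hg).fun_smul dW) (hg.fun_smul dV), ediv_smul (d1 hg) dW, ediv_smul hg dV]
    simp only [fderiv_const_sub, neg_apply]
    ring
  have hm := ediv_smul (h := fun _ => (-1 : ℝ)) (differentiableAt_const _) dW
  simp only [fderiv_fun_const, Pi.zero_apply, zero_apply, add_zero] at hm
  have dm : DifferentiableAt ℝ (fun y => (-1 : ℝ) • W y) z := dW.fun_const_smul (-1 : ℝ)
  -- The gradient terms on the left are `e ∇f + f ∇e = ∇(e f)` applied to `V - W`, so they are
  -- absorbed by the divergence of `e f (V - W)`.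
  rw [key df, key de, ediv_smul (de.fun_mul df) (dV.fun_add dm), ediv_add dV dm, hm,
    fderiv_fun_mul de df]
  simp only [map_add, map_smul, add_apply, smul_apply, smul_eq_mul]
  ring

end Mollification

end WeakIMCF
end

noncomputable section

namespace WeakIMCF

/-! ### Submodularity of the perimeter -/

section Submodularity

variable {n : ℕ}

lemma contDiff_interp {f : Coord n → ℝ} {W V : Coord n → Coord n} (hf : ContDiff ℝ 1 f)
    (hW : ContDiff ℝ 1 W) (hV : ContDiff ℝ 1 V) :
    ContDiff ℝ 1 fun y => (1 - f y) • W y + f y • V y :=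
  ((contDiff_const.sub hf).smul hW).add (hf.smul hV)

lemma tsupport_interp_subset (f : Coord n → ℝ) (W V : Coord n → Coord n) :
    tsupport (fun y => (1 - f y) • W y + f y • V y) ⊆ tsupport W ∪ tsupport V := by
  refine closure_minimal (fun z hz => ?_) ((isClosed_tsupport W).union (isClosed_tsupport V))
  by_contra h
  refine hz ?_
  simp only [image_eq_zero_of_notMem_tsupport fun h' => h (Or.inl h'),
    image_eq_zero_of_notMem_tsupport fun h' => h (Or.inr h'), smul_zero, add_zero]

/-- The integral of the mollified fields. -/
lemma setIntegral_ediv_moll_add (ρ : ContDiffBump (0 : Coord n)) {W V : Coord n → Coord n}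
    (hW : ContDiff ℝ 1 W) (hWc : HasCompactSupport W) (hV : ContDiff ℝ 1 V)
    (hVc : HasCompactSupport V) {A B : Set (Coord n)} (hA : MeasurableSet A)
    (hB : MeasurableSet B) :
    (∫ z in A, ediv (moll ρ fun y => (1 - mollInd ρ B y) • W y + mollInd ρ B y • V y) z)
      + (∫ z in B, ediv (moll ρ fun y => (1 - mollInd ρ A y) • W y + mollInd ρ A y • V y) z)
    = ∫ z, ((mollInd ρ A z + mollInd ρ B z - mollInd ρ A z * mollInd ρ B z) * ediv W z
      + mollInd ρ A z * mollInd ρ B z * ediv V z) := by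
  have he : ContDiff ℝ 1 (mollInd ρ A) := (contDiff_mollInd ρ hA).of_le (by norm_num)
  have hf : ContDiff ℝ 1 (mollInd ρ B) := (contDiff_mollInd ρ hB).of_le (by norm_num)
  have hcs : ∀ f : Coord n → ℝ, HasCompactSupport fun y => (1 - f y) • W y + f y • V y := fun f =>
    (hWc.isCompact.union hVc.isCompact).of_isClosed_subset (isClosed_tsupport _)
      (tsupport_interp_subset f W V)
  rw [setIntegral_ediv_moll ρ (contDiff_interp hf hW hV) (hcs _) hA,
    setIntegral_ediv_moll ρ (contDiff_interp he hW hV) (hcs _) hB]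
  have i1 : Integrable fun z => mollInd ρ A z *
      ediv (fun y => (1 - mollInd ρ B y) • W y + mollInd ρ B y • V y) z :=
    (he.continuous.mul (continuous_ediv (contDiff_interp hf hW hV))).integrable_of_hasCompactSupport
      (hasCompactSupport_ediv (hcs _)).mul_left
  have i2 : Integrable fun z => mollInd ρ B z *
      ediv (fun y => (1 - mollInd ρ A y) • W y + mollInd ρ A y • V y) z :=
    (hf.continuous.mul (continuous_ediv (contDiff_interp he hW hV))).integrable_of_hasCompactSupport
      (hasCompactSupport_ediv (hcs _)).mul_left
  rw [← integral_add i1 i2]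
  simp only [ediv_identity he hf hW hV]
  -- The remaining term is the divergence of a compactly supported field and integrates to zero.
  have hU : ContDiff ℝ 1 fun y => (mollInd ρ A y * mollInd ρ B y) • (V y + (-1 : ℝ) • W y) :=
    (he.mul hf).smul (hV.add (hW.const_smul (-1 : ℝ)))
  have hUc : HasCompactSupport
      fun y => (mollInd ρ A y * mollInd ρ B y) • (V y + (-1 : ℝ) • W y) := by
    refine HasCompactSupport.intro (hWc.isCompact.union hVc.isCompact) fun z h => ?_
    simp only [image_eq_zero_of_notMem_tsupport fun h' => h (Or.inl h'),
      image_eq_zero_of_notMem_tsupport fun h' => h (Or.inr h'), smul_zero, add_zero]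
  have hcont : Continuous fun z =>
      ((mollInd ρ A z + mollInd ρ B z - mollInd ρ A z * mollInd ρ B z) * ediv W z
      + mollInd ρ A z * mollInd ρ B z * ediv V z) := by
    have := he.continuous
    have := hf.continuous
    have := continuous_ediv hW
    have := continuous_ediv hV
    fun_prop
  have i3 : Integrable fun z =>
      ((mollInd ρ A z + mollInd ρ B z - mollInd ρ A z * mollInd ρ B z) * ediv W z
      + mollInd ρ A z * mollInd ρ B z * ediv V z) :=
    hcont.integrable_of_hasCompactSupport
      ((hasCompactSupport_ediv hWc).mul_left.add (hasCompactSupport_ediv hVc).mul_left)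
  rw [integral_add i3 (integrable_ediv hU hUc), integral_ediv hU hUc, add_zero]

/-- Mollifiers with radius tending to `0`. -/
def bumpSeq (n k : ℕ) : ContDiffBump (0 : Coord n) where
  rIn := 1 / (2 * ((k : ℝ) + 1))
  rOut := 1 / ((k : ℝ) + 1)
  rIn_pos := by positivity
  rIn_lt_rOut := by
    refine one_div_lt_one_div_of_lt (by positivity) ?_
    have : (0 : ℝ) ≤ k := Nat.cast_nonneg k
    linarith

lemma tendsto_bumpSeq_rOut : Filter.Tendsto (fun k => (bumpSeq n k).rOut) Filter.atTop (𝓝 0) :=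
  tendsto_one_div_add_atTop_nhds_zero_nat

/-- This is Lebesgue differentiation, which needs `rOut` to be bounded by a fixed multiple of `rIn`;
for `bumpSeq` the ratio is exactly `2`. -/
lemma ae_tendsto_mollInd {A : Set (Coord n)} (hA : MeasurableSet A) :
    ∀ᵐ z, Filter.Tendsto (fun k => mollInd (bumpSeq n k) A z) Filter.atTop
      (𝓝 (A.indicator (fun _ => (1 : ℝ)) z)) :=
  ContDiffBump.ae_convolution_tendsto_right_of_locallyIntegrable (K := 2) tendsto_bumpSeq_rOut
    (Filter.Eventually.of_forall fun k => by
      simp only [bumpSeq]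
      refine le_of_eq ?_
      field_simp)
    (locallyIntegrable_indicator_one hA)

/-- For indicators `e`, `f` of `A`, `B` the functions `e + f - e f` and `e f` are the indicators of
`A ∪ B` and `A ∩ B`. Mollified weights lie in `[0, 1]`, so dominated convergence applies. -/
lemma tendsto_integral_moll {W V : Coord n → Coord n}
    (hW : ContDiff ℝ 1 W) (hWc : HasCompactSupport W) (hV : ContDiff ℝ 1 V)
    (hVc : HasCompactSupport V) {A B : Set (Coord n)} (hA : MeasurableSet A)
    (hB : MeasurableSet B) :
    Filter.Tendsto (fun k => ∫ z, ((mollInd (bumpSeq n k) A z + mollInd (bumpSeq n k) B z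
      - mollInd (bumpSeq n k) A z * mollInd (bumpSeq n k) B z) * ediv W z
      + mollInd (bumpSeq n k) A z * mollInd (bumpSeq n k) B z * ediv V z)) Filter.atTop
      (𝓝 ((∫ z in A ∪ B, ediv W z) + (∫ z in A ∩ B, ediv V z))) := by
  have e : (∫ z in A ∪ B, ediv W z) + (∫ z in A ∩ B, ediv V z) = ∫ z,
      ((A.indicator (fun _ => (1 : ℝ)) z + B.indicator (fun _ => (1 : ℝ)) z
      - A.indicator (fun _ => (1 : ℝ)) z * B.indicator (fun _ => (1 : ℝ)) z) * ediv W z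
      + A.indicator (fun _ => (1 : ℝ)) z * B.indicator (fun _ => (1 : ℝ)) z * ediv V z) := by
    rw [← integral_indicator (hA.union hB), ← integral_indicator (hA.inter hB), ← integral_add
      ((integrable_ediv hW hWc).indicator (hA.union hB))
      ((integrable_ediv hV hVc).indicator (hA.inter hB))]
    refine integral_congr_ae (Filter.Eventually.of_forall fun z => ?_)
    by_cases h1 : z ∈ A <;> by_cases h2 : z ∈ B <;> simp [indicator, h1, h2]
  rw [e]
  refine tendsto_integral_of_dominated_convergence (fun z => |ediv W z| + |ediv V z|) ?_
    ((integrable_ediv hW hWc).abs.add (integrable_ediv hV hVc).abs) ?_ ?_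
  · intro k
    have := (contDiff_mollInd (bumpSeq n k) hA).continuous
    have := (contDiff_mollInd (bumpSeq n k) hB).continuous
    have := continuous_ediv hW
    have := continuous_ediv hV
    exact Continuous.aestronglyMeasurable (by fun_prop)
  · refine fun k => Filter.Eventually.of_forall fun z => ?_
    obtain ⟨a0, a1⟩ := mollInd_mem_Icc (bumpSeq n k) A z
    obtain ⟨b0, b1⟩ := mollInd_mem_Icc (bumpSeq n k) B z
    rw [Real.norm_eq_abs]
    refine (abs_add_le _ _).trans (add_le_add ?_ ?_)
    · rw [abs_mul]
      refine mul_le_of_le_one_left (abs_nonneg _) (abs_le.2 ⟨?_, ?_⟩) <;> nlinarith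
    · rw [abs_mul]
      refine mul_le_of_le_one_left (abs_nonneg _) (abs_le.2 ⟨?_, ?_⟩) <;> nlinarith
  · filter_upwards [ae_tendsto_mollInd hA, ae_tendsto_mollInd hB] with z hz1 hz2
    exact (((hz1.add hz2).sub (hz1.mul hz2)).mul_const _).add ((hz1.mul hz2).mul_const _)

variable {M : Type*} [EMetricSpace M] [ChartedSpace (Coord n) M]
  [RiemannianBundle (fun x : M => TangentSpace (𝓡 n) x)] [IsManifold (𝓡 n) ∞ M]
  [IsContMDiffRiemannianBundle (𝓡 n) ∞ (Coord n) (fun x : M => TangentSpace (𝓡 n) x)]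

lemma convex_chartNorm_le (φ : OpenPartialHomeomorph M (Coord n)) (z : Coord n) (c : ℝ) :
    Convex ℝ {w | chartNorm φ z w ≤ c} := by
  intro w hw w' hw' a b ha hb hab
  simp only [mem_ofPred_eq] at hw hw' ⊢
  refine (chartNorm_add_le φ z _ _).trans ?_
  rw [chartNorm_smul, chartNorm_smul, abs_of_nonneg ha, abs_of_nonneg hb]
  calc _ ≤ a * c + b * c := by gcongr
    _ = c := by rw [← add_mul, hab, one_mul]

lemma isClosed_chartNorm_le {φ : OpenPartialHomeomorph M (Coord n)}
    (hφ : φ ∈ IsManifold.maximalAtlas (𝓡 n) ∞ M) {z : Coord n} (hz : z ∈ φ.target) (c : ℝ) :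
    IsClosed {w | chartNorm φ z w ≤ c} := by
  have h : Continuous fun w => chartNorm φ z w :=
    (continuousOn_chartNorm hφ).comp_continuous (f := fun w => (z, w)) (by fun_prop)
      fun w => ⟨hz, mem_univ _⟩
  exact isClosed_le h continuous_const

lemma chartNorm_zero (φ : OpenPartialHomeomorph M (Coord n)) (z : Coord n) :
    chartNorm φ z 0 = 0 := by simp [chartNorm]

/-- Mollification almost preserves pointwise bounds of a field. -/
lemma chartNorm_moll_le {φ : OpenPartialHomeomorph M (Coord n)}
    (hφ : φ ∈ IsManifold.maximalAtlas (𝓡 n) ∞ M) {K : Set (Coord n)} (hK : IsCompact K)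
    (hKt : K ⊆ φ.target) {ψ : Coord n → ℝ} (hψ : ContinuousOn ψ φ.target)
    (hψ01 : ∀ z ∈ φ.target, ψ z ∈ Icc (0 : ℝ) 1) {δ : ℝ} (hδ : 0 < δ) :
    ∃ r > 0, ∀ ρ : ContDiffBump (0 : Coord n), ρ.rOut ≤ r → ∀ Q : Coord n → Coord n,
      Continuous Q → tsupport Q ⊆ K → (∀ z ∈ φ.target, chartNorm φ z (Q z) ≤ ψ z) →
      ∀ z ∈ φ.target, chartNorm φ z (moll ρ Q z) ≤ ψ z + δ := by
  obtain ⟨r₁, hr₁, hr₁t⟩ := hK.exists_cthickening_subset_open φ.open_target hKt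
  have hδ' : 0 < min 1 δ / 3 := by positivity
  -- As `ψ ≤ 1` and `d ≤ 1`, one has `(1 + d) (ψ + d) ≤ ψ + 3 d ≤ ψ + δ`.
  set d := min 1 δ / 3 with hd
  have hd1 : d ≤ 1 / 3 := by rw [hd]; gcongr; exact min_le_left _ _
  have hd2 : 3 * d ≤ δ := by
    rw [hd, mul_div_cancel₀ _ (by norm_num : (3 : ℝ) ≠ 0)]; exact min_le_right _ _
  obtain ⟨r₂, hr₂, h2⟩ := exists_chartNorm_le hφ hK hKt hδ'
  obtain ⟨r₃, hr₃, h3⟩ := Metric.uniformContinuousOn_iff.1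
    (hK.cthickening.uniformContinuousOn_of_continuous (hψ.mono hr₁t)) d hδ'
  refine ⟨min r₁ (min r₂ (r₃ / 2)), by positivity, fun ρ hρ Q hQ hQK hQn z hz => ?_⟩
  have hρ1 : ρ.rOut ≤ r₁ := hρ.trans (min_le_left _ _)
  have hρ2 : ρ.rOut ≤ r₂ := hρ.trans ((min_le_right _ _).trans (min_le_left _ _))
  have hρ3 : ρ.rOut ≤ r₃ / 2 := hρ.trans ((min_le_right _ _).trans (min_le_right _ _))
  obtain ⟨p0, p1⟩ := hψ01 z hz
  have key : moll ρ Q z ∈ {w | chartNorm φ z w ≤ ψ z + δ} := by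
    refine moll_mem ρ hQ (convex_chartNorm_le φ z _) (isClosed_chartNorm_le hφ hz _)
      fun t ht => ?_
    change chartNorm φ z (Q (z - t)) ≤ ψ z + δ
    by_cases hy : z - t ∈ K
    · have hdist : dist z (z - t) = ‖t‖ := by rw [dist_eq_norm, sub_sub_cancel]
      have e1 := (h2 (z - t) hy z (by rw [hdist]; linarith)).2 (Q (z - t)) (Q (z - t))
        (by simp only [sub_self, norm_zero]; positivity)
      have e2 := hQn _ (hKt hy)
      have e3 := h3 z (Metric.mem_cthickening_of_dist_le z (z - t) _ _ hy (by rw [hdist]; linarith))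
        (z - t) (Metric.self_subset_cthickening K hy) (by rw [hdist]; linarith)
      rw [Real.dist_eq] at e3
      have e4 := (abs_lt.1 e3).1
      have e5 : chartNorm φ (z - t) (Q (z - t)) ≤ ψ z + d := by linarith
      calc _ ≤ (1 + d) * chartNorm φ (z - t) (Q (z - t)) := e1
        _ ≤ (1 + d) * (ψ z + d) := by gcongr
        _ ≤ ψ z + δ := by nlinarith
    · rw [image_eq_zero_of_notMem_tsupport fun h => hy (hQK h), chartNorm_zero]
      linarith
  exact key

/-- The submodularity estimate in a chart. -/
lemma exists_fields_union_inter {φ : OpenPartialHomeomorph M (Coord n)}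
    (hφ : φ ∈ IsManifold.maximalAtlas (𝓡 n) ∞ M) {O : Set (Coord n)} (hO : IsOpen O)
    (hOt : O ⊆ φ.target) {W V : Coord n → Coord n}
    (hW : ContDiff ℝ 1 W) (hWc : HasCompactSupport W) (hWO : tsupport W ⊆ O)
    (hV : ContDiff ℝ 1 V) (hVc : HasCompactSupport V) (hVO : tsupport V ⊆ O)
    {ψ : Coord n → ℝ} (hψ : ContinuousOn ψ φ.target)
    (hψ01 : ∀ z ∈ φ.target, ψ z ∈ Icc (0 : ℝ) 1)
    (hWψ : ∀ z ∈ φ.target, chartNorm φ z (W z) ≤ ψ z)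
    (hVψ : ∀ z ∈ φ.target, chartNorm φ z (V z) ≤ ψ z)
    {A B : Set (Coord n)} (hA : MeasurableSet A) (hB : MeasurableSet B) {δ : ℝ} (hδ : 0 < δ) :
    ∃ Q₁ Q₂ : Coord n → Coord n, (ContDiff ℝ 1 Q₁ ∧ HasCompactSupport Q₁ ∧ tsupport Q₁ ⊆ O ∧
        ∀ z ∈ φ.target, chartNorm φ z (Q₁ z) ≤ ψ z + δ) ∧
      (ContDiff ℝ 1 Q₂ ∧ HasCompactSupport Q₂ ∧ tsupport Q₂ ⊆ O ∧
        ∀ z ∈ φ.target, chartNorm φ z (Q₂ z) ≤ ψ z + δ) ∧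
      (∫ z in A ∪ B, ediv W z) + (∫ z in A ∩ B, ediv V z)
        ≤ (∫ z in A, ediv Q₁ z) + (∫ z in B, ediv Q₂ z) + δ := by
  set K := tsupport W ∪ tsupport V with hKdef
  have hK : IsCompact K := hWc.isCompact.union hVc.isCompact
  have hKO : K ⊆ O := union_subset hWO hVO
  obtain ⟨r₁, hr₁, hr₁O⟩ := hK.exists_cthickening_subset_open hO hKO
  obtain ⟨r₂, hr₂, h2⟩ := chartNorm_moll_le hφ hK (hKO.trans hOt) hψ hψ01 hδ
  have ht := tendsto_integral_moll hW hWc hV hVc hA hB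
  have ev1 := ht.eventually (lt_mem_nhds (sub_lt_self _ hδ))
  have ev2 := (tendsto_bumpSeq_rOut (n := n)).eventually (gt_mem_nhds (lt_min hr₁ hr₂))
  obtain ⟨k, hk1, hk2⟩ := (ev1.and ev2).exists
  -- The field tested on `A` interpolates from `W` to `V` by the mollified indicator of `B`, and
  -- conversely. Interpolation keeps the pointwise bound by convexity, and the outer mollification
  -- costs at most `δ`.
  have good : ∀ D : Set (Coord n), MeasurableSet D →
      ContDiff ℝ 1 (moll (bumpSeq n k) fun y => (1 - mollInd (bumpSeq n k) D y) • W y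
        + mollInd (bumpSeq n k) D y • V y) ∧
      HasCompactSupport (moll (bumpSeq n k) fun y => (1 - mollInd (bumpSeq n k) D y) • W y
        + mollInd (bumpSeq n k) D y • V y) ∧
      tsupport (moll (bumpSeq n k) fun y => (1 - mollInd (bumpSeq n k) D y) • W y
        + mollInd (bumpSeq n k) D y • V y) ⊆ O ∧
      ∀ z ∈ φ.target, chartNorm φ z (moll (bumpSeq n k)
        (fun y => (1 - mollInd (bumpSeq n k) D y) • W y + mollInd (bumpSeq n k) D y • V y) z)
          ≤ ψ z + δ := by
    intro D hD
    have hf : ContDiff ℝ 1 (mollInd (bumpSeq n k) D) :=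
      (contDiff_mollInd _ hD).of_le (by norm_num)
    have hQ := (contDiff_interp hf hW hV).continuous
    have hsub := tsupport_interp_subset (mollInd (bumpSeq n k) D) W V
    have hts := tsupport_moll_subset (bumpSeq n k) hsub
    have hle : (bumpSeq n k).rOut ≤ r₁ := hk2.le.trans (min_le_left _ _)
    refine ⟨contDiff_moll _ hQ, hK.cthickening.of_isClosed_subset (isClosed_tsupport _) hts,
      hts.trans ((Metric.cthickening_mono hle K).trans hr₁O), ?_⟩
    refine h2 (bumpSeq n k) (hk2.le.trans (min_le_right _ _)) _ hQ hsub fun z hz => ?_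
    obtain ⟨f0, f1⟩ := mollInd_mem_Icc (bumpSeq n k) D z
    exact (convex_chartNorm_le φ z (ψ z)) (hWψ z hz) (hVψ z hz) (by linarith) f0 (by ring)
  refine ⟨_, _, good B hB, good A hA, ?_⟩
  rw [setIntegral_ediv_moll_add _ hW hWc hV hVc hA hB]
  linarith

variable [MeasurableSpace M] [BorelSpace M] [SecondCountableTopology M]

/-- A bound by a function `ζ`, rather than by `1`, is essential for gluing: with `ζ` running through
a partition of unity, the sum of the new fields is bounded by `1` plus the accumulated errors. -/
lemma exists_fields_chart {φ : OpenPartialHomeomorph M (Coord n)}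
    (hφ : φ ∈ IsManifold.maximalAtlas (𝓡 n) ∞ M) {U : Set M} (hU : IsOpen U)
    {E F C : Set M} (hE : MeasurableSet E) (hF : MeasurableSet F)
    {X Y : (x : M) → TangentSpace (𝓡 n) x} (hX : IsC1 X) (hY : IsC1 Y) (hC : IsCompact C)
    (hCU : C ⊆ U ∩ φ.source) (hX0 : ∀ x ∉ C, X x = 0) (hY0 : ∀ x ∉ C, Y x = 0)
    {ζ : M → ℝ} (hζ : Continuous ζ) (hζ01 : ∀ x, ζ x ∈ Icc (0 : ℝ) 1) (hXζ : ∀ x, ‖X x‖ ≤ ζ x)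
    (hYζ : ∀ x, ‖Y x‖ ≤ ζ x) {δ : ℝ} (hδ : 0 < δ) :
    ∃ Z₁ Z₂ : (x : M) → TangentSpace (𝓡 n) x,
      (IsC1 Z₁ ∧ SupportedIn U Z₁ ∧ ∀ x, ‖Z₁ x‖ ≤ ζ x + δ) ∧
      (IsC1 Z₂ ∧ SupportedIn U Z₂ ∧ ∀ x, ‖Z₂ x‖ ≤ ζ x + δ) ∧
      divInt (E ∪ F) X + divInt (E ∩ F) Y ≤ divInt E Z₁ + divInt F Z₂ + δ := by
  obtain ⟨W, hW, hWc, hWC, hWt, rfl⟩ := exists_eq_fieldOf hφ hX hC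
    (hCU.trans inter_subset_right) hX0
  obtain ⟨V, hV, hVc, hVC, hVt, rfl⟩ := exists_eq_fieldOf hφ hY hC
    (hCU.trans inter_subset_right) hY0
  set O := φ.target ∩ φ.symm ⁻¹' U with hOdef
  have hO : IsOpen O := φ.symm.isOpen_inter_preimage hU
  have hCO : φ '' C ⊆ O := by
    rintro _ ⟨x, hx, rfl⟩
    refine ⟨φ.map_source (hCU hx).2, ?_⟩
    simp only [mem_preimage]
    rw [φ.left_inv (hCU hx).2]
    exact (hCU hx).1
  have hmem : ∀ Q : Coord n → Coord n, ContDiff ℝ 1 Q ∧ HasCompactSupport Q ∧ tsupport Q ⊆ O ∧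
        (∀ z ∈ φ.target, chartNorm φ z (Q z) ≤ (ζ ∘ φ.symm) z + δ) →
      IsC1 (fieldOf φ Q : (x : M) → TangentSpace (𝓡 n) x) ∧ SupportedIn U (fieldOf φ Q) ∧
        ∀ x, ‖fieldOf φ Q x‖ ≤ ζ x + δ := by
    rintro Q ⟨h1, h2, h3, h4⟩
    have h3t : tsupport Q ⊆ φ.target := h3.trans inter_subset_left
    refine ⟨contMDiff_fieldOf hφ h1 h2 h3t, ⟨φ.symm '' tsupport Q, ?_,
      isCompact_symm_image_tsupport h2 h3t, fun x hx => fieldOf_of_notMem hx⟩, fun x => ?_⟩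
    · rintro _ ⟨z, hz, rfl⟩
      exact (h3 hz).2
    · by_cases hx : x ∈ φ.source
      · obtain ⟨z, hz, rfl⟩ : ∃ z ∈ φ.target, φ.symm z = x := ⟨φ x, φ.map_source hx, φ.left_inv hx⟩
        rw [norm_fieldOf_symm hφ hz]
        exact h4 z hz
      · rw [fieldOf_of_notMem fun ⟨z, hz, h⟩ => hx (h ▸ φ.map_target (h3t hz)), norm_zero]
        linarith [(hζ01 x).1]
  obtain ⟨Q₁, Q₂, hQ₁, hQ₂, hQ⟩ := exists_fields_union_inter hφ hO inter_subset_left hW hWc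
    (hWC.trans hCO) hV hVc (hVC.trans hCO) (ψ := ζ ∘ φ.symm)
    (hζ.comp_continuousOn φ.continuousOn_symm) (fun z _ => hζ01 _)
    (fun z hz => by rw [← norm_fieldOf_symm hφ hz]; exact hXζ _)
    (fun z hz => by rw [← norm_fieldOf_symm hφ hz]; exact hYζ _)
    (measurableSet_target_inter φ hE) (measurableSet_target_inter φ hF) hδ
  refine ⟨_, _, hmem Q₁ hQ₁, hmem Q₂ hQ₂, ?_⟩
  unfold divInt
  rw [setIntegral_divergence_fieldOf hφ hW hWc hWt (hE.union hF),
    setIntegral_divergence_fieldOf hφ hV hVc hVt (hE.inter hF),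
    setIntegral_divergence_fieldOf hφ hQ₁.1 hQ₁.2.1 (hQ₁.2.2.1.trans inter_subset_left) hE,
    setIntegral_divergence_fieldOf hφ hQ₂.1 hQ₂.2.1 (hQ₂.2.2.1.trans inter_subset_left) hF]
  rwa [preimage_union, preimage_inter, inter_union_distrib_left, inter_inter_distrib_left]

/-- Induction over the charts. Each chart adds an error `δ` to the norm bound and to the integral
inequality. -/
lemma exists_fields_sum {ι : Type*} {φ : ι → OpenPartialHomeomorph M (Coord n)}
    (hφ : ∀ i, φ i ∈ IsManifold.maximalAtlas (𝓡 n) ∞ M) {U : Set M} (hU : IsOpen U)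
    {E F C : Set M} (hE : MeasurableSet E) (hF : MeasurableSet F)
    {X Y : (x : M) → TangentSpace (𝓡 n) x} (hX : IsC1 X) (hY : IsC1 Y) (hC : IsCompact C)
    (hCU : C ⊆ U) (hX0 : ∀ x ∉ C, X x = 0) (hY0 : ∀ x ∉ C, Y x = 0) (hX1 : ∀ x, ‖X x‖ ≤ 1)
    (hY1 : ∀ x, ‖Y x‖ ≤ 1) {ρ : ι → M → ℝ} (hρ : ∀ i, ContMDiff (𝓡 n) 𝓘(ℝ, ℝ) 1 (ρ i))
    (hρ01 : ∀ i x, ρ i x ∈ Icc (0 : ℝ) 1) (hρφ : ∀ i, tsupport (ρ i) ⊆ (φ i).source)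
    {δ : ℝ} (hδ : 0 < δ) (s : Finset ι) :
    ∃ Z₁ Z₂ : (x : M) → TangentSpace (𝓡 n) x,
      (IsC1 Z₁ ∧ SupportedIn U Z₁ ∧ ∀ x, ‖Z₁ x‖ ≤ ∑ i ∈ s, (ρ i x + δ)) ∧
      (IsC1 Z₂ ∧ SupportedIn U Z₂ ∧ ∀ x, ‖Z₂ x‖ ≤ ∑ i ∈ s, (ρ i x + δ)) ∧
      divInt (E ∪ F) (fun x => (∑ i ∈ s, ρ i x) • X x)
        + divInt (E ∩ F) (fun x => (∑ i ∈ s, ρ i x) • Y x)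
        ≤ divInt E Z₁ + divInt F Z₂ + ∑ _i ∈ s, δ := by
  classical
  induction s using Finset.induction_on with
  | empty =>
    refine ⟨fun _ => 0, fun _ => 0, ?_, ?_, ?_⟩
    · exact ⟨isC1_zero, (isTestField_zero U).2.1, by simp⟩
    · exact ⟨isC1_zero, (isTestField_zero U).2.1, by simp⟩
    · simp [divInt_zero]
  | insert i s hi ih =>
    obtain ⟨Z₁, Z₂, ⟨h11, h12, h13⟩, ⟨h21, h22, h23⟩, h3⟩ := ih
    have hCi : IsCompact (C ∩ tsupport (ρ i)) := hC.inter_right (isClosed_tsupport _)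
    have off : ∀ Q : (x : M) → TangentSpace (𝓡 n) x, (∀ x ∉ C, Q x = 0) →
        ∀ x ∉ C ∩ tsupport (ρ i), ρ i x • Q x = 0 := by
      intro Q hQ x hx
      by_cases hxC : x ∈ C
      · rw [image_eq_zero_of_notMem_tsupport fun h => hx ⟨hxC, h⟩, zero_smul]
      · rw [hQ x hxC, smul_zero]
    have bd : ∀ Q : (x : M) → TangentSpace (𝓡 n) x, (∀ x, ‖Q x‖ ≤ 1) →
        ∀ x, ‖ρ i x • Q x‖ ≤ ρ i x := by
      intro Q hQ x
      rw [norm_smul, Real.norm_eq_abs, abs_of_nonneg (hρ01 i x).1]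
      exact mul_le_of_le_one_right (hρ01 i x).1 (hQ x)
    obtain ⟨Q₁, Q₂, ⟨k11, k12, k13⟩, ⟨k21, k22, k23⟩, k3⟩ := exists_fields_chart (hφ i) hU hE hF
      (IsC1.smul hX (hρ i)) (IsC1.smul hY (hρ i)) hCi
      (fun x hx => ⟨hCU hx.1, hρφ i hx.2⟩) (off X hX0) (off Y hY0) (hρ i).continuous (hρ01 i)
      (bd X hX1) (bd Y hY1) hδ
    have hsum : ContMDiff (𝓡 n) 𝓘(ℝ, ℝ) 1 fun x => ∑ j ∈ s, ρ j x :=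
      contMDiff_finsetSum fun j _ => hρ j
    have split : ∀ (A : Set M) (Q : (x : M) → TangentSpace (𝓡 n) x), IsC1 Q →
        (∀ x ∉ C, Q x = 0) → divInt A (fun x => (∑ j ∈ insert i s, ρ j x) • Q x)
          = divInt A (fun x => ρ i x • Q x) + divInt A (fun x => (∑ j ∈ s, ρ j x) • Q x) := by
      intro A Q hQ hQ0
      have sQ : SupportedIn U Q := ⟨C, hCU, hC, hQ0⟩
      rw [← divInt_add (IsC1.smul hQ (hρ i)) (IsC1.smul hQ hsum) (sQ.smul _) (sQ.smul _)]
      congr 1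
      funext x
      rw [Finset.sum_insert hi, add_smul]
    refine ⟨fun x => Q₁ x + Z₁ x, fun x => Q₂ x + Z₂ x,
      ⟨IsC1.add k11 h11, k12.add h12, fun x => ?_⟩,
      ⟨IsC1.add k21 h21, k22.add h22, fun x => ?_⟩, ?_⟩
    · rw [Finset.sum_insert hi]
      exact (norm_add_le _ _).trans (add_le_add (k13 x) (h13 x))
    · rw [Finset.sum_insert hi]
      exact (norm_add_le _ _).trans (add_le_add (k23 x) (h23 x))
    · rw [split _ X hX hX0, split _ Y hY hY0, divInt_add k11 h11 k12 h12,
        divInt_add k21 h21 k22 h22, Finset.sum_insert hi]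
      linarith

/-- The perimeter is submodular. -/
theorem perimeter_union_add_perimeter_inter_le {U : Set M} (hU : IsOpen U) {E F : Set M}
    (hE : MeasurableSet E) (hF : MeasurableSet F) :
    perimeter n (E ∪ F) U + perimeter n (E ∩ F) U ≤ perimeter n E U + perimeter n F U := by
  have : LocallyCompactSpace M := ChartedSpace.locallyCompactSpace (Coord n) M
  refine perimeter_add_le fun X Y hX hY => ?_
  obtain ⟨CX, hCXU, hCX, hX0⟩ := hX.2.1
  obtain ⟨CY, hCYU, hCY, hY0⟩ := hY.2.1
  set C := CX ∪ CY with hCdef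
  have hC : IsCompact C := hCX.union hCY
  have hCU : C ⊆ U := union_subset hCXU hCYU
  replace hX0 : ∀ x ∉ C, X x = 0 := fun x hx => hX0 x fun h => hx (Or.inl h)
  replace hY0 : ∀ x ∉ C, Y x = 0 := fun x hx => hY0 x fun h => hx (Or.inr h)
  obtain ⟨t, -, ht⟩ := hC.elim_nhds_subcover (fun x => (chartAt (Coord n) x).source)
    fun x _ => (chartAt (Coord n) x).open_source.mem_nhds (mem_chart_source _ x)
  obtain ⟨ρ, hρ⟩ := SmoothPartitionOfUnity.exists_isSubordinate (𝓡 n) hC.isClosed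
    (fun x : t => (chartAt (Coord n) x.1).source) (fun x => (chartAt (Coord n) x.1).open_source)
    (fun x hx => by
      obtain ⟨i, hi, hx⟩ := mem_iUnion₂.1 (ht hx)
      exact mem_iUnion.2 ⟨⟨i, hi⟩, hx⟩)
  have hsum1 : ∀ x ∈ C, ∑ i, ρ i x = 1 := fun x hx => by
    rw [← finsum_eq_sum_of_fintype]; exact ρ.sum_eq_one hx
  have hsum2 : ∀ x, ∑ i, ρ i x ≤ 1 := fun x => by
    rw [← finsum_eq_sum_of_fintype]; exact ρ.sum_le_one x
  have hself : ∀ Q : (x : M) → TangentSpace (𝓡 n) x, (∀ x ∉ C, Q x = 0) →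
      (fun x => (∑ i, ρ i x) • Q x) = Q := by
    intro Q hQ
    funext x
    by_cases hx : x ∈ C
    · rw [hsum1 x hx, one_smul]
    · rw [hQ x hx, smul_zero]
  have key : ∀ δ : ℝ, 0 < δ → ENNReal.ofReal (divInt (E ∪ F) X + divInt (E ∩ F) Y)
      ≤ ENNReal.ofReal (1 + δ) * (perimeter n E U + perimeter n F U) + ENNReal.ofReal δ := by
    intro δ hδ
    -- `N` counts the charts, and the error per chart is `δ / (N + 1)`; the `1` guards against an
    -- empty cover.
    set N : ℝ := ((Finset.univ : Finset t).card : ℝ) with hN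
    have hN0 : 0 ≤ N := Nat.cast_nonneg _
    have hd : 0 < δ / (N + 1) := by positivity
    have hNd : N * (δ / (N + 1)) ≤ δ := by
      rw [mul_div_assoc', div_le_iff₀ (by positivity)]
      nlinarith
    obtain ⟨Z₁, Z₂, ⟨h11, h12, h13⟩, ⟨h21, h22, h23⟩, h3⟩ := exists_fields_sum
      (φ := fun x : t => chartAt (Coord n) x.1)
      (fun x => IsManifold.chart_mem_maximalAtlas x.1) hU hE hF hX.1 hY.1 hC hCU
      hX0 hY0 hX.2.2 hY.2.2 (ρ := fun i => ρ i)
      (fun i => (ρ i).contMDiff.of_le (by exact mod_cast le_top))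
      (fun i x => ⟨ρ.nonneg i x, ρ.le_one i x⟩) hρ hd Finset.univ
    rw [hself X hX0, hself Y hY0, Finset.sum_const, nsmul_eq_mul] at h3
    have hb : ∀ x, ∑ i, (ρ i x + δ / (N + 1)) ≤ 1 + δ := fun x => by
      rw [Finset.sum_add_distrib, Finset.sum_const, nsmul_eq_mul]
      exact add_le_add (hsum2 x) hNd
    have g1 := ofReal_divInt_le_mul_perimeter (A := E) h11 h12 (c := 1 + δ) (by positivity)
      fun x => (h13 x).trans (hb x)
    have g2 := ofReal_divInt_le_mul_perimeter (A := F) h21 h22 (c := 1 + δ) (by positivity)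
      fun x => (h23 x).trans (hb x)
    calc _ ≤ ENNReal.ofReal (divInt E Z₁ + divInt F Z₂ + δ) :=
          ENNReal.ofReal_le_ofReal (h3.trans (by gcongr))
      _ ≤ ENNReal.ofReal (divInt E Z₁) + ENNReal.ofReal (divInt F Z₂) + ENNReal.ofReal δ :=
          ENNReal.ofReal_add_le.trans (by gcongr; exact ENNReal.ofReal_add_le)
      _ ≤ _ := by rw [mul_add]; gcongr
  by_cases htop : perimeter n E U + perimeter n F U = ⊤
  · rw [htop]; exact le_top
  have hlim : Filter.Tendsto (fun δ : ℝ => ENNReal.ofReal (1 + δ) *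
      (perimeter n E U + perimeter n F U) + ENNReal.ofReal δ) (𝓝[>] 0)
      (𝓝 (ENNReal.ofReal (1 + 0) * (perimeter n E U + perimeter n F U) + ENNReal.ofReal 0)) := by
    refine Filter.Tendsto.mono_left ?_ nhdsWithin_le_nhds
    refine (ENNReal.Tendsto.mul_const ?_ (Or.inr htop)).add ENNReal.continuous_ofReal.continuousAt
    exact (ENNReal.continuous_ofReal.comp (continuous_const.add continuous_id)).tendsto (0 : ℝ)
  rw [add_zero, ENNReal.ofReal_one, one_mul, ENNReal.ofReal_zero, add_zero] at hlim
  exact ge_of_tendsto hlim (eventually_nhdsWithin_of_forall fun δ hδ => key δ hδ)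

lemma perimeter_inter_le {U : Set M} (hU : IsOpen U) {E F : Set M}
    (hE : MeasurableSet E) (hF : MeasurableSet F) :
    perimeter n (E ∩ F) U ≤ perimeter n E U + perimeter n F U :=
  le_add_self.trans (perimeter_union_add_perimeter_inter_le hU hE hF)

end Submodularity

end WeakIMCF
end

noncomputable section

namespace WeakIMCF

/-! ### Shears of the coordinate space -/

section EuclideanShear

variable {n : ℕ}

/-- The shear `z ↦ z - γ(z) e`. -/
def shear (γ : Coord n → ℝ) (e : Coord n) (z : Coord n) : Coord n := z - γ z • e

/-- The derivative of a shear. -/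
def shearDeriv (γ : Coord n → ℝ) (e z : Coord n) : Coord n →L[ℝ] Coord n :=
  ContinuousLinearMap.id ℝ (Coord n) - (fderiv ℝ γ z).smulRight e

lemma shearDeriv_apply (γ : Coord n → ℝ) (e z w : Coord n) :
    shearDeriv γ e z w = w - fderiv ℝ γ z w • e := rfl

lemma hasFDerivAt_shear {γ : Coord n → ℝ} {z : Coord n} (hγ : DifferentiableAt ℝ γ z)
    (e : Coord n) : HasFDerivAt (shear γ e) (shearDeriv γ e z) z :=
  (hasFDerivAt_id z).sub (hγ.hasFDerivAt.smul_const e)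

/-- The derivative is the identity minus a map of rank one, that is, a transvection. -/
lemma det_shearDeriv (γ : Coord n → ℝ) (e z : Coord n) :
    (shearDeriv γ e z).det = 1 - fderiv ℝ γ z e := by
  have h : ((shearDeriv γ e z : Coord n →L[ℝ] Coord n) : Coord n →ₗ[ℝ] Coord n)
      = LinearMap.transvection (fderiv ℝ γ z : Coord n →ₗ[ℝ] ℝ) (-e) := by
    ext w : 1
    simp [shearDeriv_apply, LinearMap.transvection.apply, sub_eq_add_neg]
  rw [ContinuousLinearMap.det, h, LinearMap.transvection.det]
  simp [sub_eq_add_neg]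

/-- The shear is the identity perturbed by the contraction `γ • e`. -/
lemma injective_shear {γ : Coord n → ℝ} {e : Coord n} {L : ℝ≥0} (hγ : LipschitzWith L γ)
    (hL : L * ‖e‖ < 1) : Function.Injective (shear γ e) := by
  intro z w h
  have h1 : z - w = (γ z - γ w) • e := by
    unfold shear at h
    rw [sub_smul]
    have := sub_eq_sub_iff_add_eq_add.1 h
    rw [sub_eq_sub_iff_add_eq_add, this, add_comm]
  have h2 : ‖z - w‖ ≤ L * ‖e‖ * ‖z - w‖ := by
    conv_lhs => rw [h1, norm_smul]
    have := hγ.dist_le_mul z w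
    rw [Real.dist_eq, ← Real.norm_eq_abs, dist_eq_norm] at this
    calc _ ≤ (L * ‖z - w‖) * ‖e‖ := by gcongr
      _ = _ := by ring
  by_contra hne
  have h3 : 0 < ‖z - w‖ := norm_pos_iff.2 (sub_ne_zero.2 hne)
  nlinarith

lemma lipschitzWith_const_mul {χ : Coord n → ℝ} {L : ℝ≥0} (hL : LipschitzWith L χ) {s : ℝ}
    (hs : 0 ≤ s) : LipschitzWith (Real.toNNReal s * L) fun z => s * χ z := by
  refine LipschitzWith.of_dist_le_mul fun z w => ?_
  have := hL.dist_le_mul z w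
  rw [Real.dist_eq] at this ⊢
  rw [← mul_sub, abs_mul, abs_of_nonneg hs, NNReal.coe_mul, Real.coe_toNNReal _ hs, mul_assoc]
  gcongr

lemma injective_shear_const_mul {χ : Coord n → ℝ} {L : ℝ≥0} (hL : LipschitzWith L χ) {s : ℝ}
    (hs : 0 ≤ s) (hsL : s * L < 1) {e : Coord n} (he : ‖e‖ ≤ 1) :
    Function.Injective (shear (fun z => s * χ z) e) := by
  refine injective_shear (lipschitzWith_const_mul hL hs) ?_
  rw [NNReal.coe_mul, Real.coe_toNNReal _ hs]
  calc s * L * ‖e‖ ≤ s * L * 1 := by gcongr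
    _ < 1 := by linarith

lemma shear_of_eq_zero {γ : Coord n → ℝ} {z : Coord n} (h : γ z = 0) (e : Coord n) :
    shear γ e z = z := by simp [shear, h]

/-- The shear fixes every point off `S`. If a point of `S` were mapped to some `y ∉ S`, it would
have the same image as `y`, contradicting injectivity. -/
lemma mapsTo_shear {γ : Coord n → ℝ} {e : Coord n} (hi : Function.Injective (shear γ e))
    {S : Set (Coord n)} (hS : ∀ z ∉ S, γ z = 0) : MapsTo (shear γ e) S S := by
  intro z hz
  by_contra h
  rw [hi (shear_of_eq_zero (hS _ h) e)] at h
  exact h hz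

lemma mem_image_shear_iff {γ : Coord n → ℝ} {e : Coord n} (hi : Function.Injective (shear γ e))
    {S A : Set (Coord n)} (hS : ∀ z ∉ S, γ z = 0) {z : Coord n} (hz : z ∉ S) :
    z ∈ shear γ e '' A ↔ z ∈ A := by
  constructor
  · rintro ⟨w, hw, rfl⟩
    have : w ∉ S := fun h => hz (mapsTo_shear hi hS h)
    rwa [shear_of_eq_zero (hS w this) e]
  · exact fun h => ⟨z, h, shear_of_eq_zero (hS z hz) e⟩

/-- The Piola transform of a field under a shear. -/
def shearField (γ : Coord n → ℝ) (e : Coord n) (W : Coord n → Coord n) (z : Coord n) : Coord n :=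
  (1 - fderiv ℝ γ z e) • W (shear γ e z) + fderiv ℝ γ z (W (shear γ e z)) • e

lemma contDiff_shear {γ : Coord n → ℝ} {k : WithTop ℕ∞} (hγ : ContDiff ℝ k γ) (e : Coord n) :
    ContDiff ℝ k (shear γ e) := contDiff_id.sub (hγ.smul contDiff_const)

lemma contDiff_shearField {γ : Coord n → ℝ} (hγ : ContDiff ℝ 2 γ) (e : Coord n)
    {W : Coord n → Coord n} (hW : ContDiff ℝ 1 W) : ContDiff ℝ 1 (shearField γ e W) := by
  have h1 : ContDiff ℝ 1 (fderiv ℝ γ) := hγ.fderiv_right (by norm_num)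
  have h2 := hW.comp (contDiff_shear (hγ.of_le (by norm_num)) e)
  exact ((contDiff_const.sub (h1.clm_apply contDiff_const)).smul h2).add
    ((h1.clm_apply h2).smul contDiff_const)

/-- This is the Piola identity. The two terms with `D²γ` cancel by symmetry, which is why `γ` is
taken `C^2`. The terms `∇γ (DW e)` cancel because the derivative of the shear maps `e` to `(1 - ∂_e
γ) e`. -/
lemma ediv_shearField {γ : Coord n → ℝ} (hγ : ContDiff ℝ 2 γ) (e : Coord n)
    {W : Coord n → Coord n} (hW : ContDiff ℝ 1 W) (z : Coord n) :
    ediv (shearField γ e W) z = (1 - fderiv ℝ γ z e) * ediv W (shear γ e z) := by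
  have h1 : ContDiff ℝ 1 (fderiv ℝ γ) := hγ.fderiv_right (by norm_num)
  have h2 := hW.comp (contDiff_shear (hγ.of_le (by norm_num)) e)
  have dV : HasFDerivAt (fun y => W (shear γ e y))
      ((fderiv ℝ W (shear γ e z)).comp (shearDeriv γ e z)) z :=
    ((hW.differentiable one_ne_zero).differentiableAt.hasFDerivAt).comp z
      (hasFDerivAt_shear (hγ.differentiable two_ne_zero).differentiableAt e)
  have dG : HasFDerivAt (fderiv ℝ γ) (fderiv ℝ (fderiv ℝ γ) z) z :=
    (h1.differentiable one_ne_zero).differentiableAt.hasFDerivAt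
  have dJ : HasFDerivAt (fun y => 1 - fderiv ℝ γ y e)
      (-((fderiv ℝ (fderiv ℝ γ) z).flip e)) z := by
    simpa using (hasFDerivAt_const (1 : ℝ) z).fun_sub (dG.clm_apply (hasFDerivAt_const e z))
  have dK := dG.clm_apply dV
  have hsymm : IsSymmSndFDerivAt ℝ γ z := hγ.contDiffAt.isSymmSndFDerivAt (by simp)
  have hV : ediv (fun y => W (shear γ e y)) z
      = ediv W (shear γ e z) - fderiv ℝ γ z (fderiv ℝ W (shear γ e z) e) := by
    unfold ediv
    rw [dV.fderiv]
    have hw : fderiv ℝ W (shear γ e z) e = ∑ i, (fderiv ℝ W (shear γ e z) e) i •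
        (EuclideanSpace.single i (1 : ℝ) : Coord n) := by
      simpa using ((EuclideanSpace.basisFun (Fin n) ℝ).sum_repr (fderiv ℝ W (shear γ e z) e)).symm
    conv_rhs => rw [hw]
    rw [map_sum, ← Finset.sum_sub_distrib]
    refine Finset.sum_congr rfl fun i _ => ?_
    simp [shearDeriv_apply, mul_comm]
  have hc : ediv (fun _ : Coord n => e) z = 0 := by
    unfold ediv
    simp
  unfold shearField
  rw [ediv_add (dJ.differentiableAt.fun_smul dV.differentiableAt)
      (dK.differentiableAt.fun_smul (differentiableAt_const e)),
    ediv_smul dJ.differentiableAt dV.differentiableAt,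
    ediv_smul dK.differentiableAt (differentiableAt_const e), hV, hc, dJ.fderiv, dK.fderiv]
  have := hsymm (W (shear γ e z)) e
  simp [shearDeriv_apply, this]
  ring

lemma setIntegral_ediv_shearField {γ : Coord n → ℝ} (hγ : ContDiff ℝ 2 γ) {e : Coord n}
    (hi : Function.Injective (shear γ e)) (hJ : ∀ z, fderiv ℝ γ z e ≤ 1)
    {W : Coord n → Coord n} (hW : ContDiff ℝ 1 W) {A : Set (Coord n)} (hA : MeasurableSet A) :
    ∫ z in shear γ e '' A, ediv W z = ∫ z in A, ediv (shearField γ e W) z := by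
  rw [integral_image_eq_integral_abs_det_fderiv_smul volume hA
    (fun z _ => (hasFDerivAt_shear (hγ.differentiable two_ne_zero).differentiableAt
      e).hasFDerivWithinAt) hi.injOn]
  refine setIntegral_congr_fun hA fun z _ => ?_
  rw [ediv_shearField hγ e hW, det_shearDeriv, abs_of_nonneg (sub_nonneg.2 (hJ z)), smul_eq_mul]

lemma measurableSet_image_shear {γ : Coord n → ℝ} (hγ : Continuous γ) {e : Coord n}
    (hi : Function.Injective (shear γ e)) {A : Set (Coord n)} (hA : MeasurableSet A) :
    MeasurableSet (shear γ e '' A) :=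
  hA.image_of_continuousOn_injOn
    (continuous_id.sub (hγ.smul continuous_const)).continuousOn hi.injOn

/-- Small shears move little volume. -/
lemma tendsto_volume_shear {χ : Coord n → ℝ} (hχ : ContDiff ℝ 2 χ) (hχc : HasCompactSupport χ)
    {L : ℝ≥0} (hL : LipschitzWith L χ) {e : Coord n} (he : ‖e‖ ≤ 1) {A : Set (Coord n)}
    (hA : MeasurableSet A) (hAf : volume A ≠ ⊤) :
    Filter.Tendsto (fun s : ℝ => volume (symmDiff (shear (fun z => s * χ z) e '' A) A))
      (𝓝[>] 0) (𝓝 0) := by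
  rw [ENNReal.tendsto_nhds_zero]
  intro ε hε
  -- The seven parts are `3 d` for the image minus `A` and `4 d` for `A` minus the image.
  have hε' : ε / 7 ≠ 0 := (ENNReal.div_pos hε.ne' (by norm_num)).ne'
  set d := ε / 7 with hd
  -- A sufficiently small shear keeps the compact core `Kc` inside the open set `O ⊇ A`, so points
  -- leaving `A` are in `O \ A` or come from `A \ Kc`.
  obtain ⟨Kc, hKA, hKc, hKd⟩ := hA.exists_isCompact_sdiff_lt hAf hε'
  obtain ⟨O, hAO, hO, -, hOd⟩ := hA.exists_isOpen_sdiff_lt hAf hε'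
  obtain ⟨r, hr, hrO⟩ := hKc.exists_cthickening_subset_open hO (hKA.trans hAO)
  obtain ⟨B, hB⟩ := hχ.continuous.bounded_above_of_compact_support hχc
  have t0 : Filter.Tendsto (fun s : ℝ => s) (𝓝[>] 0) (𝓝 0) := nhdsWithin_le_nhds
  have e1 : ∀ᶠ s : ℝ in 𝓝[>] 0, s * B < r := by
    have : Filter.Tendsto (fun s : ℝ => s * B) (𝓝[>] 0) (𝓝 (0 * B)) := t0.mul_const B
    rw [zero_mul] at this
    exact this.eventually (gt_mem_nhds hr)
  have e2 : ∀ᶠ s : ℝ in 𝓝[>] 0, s * L < 1 := by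
    have : Filter.Tendsto (fun s : ℝ => s * L) (𝓝[>] 0) (𝓝 (0 * L)) := t0.mul_const (L : ℝ)
    rw [zero_mul] at this
    exact this.eventually (gt_mem_nhds one_pos)
  have e3 : ∀ᶠ s : ℝ in 𝓝[>] 0, ENNReal.ofReal (s * L) * volume A < d := by
    have h1 : Filter.Tendsto (fun s : ℝ => s * L) (𝓝[>] 0) (𝓝 (0 * L)) := t0.mul_const (L : ℝ)
    have h2 := ENNReal.Tendsto.mul_const (ENNReal.tendsto_ofReal h1) (Or.inr hAf)
    rw [zero_mul, ENNReal.ofReal_zero, zero_mul] at h2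
    exact h2.eventually (gt_mem_nhds (pos_iff_ne_zero.2 hε'))
  filter_upwards [e1, e2, e3, self_mem_nhdsWithin] with s h1 h2 h3 hs
  replace hs : 0 < s := hs
  set γ : Coord n → ℝ := fun z => s * χ z with hγdef
  have hγ : ContDiff ℝ 2 γ := contDiff_const.mul hχ
  have hγL : LipschitzWith (Real.toNNReal s * L) γ := lipschitzWith_const_mul hL hs.le
  have hi : Function.Injective (shear γ e) := injective_shear_const_mul hL hs.le h2 he
  have hJ : ∀ z, |fderiv ℝ γ z e| ≤ s * L := fun z => by
    have h := norm_fderiv_le_of_lipschitz ℝ hγL (x₀ := z)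
    rw [NNReal.coe_mul, Real.coe_toNNReal _ hs.le] at h
    calc _ ≤ ‖fderiv ℝ γ z‖ * ‖e‖ := (fderiv ℝ γ z).le_opNorm e
      _ ≤ (s * L) * 1 := by gcongr
      _ = _ := mul_one _
  have hcv : ∀ T, MeasurableSet T → ∫⁻ z in T, ENNReal.ofReal |(shearDeriv γ e z).det|
      = volume (shear γ e '' T) := fun T hT =>
    lintegral_abs_det_fderiv_eq_addHaar_image volume hT
      (fun z _ => (hasFDerivAt_shear (hγ.differentiable two_ne_zero).differentiableAt
      e).hasFDerivWithinAt) hi.injOn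
  have up : volume (shear γ e '' (A \ Kc)) ≤ 2 * d := by
    rw [← hcv _ (hA.diff hKc.isClosed.measurableSet)]
    calc _ ≤ ∫⁻ z in A \ Kc, 2 := by
          refine lintegral_mono fun z => ?_
          rw [det_shearDeriv]
          refine (ENNReal.ofReal_le_ofReal (abs_le.2 ?_)).trans_eq (ENNReal.ofReal_ofNat 2)
          have := abs_le.1 (hJ z)
          constructor <;> linarith
      _ = 2 * volume (A \ Kc) := by simp
      _ ≤ 2 * d := by gcongr
  have low : volume A ≤ volume (shear γ e '' A) + d := by
    rw [← hcv _ hA]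
    have hm : Measurable fun z => ENNReal.ofReal |(shearDeriv γ e z).det| := by
      simp only [det_shearDeriv]
      have : Continuous fun z => fderiv ℝ γ z e :=
        (hγ.continuous_fderiv two_ne_zero).clm_apply continuous_const
      fun_prop
    calc volume A = ∫⁻ z in A, 1 := by simp
      _ ≤ ∫⁻ z in A, (ENNReal.ofReal |(shearDeriv γ e z).det| + ENNReal.ofReal (s * L)) := by
          refine lintegral_mono fun z => ?_
          rw [← ENNReal.ofReal_add (abs_nonneg _) (by positivity), ← ENNReal.ofReal_one,
            det_shearDeriv]
          refine ENNReal.ofReal_le_ofReal ?_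
          have := abs_le.1 (hJ z)
          have := le_abs_self (1 - fderiv ℝ γ z e)
          linarith
      _ = (∫⁻ z in A, ENNReal.ofReal |(shearDeriv γ e z).det|)
          + ENNReal.ofReal (s * L) * volume A := by
          rw [lintegral_add_left hm]; simp
      _ ≤ _ := by gcongr
  have hmA := measurableSet_image_shear hγ.continuous hi hA
  have sub : shear γ e '' A \ A ⊆ shear γ e '' (A \ Kc) ∪ (O \ A) := by
    rintro _ ⟨⟨z, hz, rfl⟩, hzA⟩
    by_cases hzK : z ∈ Kc
    · refine Or.inr ⟨hrO (Metric.mem_cthickening_of_dist_le _ z _ _ hzK ?_), hzA⟩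
      rw [dist_eq_norm, shear, sub_sub_cancel_left, norm_neg, norm_smul, hγdef, norm_mul,
        Real.norm_of_nonneg hs.le]
      calc s * ‖χ z‖ * ‖e‖ ≤ s * B * 1 := by
            have := hB z
            have := (norm_nonneg _).trans this
            gcongr
        _ ≤ r := by linarith
    · exact Or.inl ⟨z, ⟨hz, hzK⟩, rfl⟩
  have b1 : volume (shear γ e '' A \ A) ≤ 3 * d := by
    calc _ ≤ volume (shear γ e '' (A \ Kc)) + volume (O \ A) :=
          (measure_mono sub).trans (measure_union_le _ _)
      _ ≤ 2 * d + d := by gcongr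
      _ = 3 * d := by ring
  -- The shear loses at most `d` of the volume of `A`, so the part of `A` outside the image is
  -- controlled by the part of the image outside `A`.
  have b2 : volume (A \ shear γ e '' A) ≤ 4 * d := by
    have i1 := measure_inter_add_sdiff (μ := volume) A hmA
    have i2 := measure_inter_add_sdiff (μ := volume) (shear γ e '' A) hA
    have hfin : volume (A ∩ shear γ e '' A) ≠ ⊤ :=
      ((measure_mono inter_subset_left).trans_lt hAf.lt_top).ne
    rw [← i1, ← i2, inter_comm (shear γ e '' A) A, add_assoc] at low
    calc _ ≤ volume (shear γ e '' A \ A) + d := (ENNReal.add_le_add_iff_left hfin).1 low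
      _ ≤ 3 * d + d := by gcongr
      _ = 4 * d := by ring
  calc _ ≤ volume (shear γ e '' A \ A) + volume (A \ shear γ e '' A) := measure_union_le _ _
    _ ≤ 3 * d + 4 * d := add_le_add b1 b2
    _ = d * 7 := by ring
    _ = ε := ENNReal.div_mul_cancel (by norm_num) (by norm_num)

end EuclideanShear

end WeakIMCF
end

noncomputable section

namespace WeakIMCF

/-! ### Shears of sets in a manifold -/

section ManifoldShear

variable {n : ℕ} {M : Type*} [EMetricSpace M] [ChartedSpace (Coord n) M]

/-- The image of a set under a shear in a chart, extended by the identity. -/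
def shearSet (φ : OpenPartialHomeomorph M (Coord n)) (γ : Coord n → ℝ) (e : Coord n) (F : Set M) :
    Set M :=
  F \ φ.source ∪ φ.source ∩ φ ⁻¹' (shear γ e '' (φ.target ∩ φ.symm ⁻¹' F))

lemma mem_shearSet_iff {φ : OpenPartialHomeomorph M (Coord n)} {γ : Coord n → ℝ} {e : Coord n}
    (hi : Function.Injective (shear γ e)) {S : Set (Coord n)} (hS : ∀ z ∉ S, γ z = 0)
    {F : Set M} {x : M} (hx : x ∉ φ.symm '' S) : x ∈ shearSet φ γ e F ↔ x ∈ F := by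
  unfold shearSet
  by_cases hs : x ∈ φ.source
  · have h1 : φ x ∉ S := fun h => hx ⟨φ x, h, φ.left_inv hs⟩
    simp only [mem_union, mem_sdiff, hs, not_true_eq_false, and_false, false_or, mem_inter_iff,
      true_and, mem_preimage]
    rw [mem_image_shear_iff hi hS h1]
    simp [φ.left_inv hs, φ.map_source hs]
  · simp [hs]

lemma target_inter_shearSet {φ : OpenPartialHomeomorph M (Coord n)} {γ : Coord n → ℝ}
    {e : Coord n} (hi : Function.Injective (shear γ e)) {S : Set (Coord n)}
    (hS : ∀ z ∉ S, γ z = 0) (hSt : S ⊆ φ.target) (F : Set M) :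
    φ.target ∩ φ.symm ⁻¹' shearSet φ γ e F = shear γ e '' (φ.target ∩ φ.symm ⁻¹' F) := by
  ext z
  constructor
  · rintro ⟨hz, h⟩
    rcases h with h | h
    · exact (h.2 (φ.map_target hz)).elim
    · have := h.2
      rwa [mem_preimage, φ.right_inv hz] at this
  · rintro ⟨w, hw, rfl⟩
    have hz : shear γ e w ∈ φ.target := by
      by_cases hwS : w ∈ S
      · exact hSt (mapsTo_shear hi hS hwS)
      · rw [shear_of_eq_zero (hS w hwS)]; exact hw.1
    refine ⟨hz, Or.inr ⟨φ.map_target hz, ?_⟩⟩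
    rw [mem_preimage, φ.right_inv hz]
    exact ⟨w, hw, rfl⟩

variable [RiemannianBundle (fun x : M => TangentSpace (𝓡 n) x)] [IsManifold (𝓡 n) ∞ M]
  [IsContMDiffRiemannianBundle (𝓡 n) ∞ (Coord n) (fun x : M => TangentSpace (𝓡 n) x)]
  [SecondCountableTopology M] [MeasurableSpace M] [BorelSpace M]

lemma measurableSet_shearSet {φ : OpenPartialHomeomorph M (Coord n)} {γ : Coord n → ℝ}
    (hγ : Continuous γ) {e : Coord n} (hi : Function.Injective (shear γ e)) {F : Set M}
    (hF : MeasurableSet F) : MeasurableSet (shearSet φ γ e F) := by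
  refine (hF.diff φ.open_source.measurableSet).union ?_
  have h := (φ.continuousOn.domRestrict.measurable)
    (measurableSet_image_shear hγ hi (measurableSet_target_inter φ hF))
  have h2 := φ.open_source.measurableSet.subtype_image h
  convert h2 using 1
  ext z
  simp [and_comm]

lemma norm_shearField_sub_le {γ : Coord n → ℝ}
    {e z : Coord n} {L : ℝ≥0} (hL : LipschitzWith L γ) (he : ‖e‖ ≤ 1) (W : Coord n → Coord n) :
    ‖shearField γ e W z - W (shear γ e z)‖ ≤ 2 * L * ‖W (shear γ e z)‖ := by
  have h : ∀ w, |fderiv ℝ γ z w| ≤ L * ‖w‖ := fun w =>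
    ((fderiv ℝ γ z).le_opNorm w).trans
      (mul_le_mul_of_nonneg_right (norm_fderiv_le_of_lipschitz ℝ hL) (norm_nonneg _))
  set w := W (shear γ e z)
  have e1 : shearField γ e W z - w = -(fderiv ℝ γ z e • w) + fderiv ℝ γ z w • e := by
    unfold shearField
    rw [sub_smul, one_smul]
    abel
  rw [e1]
  refine (norm_add_le _ _).trans ?_
  rw [norm_neg, norm_smul, norm_smul, Real.norm_eq_abs, Real.norm_eq_abs]
  have h1 := h e
  have h2 := h w
  have h3 : (L : ℝ) * ‖e‖ ≤ L := mul_le_of_le_one_right L.2 he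
  calc _ ≤ L * ‖w‖ + L * ‖w‖ * 1 := by
        gcongr
        linarith
    _ = _ := by ring

/-- Small shears almost do not increase the perimeter. -/
theorem exists_perimeter_shearSet_le {φ : OpenPartialHomeomorph M (Coord n)}
    (hφ : φ ∈ IsManifold.maximalAtlas (𝓡 n) ∞ M) {K : Set M} (hK : IsOpen K)
    {S : Set (Coord n)} (hS : IsCompact S) (hSt : S ⊆ φ.target) (hSK : φ.symm '' S ⊆ K)
    {δ : ℝ} (hδ : 0 < δ) :
    ∃ r > 0, ∀ γ : Coord n → ℝ, ∀ e : Coord n, ∀ L : ℝ≥0, ContDiff ℝ 2 γ → (∀ z ∉ S, γ z = 0) →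
      (∀ z, |γ z| ≤ r) → LipschitzWith L γ → L ≤ r → L < 1 → ‖e‖ ≤ 1 →
      ∀ F : Set M, MeasurableSet F →
        perimeter n (shearSet φ γ e F) K ≤ ENNReal.ofReal (1 + δ) * perimeter n F K := by
  obtain ⟨r₀, hr₀, hr⟩ := exists_chartNorm_le hφ hS hSt hδ
  have hC : IsCompact (φ.symm '' S) := hS.image_of_continuousOn (φ.continuousOn_symm.mono hSt)
  have hCs : φ.symm '' S ⊆ φ.source := by
    rintro _ ⟨z, hz, rfl⟩
    exact φ.map_target (hSt hz)
  -- The cut-off is `1` near the sheared region. There the test field is transported by the Piola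
  -- transform; the part `(1 - η) X` does not see the shear.
  obtain ⟨η, hη, hη1, ⟨D, hDK, hD, hη0⟩, hη01⟩ := exists_cutoff n hC (hK.inter φ.open_source)
    (subset_inter hSK hCs)
  have hη' : ContMDiff (𝓡 n) 𝓘(ℝ, ℝ) 1 η := hη.of_le (by exact mod_cast le_top)
  have hθ' : ContMDiff (𝓡 n) 𝓘(ℝ, ℝ) 1 fun x => 1 - η x := contMDiff_const.sub hη'
  -- The factor `1 / 2` compensates the constant `2` in `norm_shearField_sub_le`.
  refine ⟨r₀ / 2, by positivity, fun γ e L hγ hγS hγr hL hLr hL1 he F hF => ?_⟩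
  have hi : Function.Injective (shear γ e) := by
    refine injective_shear hL ?_
    calc (L : ℝ) * ‖e‖ ≤ L * 1 := by gcongr
      _ < 1 := by rw [mul_one]; exact_mod_cast hL1
  have hJ : ∀ z, fderiv ℝ γ z e ≤ 1 := fun z => by
    calc fderiv ℝ γ z e ≤ ‖fderiv ℝ γ z‖ * ‖e‖ :=
          (le_abs_self _).trans ((fderiv ℝ γ z).le_opNorm e)
      _ ≤ L * 1 := by
          gcongr
          exact norm_fderiv_le_of_lipschitz ℝ hL
      _ ≤ 1 := by rw [mul_one]; exact_mod_cast hL1.le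
  have hmF := measurableSet_shearSet (φ := φ) hγ.continuous hi hF
  refine perimeter_le fun X hX => ?_
  have sηX : SupportedIn (K ∩ φ.source) (fun x => η x • X x) := SupportedIn.smul_left hD hDK X hη0
  have sθX : SupportedIn K (fun x => (1 - η x) • X x) := SupportedIn.smul hX.2.1 _
  have cηX := IsC1.smul hX.1 hη'
  have cθX := IsC1.smul hX.1 hθ'
  have eX : X = fun x => η x • X x + (1 - η x) • X x := by
    funext x
    rw [← add_smul, add_sub_cancel, one_smul]
  obtain ⟨C', hC'K, hC', hC'0⟩ := sηX
  obtain ⟨W, hW, hWc, hWC, hWt, hWX⟩ := exists_eq_fieldOf hφ cηX hC'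
    (hC'K.trans inter_subset_right) hC'0
  set V := shearField γ e W with hVdef
  have hV : ContDiff ℝ 1 V := contDiff_shearField hγ e hW
  have hVoff : ∀ z ∉ S, V z = W z := fun z hz => by
    have h0 : fderiv ℝ γ z = 0 := by
      have : γ =ᶠ[𝓝 z] fun _ => 0 := by
        filter_upwards [hS.isClosed.isOpen_compl.mem_nhds hz] with y hy
        exact hγS y hy
      rw [this.fderiv_eq]
      simp
    simp [hVdef, shearField, h0, shear_of_eq_zero (hγS z hz)]
  have hVsub : tsupport V ⊆ S ∪ tsupport W := by
    refine closure_minimal (fun z hz => ?_) (hS.isClosed.union (isClosed_tsupport W))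
    by_contra h
    refine hz ?_
    rw [hVoff z fun h' => h (Or.inl h')]
    exact image_eq_zero_of_notMem_tsupport fun h' => h (Or.inr h')
  have hVc : HasCompactSupport V :=
    (hS.union hWc.isCompact).of_isClosed_subset (isClosed_tsupport V) hVsub
  have hVt : tsupport V ⊆ φ.target := hVsub.trans (union_subset hSt hWt)
  have cV : IsC1 (fieldOf φ V : (x : M) → TangentSpace (𝓡 n) x) := contMDiff_fieldOf hφ hV hVc hVt
  have sV : SupportedIn K (fieldOf φ V : (x : M) → TangentSpace (𝓡 n) x) := by
    refine ⟨φ.symm '' tsupport V, ?_, isCompact_symm_image_tsupport hVc hVt,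
      fun x hx => fieldOf_of_notMem hx⟩
    rintro _ ⟨z, hz, rfl⟩
    rcases hVsub hz with h | h
    · exact hSK ⟨z, h, rfl⟩
    · obtain ⟨x, hx, rfl⟩ := hWC h
      rw [φ.left_inv (hC'K hx).2]
      exact (hC'K hx).1
  have hsηX : SupportedIn K (fun x => η x • X x) := SupportedIn.smul hX.2.1 _
  have d1 : divInt (shearSet φ γ e F) (fun x => η x • X x) = divInt F (fieldOf φ V) := by
    rw [← hWX]
    unfold divInt
    rw [setIntegral_divergence_fieldOf hφ hW hWc hWt hmF,
      setIntegral_divergence_fieldOf hφ hV hVc hVt hF, target_inter_shearSet hi hγS hSt,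
      setIntegral_ediv_shearField hγ hi hJ hW (measurableSet_target_inter φ hF)]
  have d2 : divInt (shearSet φ γ e F) (fun x => (1 - η x) • X x)
      = divInt F (fun x => (1 - η x) • X x) := by
    unfold divInt
    rw [← integral_indicator hmF, ← integral_indicator hF]
    congr 1
    funext x
    by_cases hx : x ∈ φ.symm '' S
    · have : divergence (fun x => (1 - η x) • X x) x = 0 := by
        refine divergence_eq_zero cθX ?_
        filter_upwards [hη1 x hx] with y hy
        rw [hy, sub_self, zero_smul]
      simp [indicator, this]
    · have := mem_shearSet_iff (F := F) hi hγS hx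
      by_cases hxE : x ∈ F
      · rw [indicator_of_mem hxE, indicator_of_mem (this.2 hxE)]
      · rw [indicator_of_notMem hxE, indicator_of_notMem fun h => hxE (this.1 h)]
  have d3 : divInt (shearSet φ γ e F) X
      = divInt F (fun x => fieldOf φ V x + (1 - η x) • X x) := by
    conv_lhs => rw [eX]
    rw [divInt_add cηX cθX hsηX sθX, divInt_add cV cθX sV sθX, d1, d2]
  rw [d3]
  refine ofReal_divInt_le_mul_perimeter (IsC1.add cV cθX) (sV.add sθX) (by positivity) fun x => ?_
  -- On the sheared region only the transported field is left, and it is a small perturbation of a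
  -- field of norm at most `1`. Elsewhere the sum is `X` itself.
  by_cases hx : x ∈ φ.symm '' S
  · obtain ⟨z, hz, rfl⟩ := hx
    rw [(hη1 _ (mem_image_of_mem _ hz)).self_of_nhds, sub_self, zero_smul, add_zero,
      norm_fieldOf_symm hφ (hSt hz)]
    have hσ := mapsTo_shear hi hγS hz
    have hd : dist z (shear γ e z) ≤ r₀ := by
      rw [dist_eq_norm, shear, sub_sub_cancel, norm_smul, Real.norm_eq_abs]
      calc _ ≤ r₀ / 2 * 1 := by
            gcongr
            exact hγr z
        _ ≤ r₀ := by linarith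
    refine ((hr _ hσ z hd).2 (W (shear γ e z)) _
      ((norm_shearField_sub_le hL he W).trans ?_)).trans ?_
    · gcongr
      linarith
    · rw [← norm_fieldOf_symm hφ (hSt hσ), hWX]
      refine mul_le_of_le_one_right (by positivity) ?_
      rw [norm_smul, Real.norm_eq_abs, abs_of_nonneg (hη01 _).1]
      exact mul_le_one₀ (hη01 _).2 (norm_nonneg _) (hX.2.2 _)
  · have : fieldOf φ V x = η x • X x := by
      rw [← congrFun hWX x]
      unfold fieldOf
      split_ifs with h
      · rw [hVoff _ fun h' => hx ⟨φ x, h', φ.left_inv h⟩]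
      · rfl
    rw [this, ← congrFun eX x]
    exact (hX.2.2 x).trans (by linarith)

/-- Small shears move little volume. -/
lemma tendsto_riemannianVolume_shearSet {φ : OpenPartialHomeomorph M (Coord n)}
    (hφ : φ ∈ IsManifold.maximalAtlas (𝓡 n) ∞ M) {χ : Coord n → ℝ} (hχ : ContDiff ℝ 2 χ)
    (hχc : HasCompactSupport χ) (hχt : tsupport χ ⊆ φ.target) {e : Coord n} (he : ‖e‖ ≤ 1)
    {F : Set M} (hF : MeasurableSet F) :
    Filter.Tendsto
      (fun s : ℝ => riemannianVolume n (symmDiff (shearSet φ (fun z => s * χ z) e F) F))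
      (𝓝[>] 0) (𝓝 0) := by
  obtain ⟨L, hL⟩ := (hχ.of_le one_le_two).lipschitzWith_of_hasCompactSupport hχc one_ne_zero
  set S := tsupport χ with hSdef
  have hS : IsCompact S := hχc
  set A := φ.target ∩ φ.symm ⁻¹' F with hA
  have hAm : MeasurableSet A := measurableSet_target_inter φ hF
  have hASm : MeasurableSet (A ∩ S) := hAm.inter hS.isClosed.measurableSet
  obtain ⟨B, hB⟩ := hS.exists_bound_of_continuousOn ((contDiffOn_densIn hφ).continuousOn.mono hχt)
  have ht := tendsto_volume_shear hχ hχc hL he hASm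
    ((measure_mono inter_subset_right).trans_lt hS.measure_lt_top).ne
  have ht2 := ENNReal.Tendsto.const_mul (a := ENNReal.ofReal B) ht (Or.inr ENNReal.ofReal_ne_top)
  rw [mul_zero] at ht2
  have e2 : ∀ᶠ s : ℝ in 𝓝[>] 0, s * L < 1 := by
    have : Filter.Tendsto (fun s : ℝ => s * L) (𝓝[>] 0) (𝓝 (0 * L)) :=
      Filter.Tendsto.mul_const (L : ℝ) nhdsWithin_le_nhds
    rw [zero_mul] at this
    exact this.eventually (gt_mem_nhds one_pos)
  refine tendsto_of_tendsto_of_tendsto_of_le_of_le' tendsto_const_nhds ht2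
    (Filter.Eventually.of_forall fun _ => bot_le) ?_
  filter_upwards [e2, self_mem_nhdsWithin] with s h2 hs
  replace hs : 0 < s := hs
  have hi := injective_shear_const_mul hL hs.le h2 he
  have hγ : Continuous fun z => s * χ z := continuous_const.mul hχ.continuous
  have hγS : ∀ z ∉ S, s * χ z = 0 := fun z hz => by
    rw [image_eq_zero_of_notMem_tsupport hz, mul_zero]
  have hm := (measurableSet_shearSet (φ := φ) hγ hi hF).symmDiff hF
  have hsub : symmDiff (shearSet φ (fun z => s * χ z) e F) F ⊆ φ.symm '' S := by
    intro x hx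
    by_contra h
    have := mem_shearSet_iff (F := F) hi hγS h
    rw [mem_symmDiff, this] at hx
    tauto
  have hsub2 : symmDiff (shearSet φ (fun z => s * χ z) e F) F ⊆ φ.source := by
    refine hsub.trans ?_
    rintro _ ⟨z, hz, rfl⟩
    exact φ.map_target (hχt hz)
  rw [riemannianVolume_apply_of_subset hφ hm hsub2]
  -- All changes happen in the compact set `S`, which the shear maps to itself. Thus `A` may be
  -- replaced by `A ∩ S`, of finite volume, and the density is bounded by `B` there.
  have hsub3 : φ.target ∩ φ.symm ⁻¹' symmDiff (shearSet φ (fun z => s * χ z) e F) F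
      ⊆ S ∩ symmDiff (shear (fun z => s * χ z) e '' (A ∩ S)) (A ∩ S) := by
    rintro z ⟨hz, hzF⟩
    have hzS : z ∈ S := by
      obtain ⟨w, hw, hwz⟩ := hsub hzF
      have := congrArg φ hwz
      rw [φ.right_inv hz, φ.right_inv (hχt hw)] at this
      exact this ▸ hw
    refine ⟨hzS, ?_⟩
    have e1 : φ.symm z ∈ shearSet φ (fun z => s * χ z) e F
        ↔ z ∈ shear (fun z => s * χ z) e '' A := by
      rw [← target_inter_shearSet hi hγS hχt F]
      simp [hz]
    have e2 : φ.symm z ∈ F ↔ z ∈ A := by simp [hA, hz]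
    have e3 : z ∈ shear (fun z => s * χ z) e '' A
        ↔ z ∈ shear (fun z => s * χ z) e '' (A ∩ S) := by
      constructor
      · rintro ⟨w, hw, rfl⟩
        refine ⟨w, ⟨hw, ?_⟩, rfl⟩
        by_contra h
        rw [shear_of_eq_zero (hγS w h)] at hzS
        exact h hzS
      · exact fun h => image_mono inter_subset_left h
    rw [mem_preimage, mem_symmDiff, e1, e2, e3] at hzF
    rw [mem_symmDiff]
    have e4 : z ∈ A ∩ S ↔ z ∈ A := by simp [hzS]
    rwa [e4]
  calc _ ≤ ∫⁻ z in φ.target ∩ φ.symm ⁻¹' symmDiff (shearSet φ (fun z => s * χ z) e F) F,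
        ENNReal.ofReal B := by
        refine setLIntegral_mono measurable_const fun z hz => ENNReal.ofReal_le_ofReal ?_
        exact (le_abs_self _).trans (hB z (hsub3 hz).1)
    _ ≤ _ := by
        rw [setLIntegral_const]
        gcongr
        exact hsub3.trans inter_subset_right

/-- Near a boundary point of a locally Lipschitz domain, subsets of the domain may be pushed into
its interior, almost without increase of the perimeter. -/
theorem exists_push {Ω : Set M} (hΩ : IsLocallyLipschitzDomain (n := n) Ω) {x₀ : M}
    (hx₀ : x₀ ∈ frontier Ω) {K : Set M} (hK : IsOpen K) (hxK : x₀ ∈ K) :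
    ∃ V ∈ 𝓝 x₀, ∃ C ⊆ K, IsCompact C ∧ ∀ F ⊆ Ω, MeasurableSet F → ∃ G : ℕ → Set M,
      (∀ j, MeasurableSet (G j)) ∧ (∀ j, ∀ x ∉ C, (x ∈ G j ↔ x ∈ F)) ∧
      (∀ j, closure (G j ∩ V) ⊆ Ω) ∧
      Filter.Tendsto (fun j => riemannianVolume n (symmDiff (G j) F)) Filter.atTop (𝓝 0) ∧
      ∀ δ : ℝ, 0 < δ → ∀ᶠ j in Filter.atTop,
        perimeter n (G j) K ≤ ENNReal.ofReal (1 + δ) * perimeter n F K := by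
  obtain ⟨φ, hφ, hxs, k, f, c, hf, hev⟩ := hΩ.2 x₀ hx₀
  set O := φ.target ∩ φ.symm ⁻¹' K with hO
  have hOo : IsOpen O := φ.symm.isOpen_inter_preimage hK
  obtain ⟨N, hN, hNo, hxN⟩ := eventually_nhds_iff.1 hev
  have hOx : φ x₀ ∈ O ∩ φ.symm ⁻¹' N := by
    refine ⟨⟨φ.map_source hxs, ?_⟩, ?_⟩ <;> rw [mem_preimage, φ.left_inv hxs] <;> assumption
  have hO' : IsOpen (φ.target ∩ φ.symm ⁻¹' (K ∩ N)) :=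
    φ.symm.isOpen_inter_preimage (hK.inter hNo)
  obtain ⟨ε, hε, hεO⟩ := Metric.nhds_basis_closedBall.mem_iff.1
    (hO'.mem_nhds (show φ x₀ ∈ φ.target ∩ φ.symm ⁻¹' (K ∩ N) from ⟨hOx.1.1, hOx.1.2, hOx.2⟩))
  -- The bump is `1` on the ball of radius `ε / 2`. With shifts below `ε / 4`, every point sheared
  -- into the ball of radius `ε / 4` comes from there, so it has moved by the full amount `s j`.
  let χ : ContDiffBump (φ x₀) := ⟨ε / 2, ε, by positivity, by linarith⟩
  have hχ : ContDiff ℝ 2 χ := χ.contDiff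
  have hχc : HasCompactSupport χ := χ.hasCompactSupport
  have hχS : tsupport χ = Metric.closedBall (φ x₀) ε := χ.tsupport_eq
  have hχt : tsupport χ ⊆ φ.target := by
    rw [hχS]; exact hεO.trans inter_subset_left
  obtain ⟨L, hL⟩ := (hχ.of_le one_le_two).lipschitzWith_of_hasCompactSupport hχc one_ne_zero
  set e : Coord n := EuclideanSpace.single k 1 with he
  have he1 : ‖e‖ ≤ 1 := by simp [he]
  have hCs : φ.symm '' tsupport χ ⊆ K := by
    rintro _ ⟨z, hz, rfl⟩
    rw [hχS] at hz
    exact (hεO hz).2.1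
  set V : Set M := φ.source ∩ φ ⁻¹' Metric.ball (φ x₀) (ε / 4) with hV
  have hVx : V ∈ 𝓝 x₀ := (φ.isOpen_inter_preimage Metric.isOpen_ball).mem_nhds
    ⟨hxs, Metric.mem_ball_self (by positivity)⟩
  -- the parameters
  have t0 : Filter.Tendsto (fun j : ℕ => 1 / ((j : ℝ) + 1)) Filter.atTop (𝓝[>] 0) :=
    tendsto_nhdsWithin_iff.2 ⟨tendsto_one_div_add_atTop_nhds_zero_nat,
      Filter.Eventually.of_forall fun j => by
        change (0 : ℝ) < 1 / ((j : ℝ) + 1)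
        positivity⟩
  have small : ∀ b > (0 : ℝ), ∀ᶠ s : ℝ in 𝓝[>] 0, s < b ∧ s * L < b := by
    intro b hb
    have h1 : Filter.Tendsto (fun s : ℝ => s * L) (𝓝[>] 0) (𝓝 (0 * L)) :=
      Filter.Tendsto.mul_const (L : ℝ) nhdsWithin_le_nhds
    rw [zero_mul] at h1
    exact (Filter.Eventually.filter_mono nhdsWithin_le_nhds (gt_mem_nhds hb)).and
      (h1.eventually (gt_mem_nhds hb))
  obtain ⟨j₀, hj₀⟩ := Filter.eventually_atTop.1
    (t0.eventually (small (min 1 (ε / 4)) (by positivity)))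
  -- Starting the sequence at `j₀` makes the smallness conditions hold for every `j`.
  set s : ℕ → ℝ := fun j => 1 / (((j + j₀ : ℕ) : ℝ) + 1) with hs
  have ts : Filter.Tendsto s Filter.atTop (𝓝[>] 0) :=
    t0.comp (Filter.tendsto_add_atTop_nat j₀)
  have s0 : ∀ j, 0 < s j := fun j => by simp only [hs]; positivity
  have s1 : ∀ j, s j < min 1 (ε / 4) := fun j => (hj₀ (j + j₀) (Nat.le_add_left _ _)).1
  have s2 : ∀ j, s j * L < 1 := fun j =>
    (hj₀ (j + j₀) (Nat.le_add_left _ _)).2.trans_le (min_le_left _ _)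
  have hi : ∀ j, Function.Injective (shear (fun z => s j * χ z) e) := fun j =>
    injective_shear_const_mul hL (s0 j).le (s2 j) he1
  have hγS : ∀ j, ∀ z ∉ tsupport χ, s j * χ z = 0 := fun j z hz => by
    rw [image_eq_zero_of_notMem_tsupport hz, mul_zero]
  refine ⟨V, hVx, φ.symm '' tsupport χ, hCs,
    hχc.isCompact.image_of_continuousOn (φ.continuousOn_symm.mono hχt), fun F hF hFm =>
    ⟨fun j => shearSet φ (fun z => s j * χ z) e F, fun j => ?_, fun j x hx => ?_, fun j => ?_, ?_,
      fun δ hδ => ?_⟩⟩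
  · exact measurableSet_shearSet (continuous_const.mul hχ.continuous) (hi j) hFm
  · exact mem_shearSet_iff (hi j) (hγS j) hx
  · -- the sheared set stays below the graph
    set T : Set (Coord n) := Metric.closedBall (φ x₀) (ε / 4) ∩
      {z | z k + s j ≤ f fun i => z i.1} with hT
    have hTc : IsCompact T := by
      refine (isCompact_closedBall _ _).inter_right (isClosed_le ?_ ?_)
      · fun_prop
      · exact hf.continuous.comp (by fun_prop)
    have hTt : T ⊆ φ.target := fun z hz => (hεO (Metric.closedBall_subset_closedBall
      (by linarith) hz.1)).1
    have hTM : IsClosed (φ.symm '' T) :=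
      (hTc.image_of_continuousOn (φ.continuousOn_symm.mono hTt)).isClosed
    have inΩ : ∀ z ∈ Metric.closedBall (φ x₀) ε,
        (φ.symm z ∈ Ω ↔ z k < f fun i => z i.1) := by
      intro z hz
      have := hN _ (hεO hz).2.2
      rwa [φ.right_inv (hεO hz).1] at this
    -- A sheared point in `V` lies at height exactly `s j` below a point under the graph, hence in
    -- `T`. The image of `T` is closed, and it is contained in `Ω` since `s j > 0`.
    refine (closure_minimal ?_ hTM).trans ?_
    · rintro x ⟨hxF, hxs, hxV⟩
      have hxs' : φ x ∈ φ.target := φ.map_source hxs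
      rcases hxF with h | h
      · exact (h.2 hxs).elim
      obtain ⟨w, ⟨hwt, hwF⟩, hw⟩ := h.2
      refine ⟨φ x, ⟨Metric.ball_subset_closedBall hxV, ?_⟩, φ.left_inv hxs⟩
      have hdist : dist w (φ x) ≤ ε / 4 := by
        rw [← hw, dist_eq_norm, shear, sub_sub_cancel, norm_smul, norm_mul]
        have h1 : ‖χ w‖ ≤ 1 := by
          rw [Real.norm_of_nonneg χ.nonneg]; exact χ.le_one
        have h2 : ‖s j‖ ≤ ε / 4 := by
          rw [Real.norm_of_nonneg (s0 j).le]
          exact (s1 j).le.trans (min_le_right _ _)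
        calc _ ≤ ε / 4 * 1 * 1 := by gcongr
          _ = ε / 4 := by ring
      have hwb : dist w (φ x₀) ≤ ε / 2 := by
        have h3 : dist (φ x) (φ x₀) < ε / 4 := hxV
        calc _ ≤ dist w (φ x) + dist (φ x) (φ x₀) := dist_triangle _ _ _
          _ ≤ _ := by linarith
      have hχw : χ w = 1 := χ.one_of_mem_closedBall hwb
      have h4 := (inΩ w (Metric.mem_closedBall.2 (hwb.trans (by linarith)))).1 (hF hwF)
      have h5 : φ x = w - s j • e := by rw [← hw, shear, hχw, mul_one]
      simp only [mem_ofPred_eq, h5]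
      have h6 : ∀ i : {i : Fin n // i ≠ k}, (w - s j • e) i.1 = w i.1 := fun i => by
        simp [he, i.2]
      simp only [h6]
      have h7 : (w - s j • e) k + s j = w k := by simp [he]
      rw [h7]
      exact h4.le
    · rintro _ ⟨z, hz, rfl⟩
      rw [inΩ z (Metric.closedBall_subset_closedBall (by linarith) hz.1)]
      have : z k + s j ≤ f fun i => z i.1 := hz.2
      linarith [s0 j]
  · exact (tendsto_riemannianVolume_shearSet hφ hχ hχc hχt he1 hFm).comp ts
  · obtain ⟨r, hr, h⟩ := exists_perimeter_shearSet_le hφ hK hχc hχt hCs hδ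
    filter_upwards [ts.eventually (small r hr)] with j hj
    refine h _ e (Real.toNNReal (s j) * L) (contDiff_const.mul hχ) (hγS j) (fun z => ?_)
      (lipschitzWith_const_mul hL (s0 j).le) ?_ ?_ he1 F hFm
    · rw [abs_mul, abs_of_pos (s0 j), abs_of_nonneg χ.nonneg]
      exact (mul_le_of_le_one_right (s0 j).le χ.le_one).trans hj.1.le
    · rw [NNReal.coe_mul, Real.coe_toNNReal _ (s0 j).le]
      exact hj.2.le
    · rw [← NNReal.coe_lt_coe, NNReal.coe_mul, Real.coe_toNNReal _ (s0 j).le]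
      exact s2 j

end ManifoldShear

end WeakIMCF
end

noncomputable section

namespace WeakIMCF

/-! ### Almost every sub-level set of a Lipschitz function has finite perimeter -/

section EuclideanCoarea

variable {n : ℕ}

/-- A Lipschitz approximation of the indicator function of `{v < t}`. -/
def ramp (v : Coord n → ℝ) (t ε : ℝ) (z : Coord n) : ℝ := min 1 (max 0 ((t - v z) / ε))

lemma lipschitzWith_ramp {v : Coord n → ℝ} {L : ℝ≥0} (hv : LipschitzWith L v) (t : ℝ) {ε : ℝ}
    (hε : 0 < ε) : LipschitzWith (L / Real.toNNReal ε) (ramp v t ε) := by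
  refine LipschitzWith.const_min (LipschitzWith.const_max ?_ 0) 1
  refine LipschitzWith.of_dist_le_mul fun z w => ?_
  have := hv.dist_le_mul z w
  rw [Real.dist_eq] at this ⊢
  rw [← sub_div, sub_sub_sub_cancel_left, abs_div, abs_of_pos hε, abs_sub_comm, NNReal.coe_div,
    Real.coe_toNNReal _ hε.le, div_mul_eq_mul_div]
  gcongr

lemma ramp_mem_Icc (v : Coord n → ℝ) (t ε : ℝ) (z : Coord n) : ramp v t ε z ∈ Icc (0 : ℝ) 1 :=
  ⟨le_min zero_le_one (le_max_left _ _), min_le_left _ _⟩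

lemma ramp_eq_zero {v : Coord n → ℝ} {t ε : ℝ} (hε : 0 < ε) {z : Coord n} (h : t ≤ v z) :
    ramp v t ε z = 0 := by
  have : (t - v z) / ε ≤ 0 := div_nonpos_of_nonpos_of_nonneg (by linarith) hε.le
  rw [ramp, max_eq_left this, min_eq_right zero_le_one]

lemma ramp_eq_one {v : Coord n → ℝ} {t ε : ℝ} (hε : 0 < ε) {z : Coord n} (h : v z ≤ t - ε) :
    ramp v t ε z = 1 := by
  have : 1 ≤ (t - v z) / ε := by rw [le_div_iff₀ hε]; linarith
  rw [ramp, min_eq_left (this.trans (le_max_right _ _))]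

lemma lineDeriv_ramp_eq_zero {v : Coord n → ℝ} (hv : Continuous v) {t ε : ℝ} (hε : 0 < ε)
    {z : Coord n} (h : z ∉ {z | t - ε ≤ v z ∧ v z ≤ t}) (w : Coord n) :
    lineDeriv ℝ (ramp v t ε) z w = 0 := by
  have h' : v z < t - ε ∨ t < v z := by
    by_contra! h2
    exact h h2
  rcases h' with h' | h'
  · have : ramp v t ε =ᶠ[𝓝 z] fun _ => 1 := by
      filter_upwards [hv.continuousAt.eventually (gt_mem_nhds h')] with y hy
      exact ramp_eq_one hε hy.le
    rw [this.lineDeriv_eq]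
    simp [lineDeriv]
  · have : ramp v t ε =ᶠ[𝓝 z] fun _ => 0 := by
      filter_upwards [hv.continuousAt.eventually (lt_mem_nhds h')] with y hy
      exact ramp_eq_zero hε hy.le
    rw [this.lineDeriv_eq]
    simp [lineDeriv]

lemma lipschitzWith_coord {W : Coord n → Coord n} {D : ℝ≥0} (hW : LipschitzWith D W) (i : Fin n) :
    LipschitzWith D fun z => W z i := by
  refine LipschitzWith.of_dist_le_mul fun z w => ?_
  refine le_trans ?_ (hW.dist_le_mul z w)
  rw [Real.dist_eq, dist_eq_norm, ← PiLp.sub_apply, ← Real.norm_eq_abs]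
  exact PiLp.norm_apply_le _ _

/-- Integration by parts moves the derivatives to the ramp. They are at most `L / ε` and vanish off
the strip `t - ε ≤ v ≤ t`. -/
lemma integral_ramp_mul_ediv_le {v : Coord n → ℝ} {L : ℝ≥0} (hv : LipschitzWith L v) (t : ℝ)
    {ε : ℝ} (hε : 0 < ε) {V : Set (Coord n)} (hV : MeasurableSet V) (hVf : volume V ≠ ⊤)
    {W : Coord n → Coord n} (hW : ContDiff ℝ 1 W) (hWc : HasCompactSupport W)
    (hWV : tsupport W ⊆ V) {b : ℝ} (hb : ∀ z, ‖W z‖ ≤ b) :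
    ∫ z, ramp v t ε z * ediv W z
      ≤ n * (L / ε * b * volume.real (V ∩ {z | t - ε ≤ v z ∧ v z ≤ t})) := by
  have hb0 : 0 ≤ b := (norm_nonneg _).trans (hb 0)
  obtain ⟨D, hD⟩ := hW.lipschitzWith_of_hasCompactSupport hWc one_ne_zero
  have hWi : ∀ i, HasCompactSupport fun z => W z i := fun i =>
    hWc.comp_left (g := fun w : Coord n => w i) rfl
  have hr := lipschitzWith_ramp hv t hε
  have hdi : ∀ i : Fin n, ∀ z, lineDeriv ℝ (fun z => W z i) z (-EuclideanSpace.single i (1 : ℝ))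
      = -(fderiv ℝ W z (EuclideanSpace.single i (1 : ℝ))) i := by
    intro i z
    have h1 : HasFDerivAt (fun z => W z i)
        ((EuclideanSpace.proj i : Coord n →L[ℝ] ℝ).comp (fderiv ℝ W z)) z :=
      (EuclideanSpace.proj i : Coord n →L[ℝ] ℝ).hasFDerivAt.comp z
        (hW.differentiable one_ne_zero).differentiableAt.hasFDerivAt
    rw [(h1.hasLineDerivAt _).lineDeriv]
    simp
  have hcd : ∀ i : Fin n, Continuous fun z =>
      (fderiv ℝ W z (EuclideanSpace.single i (1 : ℝ))) i := fun i =>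
    (EuclideanSpace.proj i : Coord n →L[ℝ] ℝ).continuous.comp
      ((hW.continuous_fderiv one_ne_zero).clm_apply continuous_const)
  have hsum : ∫ z, ramp v t ε z * ediv W z = ∑ i : Fin n,
      ∫ z, ramp v t ε z * (fderiv ℝ W z (EuclideanSpace.single i (1 : ℝ))) i := by
    rw [← integral_finsetSum]
    · simp only [ediv, Finset.mul_sum]
    · intro i _
      refine (hr.continuous.mul (hcd i)).integrable_of_hasCompactSupport ?_
      refine HasCompactSupport.mul_left (HasCompactSupport.intro hWc fun z hz => ?_)
      rw [image_eq_zero_of_notMem_tsupport fun h => hz (tsupport_fderiv_subset ℝ h)]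
      simp
  have hm : MeasurableSet (V ∩ {z | t - ε ≤ v z ∧ v z ≤ t}) := by
    refine hV.inter (measurableSet_le measurable_const hv.continuous.measurable |>.inter
      (measurableSet_le hv.continuous.measurable measurable_const))
  have hbound : ∀ i : Fin n,
      ∫ z, ramp v t ε z * (fderiv ℝ W z (EuclideanSpace.single i (1 : ℝ))) i
        ≤ L / ε * b * volume.real (V ∩ {z | t - ε ≤ v z ∧ v z ≤ t}) := by
    intro i
    have h1 := LipschitzWith.integral_lineDeriv_mul_eq (μ := (volume : Measure (Coord n))) hr
      (lipschitzWith_coord hD i) (hWi i) (EuclideanSpace.single i (1 : ℝ))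
    simp only [hdi] at h1
    have h2 : ∫ z, ramp v t ε z * (fderiv ℝ W z (EuclideanSpace.single i (1 : ℝ))) i
        = -∫ z, lineDeriv ℝ (ramp v t ε) z (EuclideanSpace.single i (1 : ℝ)) * W z i := by
      rw [h1, ← integral_neg]
      congr 1
      funext z
      ring
    rw [h2]
    refine (neg_le_abs _).trans ?_
    have h3 : ∫ z, (V ∩ {z | t - ε ≤ v z ∧ v z ≤ t}).indicator (fun _ => (L / ε * b : ℝ)) z
        = L / ε * b * volume.real (V ∩ {z | t - ε ≤ v z ∧ v z ≤ t}) := by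
      rw [integral_indicator hm, setIntegral_const, smul_eq_mul, mul_comm]
    rw [← h3, ← Real.norm_eq_abs]
    refine norm_integral_le_of_norm_le ((integrable_indicator_iff hm).2 ?_)
      (Filter.Eventually.of_forall fun z => ?_)
    · exact integrableOn_const ((measure_mono inter_subset_left).trans_lt hVf.lt_top).ne
    · by_cases hz : z ∈ V ∩ {z | t - ε ≤ v z ∧ v z ≤ t}
      · rw [indicator_of_mem hz, norm_mul]
        have g1 := norm_lineDeriv_le_of_lipschitz ℝ hr (x₀ := z)
          (v := EuclideanSpace.single i (1 : ℝ))
        rw [NNReal.coe_div, Real.coe_toNNReal _ hε.le] at g1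
        simp only [PiLp.norm_single, norm_one, mul_one] at g1
        have g2 : ‖W z i‖ ≤ b := (PiLp.norm_apply_le _ _).trans (hb z)
        gcongr
      · rw [indicator_of_notMem hz]
        by_cases hzV : z ∈ V
        · rw [lineDeriv_ramp_eq_zero hv.continuous hε fun h => hz ⟨hzV, h⟩, zero_mul, norm_zero]
        · rw [image_eq_zero_of_notMem_tsupport fun h => hzV (hWV h)]
          simp
  rw [hsum]
  calc _ ≤ ∑ _i : Fin n, L / ε * b * volume.real (V ∩ {z | t - ε ≤ v z ∧ v z ≤ t}) :=
        Finset.sum_le_sum fun i _ => hbound i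
    _ = _ := by simp

/-- Almost every sub-level set of a Lipschitz function has finite perimeter in a set of finite
measure. -/
theorem ae_integral_ediv_le {v : Coord n → ℝ} {L : ℝ≥0} (hv : LipschitzWith L v)
    {V : Set (Coord n)} (hV : MeasurableSet V) (hVf : volume V ≠ ⊤) :
    ∀ᵐ t : ℝ, ∃ c : ℝ, ∀ (b : ℝ) (W : Coord n → Coord n), ContDiff ℝ 1 W → HasCompactSupport W →
      tsupport W ⊆ V → (∀ z, ‖W z‖ ≤ b) → ∫ z in {z | v z < t}, ediv W z ≤ b * c := by
  -- This replaces the coarea formula. The distribution function is monotone, hence differentiable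
  -- at almost every `t`, and there the volume of a strip of width `ε` below level `t` is `O(ε)`.
  set m : ℝ → ℝ := fun τ => volume.real (V ∩ {z | v z ≤ τ}) with hm
  have hfin : ∀ T : Set (Coord n), volume (V ∩ T) ≠ ⊤ := fun T =>
    ((measure_mono inter_subset_left).trans_lt hVf.lt_top).ne
  have hmono : Monotone m := fun a b hab => by
    refine measureReal_mono (inter_subset_inter_right _ fun z hz => ?_) (hfin _)
    exact le_trans hz hab
  filter_upwards [hmono.ae_differentiableAt] with t ht
  set e : ℕ → ℝ := fun j => 1 / ((j : ℝ) + 1) with he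
  have e0 : ∀ j, 0 < e j := fun j => by simp only [he]; positivity
  have et : Filter.Tendsto e Filter.atTop (𝓝 0) := tendsto_one_div_add_atTop_nhds_zero_nat
  have hslope : Filter.Tendsto (fun j => slope m t (t - 2 * e j)) Filter.atTop
      (𝓝 (deriv m t)) := by
    refine (hasDerivAt_iff_tendsto_slope.1 ht.hasDerivAt).comp (tendsto_nhdsWithin_iff.2 ⟨?_, ?_⟩)
    · have := (tendsto_const_nhds (x := t)).sub (et.const_mul 2)
      simpa using this
    · refine Filter.Eventually.of_forall fun j => ?_
      have := e0 j
      simp only [mem_compl_iff, mem_singleton_iff]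
      intro h
      linarith
  -- The strip contains its lower level, so it need not be disjoint from `v ≤ t - e j`; doubling the
  -- width separates the two sets.
  have hdiff : ∀ j, volume.real (V ∩ {z | t - e j ≤ v z ∧ v z ≤ t})
      ≤ 2 * e j * slope m t (t - 2 * e j) := by
    intro j
    have h0 := e0 j
    have h1 : volume.real (V ∩ {z | t - e j ≤ v z ∧ v z ≤ t}) + m (t - 2 * e j) ≤ m t := by
      rw [hm]
      simp only
      rw [← measureReal_union ?_ (hV.inter (measurableSet_le hv.continuous.measurable
        measurable_const)) (hfin _) (hfin _)]
      · refine measureReal_mono ?_ (hfin _)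
        rintro z (⟨h2, h3⟩ | ⟨h2, h3⟩)
        · exact ⟨h2, h3.2⟩
        · refine ⟨h2, ?_⟩
          simp only [mem_ofPred_eq] at h3 ⊢
          linarith
      · refine disjoint_left.2 fun z hz hz' => ?_
        have h3 := hz.2.1
        have h4 : v z ≤ t - 2 * e j := hz'.2
        linarith
    rw [slope_def_field]
    have : (m (t - 2 * e j) - m t) / (t - 2 * e j - t) = (m t - m (t - 2 * e j)) / (2 * e j) := by
      rw [← neg_sub, sub_sub_cancel_left, neg_div_neg_eq]
    rw [this, mul_div_cancel₀ _ (by positivity)]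
    linarith
  refine ⟨2 * n * L * deriv m t, fun b W hW hWc hWV hb => ?_⟩
  have hb0 : 0 ≤ b := (norm_nonneg _).trans (hb 0)
  have hlim1 : Filter.Tendsto (fun j => ∫ z, ramp v t (e j) z * ediv W z) Filter.atTop
      (𝓝 (∫ z in {z | v z < t}, ediv W z)) := by
    have hms : MeasurableSet {z | v z < t} :=
      measurableSet_lt hv.continuous.measurable measurable_const
    rw [← integral_indicator hms]
    refine tendsto_integral_of_dominated_convergence (fun z => |ediv W z|) (fun j => ?_)
      (integrable_ediv hW hWc).abs (fun j => Filter.Eventually.of_forall fun z => ?_)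
      (Filter.Eventually.of_forall fun z => ?_)
    · exact ((lipschitzWith_ramp hv t (e0 j)).continuous.mul
        (continuous_ediv hW)).aestronglyMeasurable
    · obtain ⟨h1, h2⟩ := ramp_mem_Icc v t (e j) z
      rw [norm_mul, Real.norm_of_nonneg h1, Real.norm_eq_abs]
      exact mul_le_of_le_one_left (abs_nonneg _) h2
    · by_cases hz : v z < t
      · rw [indicator_of_mem (by exact hz)]
        refine tendsto_const_nhds.congr' ?_
        filter_upwards [et.eventually (gt_mem_nhds (sub_pos.2 hz))] with j hj
        rw [ramp_eq_one (e0 j) (by linarith), one_mul]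
      · rw [indicator_of_notMem (by exact hz)]
        refine tendsto_const_nhds.congr fun j => ?_
        rw [ramp_eq_zero (e0 j) (not_lt.1 hz), zero_mul]
  have hlim2 : Filter.Tendsto (fun j => 2 * n * L * b * slope m t (t - 2 * e j)) Filter.atTop
      (𝓝 (2 * n * L * b * deriv m t)) := hslope.const_mul _
  have hle := le_of_tendsto_of_tendsto' hlim1 hlim2 fun j => by
    refine (integral_ramp_mul_ediv_le hv t (e0 j) hV hVf hW hWc hWV hb).trans ?_
    have h0 := e0 j
    calc _ ≤ n * (L / e j * b * (2 * e j * slope m t (t - 2 * e j))) := by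
          gcongr
          exact hdiff j
      _ = _ := by field_simp
  calc _ ≤ 2 * n * L * b * deriv m t := hle
    _ = _ := by ring

end EuclideanCoarea

end WeakIMCF
end

noncomputable section

namespace WeakIMCF

/-! ### Locally Lipschitz functions on a Riemannian manifold -/

section LocallyLipschitz

variable {n : ℕ} {M : Type*} [EMetricSpace M] [ChartedSpace (Coord n) M]
  [RiemannianBundle (fun x : M => TangentSpace (𝓡 n) x)] [IsManifold (𝓡 n) ∞ M]
  [IsContMDiffRiemannianBundle (𝓡 n) ∞ (Coord n) (fun x : M => TangentSpace (𝓡 n) x)]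

lemma exists_norm_frame_le {φ : OpenPartialHomeomorph M (Coord n)}
    (hφ : φ ∈ IsManifold.maximalAtlas (𝓡 n) ∞ M) {C : Set (Coord n)} (hC : IsCompact C)
    (hCt : C ⊆ φ.target) : ∃ B : ℝ≥0, ∀ z ∈ C, ∀ w, ‖frame φ z w‖ ≤ B * ‖w‖ := by
  obtain ⟨B₁, hB₁⟩ := (hC.prod (isCompact_closedBall (0 : Coord n) 1)).exists_bound_of_continuousOn
    ((continuousOn_chartNorm hφ).mono (prod_mono hCt (subset_univ _)))
  obtain ⟨B₂, hB₂⟩ := hC.exists_bound_of_continuousOn ((contDiffOn_densIn hφ).continuousOn.mono hCt)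
  refine ⟨Real.toNNReal B₂ * Real.toNNReal B₁, fun z hz w => ?_⟩
  have hd := densIn_pos hφ (hCt hz)
  have h1 : ‖frame φ z w‖ = densIn φ z * chartNorm φ z w := by
    rw [← congrArg (· * chartNorm φ z w) (abs_of_pos hd), ← chartNorm_smul, chartNorm,
      inv_smul_smul₀ hd.ne']
  have h2 : chartNorm φ z w ≤ B₁ * ‖w‖ := by
    by_cases hw : w = 0
    · simp [hw, chartNorm]
    have hw' : 0 < ‖w‖ := norm_pos_iff.2 hw
    have h3 := (le_abs_self _).trans (hB₁ (z, ‖w‖⁻¹ • w) ⟨hz, by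
      rw [mem_closedBall_zero_iff, norm_smul, norm_inv, norm_norm, inv_mul_cancel₀ hw'.ne']⟩)
    simp only at h3
    rw [chartNorm_smul, abs_of_pos (inv_pos.2 hw'), inv_mul_le_iff₀ hw'] at h3
    linarith
  have h4 : densIn φ z ≤ B₂ := (le_abs_self _).trans (hB₂ z hz)
  rw [h1, NNReal.coe_mul]
  calc _ ≤ B₂ * (B₁ * ‖w‖) := mul_le_mul h4 h2 (chartNorm_nonneg _ _ _) (hd.le.trans h4)
    _ ≤ Real.toNNReal B₂ * (Real.toNNReal B₁ * ‖w‖) := by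
      gcongr
      · exact (chartNorm_nonneg φ z w).trans h2
      · exact Real.le_coe_toNNReal _
      · exact Real.le_coe_toNNReal _
    _ = _ := by ring

/-- The inverse of a chart is locally Lipschitz. -/
lemma exists_edist_symm_le [IsRiemannianManifold (𝓡 n) M] (x : M) :
    ∃ (C : ℝ≥0) (r : ℝ), 0 < r ∧ Metric.ball (chartAt (Coord n) x x) r ⊆
        (chartAt (Coord n) x).target ∧
      ∀ a ∈ Metric.ball (chartAt (Coord n) x x) r, ∀ b ∈ Metric.ball (chartAt (Coord n) x x) r,
        edist ((chartAt (Coord n) x).symm a) ((chartAt (Coord n) x).symm b) ≤ C * edist a b := by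
  set φ := chartAt (Coord n) x with hφ
  have hφm : φ ∈ IsManifold.maximalAtlas (𝓡 n) ∞ M := IsManifold.chart_mem_maximalAtlas x
  obtain ⟨r, hr, hrt⟩ := Metric.nhds_basis_closedBall.mem_iff.1
    (φ.open_target.mem_nhds (φ.map_source (mem_chart_source _ x)))
  obtain ⟨C, hC⟩ := exists_norm_frame_le hφm (isCompact_closedBall (φ x) r) hrt
  have hbt : Metric.ball (φ x) r ⊆ φ.target := Metric.ball_subset_closedBall.trans hrt
  refine ⟨C, r, hr, hbt, fun a ha b hb => ?_⟩
  let η := ContinuousAffineMap.lineMap (R := ℝ) a b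
  set γ := φ.symm ∘ η with hγ
  have hη : MapsTo η (Icc 0 1) (Metric.ball (φ x) r) := by
    rw [mapsTo_iff_image_subset]
    simp only [ContinuousAffineMap.coe_lineMap_eq, ← segment_eq_image_lineMap, η]
    exact (convex_ball _ _).segment_subset ha hb
  have η_smooth : ContMDiffOn 𝓘(ℝ, ℝ) 𝓘(ℝ, Coord n) 1 η (Icc 0 1) := by
    apply ContMDiff.contMDiffOn
    rw [contMDiff_iff_contDiff]
    exact ContinuousAffineMap.contDiff _
  have hsymm := (contMDiffOn_symm_of_mem_maximalAtlas hφm).of_le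
    (show (1 : WithTop ℕ∞) ≤ ((⊤ : ℕ∞) : WithTop ℕ∞) from by exact mod_cast le_top)
  -- The distance is bounded by the length of the image of the segment from `a` to `b`, on which
  -- `frame φ` has norm at most `C`.
  have h1 : riemannianEDist (𝓡 n) (φ.symm a) (φ.symm b) ≤ pathELength (𝓡 n) γ 0 1 := by
    apply riemannianEDist_le_pathELength _ _ _ zero_le_one
    · exact hsymm.comp η_smooth fun t ht => hbt (hη ht)
    · simp [γ, η, ContinuousAffineMap.coe_lineMap_eq]
    · simp [γ, η, ContinuousAffineMap.coe_lineMap_eq]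
  rw [IsRiemannianManifold.out (I := 𝓡 n) (φ.symm a) (φ.symm b)]
  refine h1.trans ?_
  rw [← lintegral_fderiv_lineMap_eq_edist, pathELength_eq_lintegral_mfderivWithin_Icc,
    ← lintegral_const_mul' _ _ ENNReal.coe_ne_top]
  refine setLIntegral_mono' measurableSet_Icc fun t ht => ?_
  have hηt : η t ∈ φ.target := hbt (hη ht)
  have h2 : mfderivWithin 𝓘(ℝ, ℝ) (𝓡 n) γ (Icc 0 1) t = (mfderiv 𝓘(ℝ, Coord n) (𝓡 n) φ.symm (η t)) ∘L
      (mfderivWithin 𝓘(ℝ, ℝ) 𝓘(ℝ, Coord n) η (Icc 0 1) t) := by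
    refine mfderiv_comp_mfderivWithin t ?_ (η_smooth.mdifferentiableOn one_ne_zero t ht) ?_
    · exact (hsymm.mdifferentiableOn one_ne_zero).mdifferentiableAt (φ.open_target.mem_nhds hηt)
    · rw [uniqueMDiffWithinAt_iff_uniqueDiffWithinAt]
      exact uniqueDiffOn_Icc zero_lt_one t ht
  have h3 : mfderivWithin 𝓘(ℝ, ℝ) (𝓡 n) γ (Icc 0 1) t 1
      = frame φ (η t) (fderivWithin ℝ η (Icc 0 1) t 1) := by
    rw [h2, mfderivWithin_eq_fderivWithin]
    rfl
  rw [h3]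
  have h4 := hC (η t) (Metric.ball_subset_closedBall (hη ht)) (fderivWithin ℝ η (Icc 0 1) t 1)
  rw [← ofReal_norm, ← ofReal_norm, ← ENNReal.ofReal_coe_nnreal,
    ← ENNReal.ofReal_mul (NNReal.coe_nonneg C)]
  exact ENNReal.ofReal_le_ofReal h4

lemma LipLoc.continuousOn [LocallyCompactSpace M] {Ω : Set M} (hΩ : IsOpen Ω) {u : M → ℝ} (hu : LipLoc Ω u) :
    ContinuousOn u Ω := by
  intro x hx
  obtain ⟨K, hK, hKΩ, hKc⟩ := local_compact_nhds (hΩ.mem_nhds hx)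
  obtain ⟨C, hC⟩ := hu K hKΩ hKc
  exact (hC.continuousOn.continuousAt hK).continuousWithinAt

lemma isOpen_subLevel [LocallyCompactSpace M] {Ω : Set M} (hΩ : IsOpen Ω) {u : M → ℝ} (hu : LipLoc Ω u) (t : ℝ) :
    IsOpen (subLevel Ω u t) :=
  (hu.continuousOn hΩ).isOpen_inter_preimage hΩ isOpen_Iio

lemma exists_lipschitzOnWith_comp_symm [IsRiemannianManifold (𝓡 n) M] {Ω : Set M}
    (hΩ : IsOpen Ω) {u : M → ℝ} (hu : LipLoc Ω u) {x : M} (hx : x ∈ Ω) :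
    ∃ (L : ℝ≥0) (r : ℝ), 0 < r ∧ Metric.closedBall (chartAt (Coord n) x x) r ⊆
        (chartAt (Coord n) x).target ∩ (chartAt (Coord n) x).symm ⁻¹' Ω ∧
      LipschitzOnWith L (u ∘ (chartAt (Coord n) x).symm)
        (Metric.closedBall (chartAt (Coord n) x x) r) := by
  have : LocallyCompactSpace M := ChartedSpace.locallyCompactSpace (Coord n) M
  set φ := chartAt (Coord n) x with hφ
  have hxs : x ∈ φ.source := mem_chart_source _ x
  obtain ⟨K, hK, hKΩ, hKc⟩ := local_compact_nhds (hΩ.mem_nhds hx)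
  obtain ⟨C, hC⟩ := hu K hKΩ hKc
  obtain ⟨D, r₁, hr₁, hr₁t, hD⟩ := exists_edist_symm_le (n := n) x
  have h1 : φ.target ∩ φ.symm ⁻¹' interior K ∈ 𝓝 (φ x) := by
    refine (φ.symm.isOpen_inter_preimage isOpen_interior).mem_nhds ⟨φ.map_source hxs, ?_⟩
    rw [mem_preimage, φ.left_inv hxs]
    exact mem_interior_iff_mem_nhds.2 hK
  obtain ⟨r, hr, hrK⟩ := Metric.nhds_basis_closedBall.mem_iff.1
    (Filter.inter_mem h1 (Metric.ball_mem_nhds (φ x) hr₁))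
  refine ⟨C * D, r, hr, fun z hz => ⟨(hrK hz).1.1, hKΩ (interior_subset (hrK hz).1.2)⟩, ?_⟩
  intro a ha b hb
  refine (hC (interior_subset (hrK ha).1.2) (interior_subset (hrK hb).1.2)).trans ?_
  rw [ENNReal.coe_mul, mul_assoc]
  gcongr
  exact hD a (hrK ha).2 b (hrK hb).2

variable [MeasurableSpace M] [BorelSpace M] [SecondCountableTopology M]

/-- The gradient of a locally Lipschitz function is locally bounded. -/
lemma eventually_gradNorm_le [IsRiemannianManifold (𝓡 n) M] {Ω : Set M}
    (hΩ : IsOpen Ω) {u : M → ℝ} (hu : LipLoc Ω u) {x : M} (hx : x ∈ Ω) :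
    ∃ C : ℝ≥0, ∀ᶠ y in 𝓝 x, gradNorm n u y ≤ C := by
  obtain ⟨L, r, hr, hrt, hL⟩ := exists_lipschitzOnWith_comp_symm (n := n) hΩ hu hx
  set φ := chartAt (Coord n) x with hφ
  have hφm : φ ∈ IsManifold.maximalAtlas (𝓡 n) ∞ M := IsManifold.chart_mem_maximalAtlas x
  have hxs : x ∈ φ.source := mem_chart_source _ x
  have hcb := isCompact_closedBall (φ x) r
  have hbt : Metric.closedBall (φ x) r ⊆ φ.target := hrt.trans inter_subset_left
  obtain ⟨c, hc, hcb'⟩ := exists_le_chartNorm hφm hcb hbt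
  obtain ⟨z₀, hz₀, hmin⟩ := hcb.exists_isMinOn ⟨φ x, Metric.mem_closedBall_self hr.le⟩
    ((contDiffOn_densIn hφm).continuousOn.mono hbt)
  have hd0 := densIn_pos hφm (hbt hz₀)
  set d := densIn φ z₀ with hd
  refine ⟨L * Real.toNNReal ((c * d)⁻¹), ?_⟩
  have hnear : φ.source ∩ φ ⁻¹' Metric.ball (φ x) r ∈ 𝓝 x :=
    (φ.isOpen_inter_preimage Metric.isOpen_ball).mem_nhds ⟨hxs, Metric.mem_ball_self hr⟩
  filter_upwards [hnear] with y hy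
  obtain ⟨z, hz, rfl⟩ : ∃ z ∈ Metric.ball (φ x) r, φ.symm z = y := ⟨φ y, hy.2, φ.left_inv hy.1⟩
  have hzc := Metric.ball_subset_closedBall hz
  have hzt := hbt hzc
  have hco : ∀ v : TangentSpace (𝓡 n) (φ.symm z), ‖coframe φ (φ.symm z) v‖ ≤ (c * d)⁻¹ * ‖v‖ := by
    intro v
    have h1 := hcb' z hzc (densIn φ z • coframe φ (φ.symm z) v)
    have hdz := densIn_pos hφm hzt
    have h2 : chartNorm φ z (densIn φ z • coframe φ (φ.symm z) v) = ‖v‖ := by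
      rw [chartNorm, inv_smul_smul₀ hdz.ne', frame_coframe hφm hzt]
    rw [h2, norm_smul, Real.norm_of_nonneg hdz.le] at h1
    rw [inv_mul_eq_div, le_div_iff₀ (by positivity)]
    refine le_trans ?_ h1
    have h3 : d ≤ densIn φ z := hmin hzc
    calc ‖coframe φ (φ.symm z) v‖ * (c * d) = c * (d * ‖coframe φ (φ.symm z) v‖) := by ring
      _ ≤ _ := by gcongr
  have key : ‖mfderiv (𝓡 n) 𝓘(ℝ, ℝ) u (φ.symm z)‖ ≤ L * (c * d)⁻¹ := by
    refine ContinuousLinearMap.opNorm_le_bound _ (by positivity) fun v => ?_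
    -- Where `u` is not differentiable, `mfderiv` has the default value `0`, so the bound holds at
    -- every point.
    by_cases hu' : MDifferentiableAt (𝓡 n) 𝓘(ℝ, ℝ) u (φ.symm z)
    · have hsym : MDifferentiableAt 𝓘(ℝ, Coord n) (𝓡 n) φ.symm z :=
        ((contMDiffOn_symm_of_mem_maximalAtlas hφm).mdifferentiableOn (by simp)).mdifferentiableAt
          (φ.open_target.mem_nhds hzt)
      have h1 := hu'.hasMFDerivAt.comp z hsym.hasMFDerivAt
      have h2 : ∀ w : Coord n, fderiv ℝ (u ∘ φ.symm) z w
          = mfderiv (𝓡 n) 𝓘(ℝ, ℝ) u (φ.symm z) (frame φ z w) := fun w => by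
        have := h1.mfderiv
        rw [mfderiv_eq_fderiv] at this
        rw [this]
        rfl
      have h3 : ‖fderiv ℝ (u ∘ φ.symm) z‖ ≤ L :=
        norm_fderiv_le_of_lipschitzOn ℝ (Metric.closedBall_mem_nhds_of_mem hz) hL
      have h5 := h2 (coframe φ (φ.symm z) v)
      have h6 := congrArg (mfderiv (𝓡 n) 𝓘(ℝ, ℝ) u (φ.symm z)) (frame_coframe hφm hzt v)
      have h7 : ‖fderiv ℝ (u ∘ φ.symm) z (coframe φ (φ.symm z) v)‖ ≤ L * (c * d)⁻¹ * ‖v‖ := by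
        calc _ ≤ L * ((c * d)⁻¹ * ‖v‖) := (ContinuousLinearMap.le_opNorm _ _).trans
              (mul_le_mul h3 (hco v) (norm_nonneg _) L.2)
          _ = _ := by ring
      refine (norm_tangentSpace_vectorSpace (F := ℝ)).trans_le ?_
      exact (congrArg (fun q : ℝ => ‖q‖) (h5.trans h6).symm).trans_le h7
    · rw [mfderiv_zero_of_not_mdifferentiableAt hu']
      simp
      positivity
  unfold gradNorm
  rw [← ofReal_norm]
  refine (ENNReal.ofReal_le_ofReal key).trans ?_
  rw [ENNReal.ofReal_mul (NNReal.coe_nonneg L), ENNReal.coe_mul, ENNReal.ofReal_coe_nnreal]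
  rfl

/-- Almost every sub-level set of a function, which is Lipschitz in a chart, has locally finite
perimeter. -/
lemma ae_perimeter_lt_top {φ : OpenPartialHomeomorph M (Coord n)}
    (hφ : φ ∈ IsManifold.maximalAtlas (𝓡 n) ∞ M) {V C : Set (Coord n)} (hV : IsOpen V)
    (hC : IsCompact C) (hVC : V ⊆ C) (hCt : C ⊆ φ.target) {v : Coord n → ℝ} {L : ℝ≥0}
    (hv : LipschitzWith L v) :
    ∀ᵐ t : ℝ, ∀ A : Set M, MeasurableSet A → (∀ z ∈ V, (φ.symm z ∈ A ↔ v z < t)) →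
      perimeter n A (φ.source ∩ φ ⁻¹' V) < ⊤ := by
  obtain ⟨c, hc, hcb⟩ := exists_le_chartNorm hφ hC hCt
  filter_upwards [ae_integral_ediv_le hv hV.measurableSet
    ((measure_mono hVC).trans_lt hC.measure_lt_top).ne] with t ht A hA hAv
  obtain ⟨B, hB⟩ := ht
  -- The weighted components of a test field have Euclidean norm at most `c⁻¹` on `C`.
  refine (perimeter_le (R := ENNReal.ofReal (c⁻¹ * B)) fun X hX => ?_).trans_lt
    ENNReal.ofReal_lt_top
  obtain ⟨D, hDV, hD, hD0⟩ := hX.2.1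
  obtain ⟨W, hW, hWc, hWD, hWt, rfl⟩ := exists_eq_fieldOf hφ hX.1 hD
    (hDV.trans inter_subset_left) hD0
  have hWV : tsupport W ⊆ V := by
    refine hWD.trans ?_
    rintro _ ⟨x, hx, rfl⟩
    exact (hDV hx).2
  refine ENNReal.ofReal_le_ofReal ?_
  unfold divInt
  rw [setIntegral_divergence_fieldOf hφ hW hWc hWt hA]
  have hms : MeasurableSet {z | v z < t} :=
    measurableSet_lt hv.continuous.measurable measurable_const
  have : ∫ z in φ.target ∩ φ.symm ⁻¹' A, ediv W z = ∫ z in {z | v z < t}, ediv W z := by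
    rw [← integral_indicator hms, ← integral_indicator (measurableSet_target_inter φ hA)]
    congr 1
    funext z
    by_cases hz : z ∈ tsupport W
    · have h1 : z ∈ φ.target ∩ φ.symm ⁻¹' A ↔ z ∈ {z | v z < t} :=
        ⟨fun h => (hAv z (hWV hz)).1 h.2, fun h => ⟨hWt hz, (hAv z (hWV hz)).2 h⟩⟩
      by_cases h2 : z ∈ {z | v z < t}
      · rw [indicator_of_mem h2, indicator_of_mem (h1.2 h2)]
      · rw [indicator_of_notMem h2, indicator_of_notMem (fun h => h2 (h1.1 h))]
    · simp [indicator, ediv_eq_zero_of_notMem_tsupport hz]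
  rw [this]
  refine hB _ W hW hWc hWV fun z => ?_
  by_cases hz : z ∈ tsupport W
  · rw [← mul_one c⁻¹, le_inv_mul_iff₀ hc]
    refine (hcb z (hVC (hWV hz)) _).trans ?_
    rw [← norm_fieldOf_symm hφ (hWt hz)]
    exact hX.2.2 _
  · rw [image_eq_zero_of_notMem_tsupport hz, norm_zero]
    positivity

variable (n) in
/-- Every point has small neighborhoods of finite perimeter. -/
lemma exists_perimeter_lt_top (x : M) {U : Set M} (hU : U ∈ 𝓝 x) :
    ∃ B : Set M, IsOpen B ∧ x ∈ B ∧ IsCompact (closure B) ∧ closure B ⊆ U ∧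
      perimeter n B univ < ⊤ := by
  set φ := chartAt (Coord n) x with hφ
  have hφm : φ ∈ IsManifold.maximalAtlas (𝓡 n) ∞ M := IsManifold.chart_mem_maximalAtlas x
  have hxs : x ∈ φ.source := mem_chart_source _ x
  have h1 : φ.target ∩ φ.symm ⁻¹' interior U ∈ 𝓝 (φ x) := by
    refine (φ.symm.isOpen_inter_preimage isOpen_interior).mem_nhds ⟨φ.map_source hxs, ?_⟩
    rw [mem_preimage, φ.left_inv hxs]
    exact mem_interior_iff_mem_nhds.2 hU
  obtain ⟨R, hR, hRU⟩ := Metric.nhds_basis_closedBall.mem_iff.1 h1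
  -- Coordinate balls are sub-level sets of a distance function, which is Lipschitz, so almost every
  -- radius is admissible.
  have hae := ae_perimeter_lt_top (V := Metric.ball (φ x) R) hφm Metric.isOpen_ball
    (isCompact_closedBall (φ x) R) Metric.ball_subset_closedBall (hRU.trans inter_subset_left)
    (LipschitzWith.dist_left (φ x))
  obtain ⟨r, hr, hrR⟩ : ∃ r, (∀ A : Set M, MeasurableSet A →
      (∀ z ∈ Metric.ball (φ x) R, (φ.symm z ∈ A ↔ dist z (φ x) < r)) →
      perimeter n A (φ.source ∩ φ ⁻¹' Metric.ball (φ x) R) < ⊤) ∧ r ∈ Ioo 0 R := by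
    have h2 : ∃ᵐ r : ℝ, r ∈ Ioo 0 R := by
      rw [frequently_ae_mem_iff, Real.volume_Ioo]
      simpa using hR
    exact (h2.and_eventually hae).exists.imp fun r h => ⟨h.2, h.1⟩
  have hrt : Metric.closedBall (φ x) r ⊆ φ.target :=
    (Metric.closedBall_subset_closedBall hrR.2.le).trans (hRU.trans inter_subset_left)
  have hC : IsCompact (φ.symm '' Metric.closedBall (φ x) r) :=
    (isCompact_closedBall _ _).image_of_continuousOn (φ.continuousOn_symm.mono hrt)
  have hBo : IsOpen (φ.source ∩ φ ⁻¹' Metric.ball (φ x) r) :=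
    φ.isOpen_inter_preimage Metric.isOpen_ball
  have hBC : φ.source ∩ φ ⁻¹' Metric.ball (φ x) r ⊆ φ.symm '' Metric.closedBall (φ x) r :=
    fun y hy => ⟨φ y, Metric.ball_subset_closedBall hy.2, φ.left_inv hy.1⟩
  have hcl := closure_minimal hBC hC.isClosed
  refine ⟨φ.source ∩ φ ⁻¹' Metric.ball (φ x) r, hBo, ⟨hxs, Metric.mem_ball_self hrR.1⟩,
    hC.of_isClosed_subset isClosed_closure hcl, hcl.trans ?_, ?_⟩
  · rintro _ ⟨z, hz, rfl⟩
    exact interior_subset (hRU (Metric.closedBall_subset_closedBall hrR.2.le hz)).2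
  · refine (perimeter_le_of_compact hBo.measurableSet hC
      (φ.isOpen_inter_preimage (Metric.isOpen_ball (x := φ x) (ε := R))) hBC ?_).trans_lt
      (hr _ hBo.measurableSet fun z hz => ?_)
    · rintro _ ⟨z, hz, rfl⟩
      refine ⟨φ.map_target (hrt hz), ?_⟩
      rw [mem_preimage, φ.right_inv (hrt hz)]
      exact Metric.closedBall_subset_ball hrR.2 hz
    · have hzt : z ∈ φ.target := (hRU (Metric.ball_subset_closedBall hz)).1
      simp [φ.map_target hzt, φ.right_inv hzt]

/-- Almost every sub-level set of a locally Lipschitz function has locally finite perimeter. -/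
lemma exists_ae_perimeter_subLevel_lt_top [IsRiemannianManifold (𝓡 n) M] {Ω : Set M}
    (hΩ : IsOpen Ω) {u : M → ℝ} (hu : LipLoc Ω u) {x : M} (hx : x ∈ Ω) :
    ∃ N, IsOpen N ∧ x ∈ N ∧ N ⊆ Ω ∧ ∀ᵐ t : ℝ, perimeter n (subLevel Ω u t) N < ⊤ := by
  have : LocallyCompactSpace M := ChartedSpace.locallyCompactSpace (Coord n) M
  obtain ⟨L, r, hr, hrt, hL⟩ := exists_lipschitzOnWith_comp_symm (n := n) hΩ hu hx
  set φ := chartAt (Coord n) x with hφ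
  have hφm : φ ∈ IsManifold.maximalAtlas (𝓡 n) ∞ M := IsManifold.chart_mem_maximalAtlas x
  have hxs : x ∈ φ.source := mem_chart_source _ x
  -- `ae_perimeter_lt_top` asks for a function which is Lipschitz on the whole coordinate space.
  obtain ⟨v, hv, hvu⟩ := hL.extend_real
  refine ⟨φ.source ∩ φ ⁻¹' Metric.ball (φ x) r, φ.isOpen_inter_preimage Metric.isOpen_ball,
    ⟨hxs, Metric.mem_ball_self hr⟩, fun y hy => ?_, ?_⟩
  · have := (hrt (Metric.ball_subset_closedBall hy.2)).2
    rwa [mem_preimage, φ.left_inv hy.1] at this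
  · filter_upwards [ae_perimeter_lt_top (V := Metric.ball (φ x) r) hφm Metric.isOpen_ball
      (isCompact_closedBall (φ x) r) Metric.ball_subset_closedBall (hrt.trans inter_subset_left)
      hv] with t ht
    refine ht _ (isOpen_subLevel hΩ hu t).measurableSet fun z hz => ?_
    have hz' := Metric.ball_subset_closedBall hz
    rw [← hvu hz']
    exact ⟨fun h => h.2, fun h => ⟨(hrt hz').2, h⟩⟩

end LocallyLipschitz

end WeakIMCF
end

noncomputable section

namespace WeakIMCF

/-! ### Extended arithmetic and exhaustion by domains -/

/-- Turns an inequality of energies into one without subtraction. The perimeters `a`, `c` may be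
infinite: `a = ⊤` forces `c = ⊤`. -/
lemma add_le_add_of_coe_sub_le {a b c d : ℝ≥0∞} (hb : b ≠ ⊤) (hd : d ≠ ⊤)
    (h : (a : EReal) - b ≤ c - d) : a + d ≤ c + b := by
  lift b to ℝ≥0 using hb
  lift d to ℝ≥0 using hd
  rcases eq_or_ne c ⊤ with rfl | hc
  · simp
  lift c to ℝ≥0 using hc
  rcases eq_or_ne a ⊤ with rfl | ha
  · exfalso
    simp only [EReal.coe_ennreal_top, EReal.coe_nnreal_eq_coe_real, EReal.top_sub_coe,
      ← EReal.coe_sub] at h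
    exact EReal.coe_ne_top _ (top_le_iff.1 h)
  lift a to ℝ≥0 using ha
  simp only [EReal.coe_nnreal_eq_coe_real, ← EReal.coe_sub, EReal.coe_le_coe_iff] at h
  norm_cast
  rw [← NNReal.coe_le_coe]
  push_cast
  linarith

lemma coe_sub_le_of_add_le {a b c i : ℝ≥0∞} (hb : b ≠ ⊤) (hc : c ≠ ⊤) (h : a + i ≤ c) :
    (a : EReal) - b ≤ c - (b + i : ℝ≥0∞) := by
  have ha : a ≠ ⊤ := fun h' => by simp [h', hc] at h
  have hi : i ≠ ⊤ := fun h' => by simp [h', hc] at h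
  lift a to ℝ≥0 using ha
  lift b to ℝ≥0 using hb
  lift c to ℝ≥0 using hc
  lift i to ℝ≥0 using hi
  norm_cast at h
  rw [← NNReal.coe_le_coe] at h
  push_cast at h
  simp only [← ENNReal.coe_add, EReal.coe_nnreal_eq_coe_real, ← EReal.coe_sub,
    EReal.coe_le_coe_iff, NNReal.coe_add]
  linarith

/-- A compact subset of a domain is contained in a compactly contained subdomain. -/
lemma exists_isDomainSet_subset {X : Type*} [TopologicalSpace X] [T2Space X]
    [LocallyCompactSpace X] [LocallyConnectedSpace X] {Ω C : Set X} (hΩ : IsDomainSet Ω)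
    (hC : IsCompact C) (hCΩ : C ⊆ Ω) :
    ∃ K, IsDomainSet K ∧ C ⊆ K ∧ CompactlyContained K Ω := by
  obtain ⟨hΩo, ⟨x₀, hx₀⟩, hΩc⟩ := hΩ
  have hloc : ∀ x ∈ Ω, ∃ D, IsDomainSet D ∧ x ∈ D ∧ CompactlyContained D Ω := by
    intro x hx
    obtain ⟨N, hN, hNΩ, hNc⟩ := local_compact_nhds (hΩo.mem_nhds hx)
    obtain ⟨D, hDN, hDo, hxD, hDc⟩ := locallyConnectedSpace_iff_subsets_isOpen_isConnected.1
      inferInstance x N hN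
    have hcl : closure D ⊆ N := closure_minimal hDN hNc.isClosed
    exact ⟨D, ⟨hDo, hDc⟩, hxD, hNc.of_isClosed_subset isClosed_closure hcl, hcl.trans hNΩ⟩
  have hunion : ∀ D D' : Set X, IsDomainSet D → CompactlyContained D Ω → IsDomainSet D' →
      CompactlyContained D' Ω → (D ∩ D').Nonempty →
      IsDomainSet (D ∪ D') ∧ CompactlyContained (D ∪ D') Ω := by
    intro D D' h1 h2 h3 h4 h5
    refine ⟨⟨h1.1.union h3.1, h1.2.union h5 h3.2⟩, ?_, ?_⟩
    · rw [closure_union]; exact h2.1.union h4.1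
    · rw [closure_union]; exact union_subset h2.2 h4.2
  -- `S` is open and relatively closed in the connected set `Ω`, hence contains it. Finitely many of
  -- the domains cover `C`, and their union is connected as all contain `x₀`.
  set S : Set X := {y | ∃ D, IsDomainSet D ∧ x₀ ∈ D ∧ y ∈ D ∧ CompactlyContained D Ω} with hS
  have hSo : IsOpen S := by
    rw [isOpen_iff_mem_nhds]
    rintro y ⟨D, hD, h0, hy, hDc⟩
    filter_upwards [hD.1.mem_nhds hy] with z hz
    exact ⟨D, hD, h0, hz, hDc⟩
  have hΩS : Ω ⊆ S := by
    refine hΩc.subset_of_closure_inter_subset hSo ⟨x₀, hx₀, ?_⟩ ?_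
    · obtain ⟨D, hD, h0, hDc⟩ := hloc x₀ hx₀
      exact ⟨D, hD, h0, h0, hDc⟩
    · rintro y ⟨hy, hyΩ⟩
      obtain ⟨D, hD, hyD, hDc⟩ := hloc y hyΩ
      obtain ⟨z, hzD, D', hD', h0, hz, hDc'⟩ := mem_closure_iff.1 hy D hD.1 hyD
      obtain ⟨h1, h2⟩ := hunion D' D hD' hDc' hD hDc ⟨z, hz, hzD⟩
      exact ⟨D' ∪ D, h1, Or.inl h0, Or.inr hyD, h2⟩
  obtain ⟨K, hK, -, hCK, hKc⟩ : ∃ K, IsDomainSet K ∧ x₀ ∈ K ∧ C ⊆ K ∧ CompactlyContained K Ω := by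
    refine hC.induction_on (p := fun T => ∃ K, IsDomainSet K ∧ x₀ ∈ K ∧ T ⊆ K ∧
      CompactlyContained K Ω) ?_ ?_ ?_ ?_
    · obtain ⟨D, hD, h0, hDc⟩ := hloc x₀ hx₀
      exact ⟨D, hD, h0, empty_subset _, hDc⟩
    · rintro s t hst ⟨K, h1, h2, h3, h4⟩
      exact ⟨K, h1, h2, hst.trans h3, h4⟩
    · rintro s t ⟨K, h1, h2, h3, h4⟩ ⟨K', h1', h2', h3', h4'⟩
      obtain ⟨h5, h6⟩ := hunion K K' h1 h4 h1' h4' ⟨x₀, h2, h2'⟩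
      exact ⟨K ∪ K', h5, Or.inl h2, union_subset_union h3 h3', h6⟩
    · intro y hy
      obtain ⟨D, hD, h0, hyD, hDc⟩ := hΩS (hCΩ hy)
      exact ⟨D, mem_nhdsWithin_of_mem_nhds (hD.1.mem_nhds hyD), D, hD, h0, Subset.rfl, hDc⟩
  exact ⟨K, hK, hCK, hKc⟩

/-! ### The interior comparison inequality and local finiteness of the perimeter -/

section Interior

variable {n : ℕ} {M : Type*} [EMetricSpace M] [ChartedSpace (Coord n) M]
  [RiemannianBundle (fun x : M => TangentSpace (𝓡 n) x)] [IsManifold (𝓡 n) ∞ M]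
  [IsContMDiffRiemannianBundle (𝓡 n) ∞ (Coord n) (fun x : M => TangentSpace (𝓡 n) x)]
  [MeasurableSpace M] [BorelSpace M] [SecondCountableTopology M]

lemma perimeter_empty_right (E : Set M) : perimeter n E ∅ = 0 := by
  refine le_antisymm (perimeter_le fun X hX => ?_) bot_le
  obtain ⟨C, hC, -, h0⟩ := hX.2.1
  have : X = fun _ => 0 := funext fun x => h0 x fun h => hC h
  rw [this, divInt_zero, ENNReal.ofReal_zero]

lemma exists_isOpen_perimeter_lt_top {E C : Set M} (hC : IsCompact C)
    (h : ∀ x ∈ C, ∃ N, IsOpen N ∧ x ∈ N ∧ perimeter n E N < ⊤) :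
    ∃ O, IsOpen O ∧ C ⊆ O ∧ perimeter n E O < ⊤ := by
  refine hC.induction_on (p := fun T => ∃ O, IsOpen O ∧ T ⊆ O ∧ perimeter n E O < ⊤) ?_ ?_ ?_ ?_
  · exact ⟨∅, isOpen_empty, Subset.rfl, by simp [perimeter_empty_right]⟩
  · rintro s t hst ⟨O, h1, h2, h3⟩
    exact ⟨O, h1, hst.trans h2, h3⟩
  · rintro s t ⟨O, h1, h2, h3⟩ ⟨O', h1', h2', h3'⟩
    exact ⟨O ∪ O', h1.union h1', union_subset_union h2 h2',
      (perimeter_union_open_le h1 h1').trans_lt (ENNReal.add_lt_top.2 ⟨h3, h3'⟩)⟩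
  · intro x hx
    obtain ⟨N, h1, h2, h3⟩ := h x hx
    exact ⟨N, mem_nhdsWithin_of_mem_nhds (h1.mem_nhds h2), N, h1, Subset.rfl, h3⟩

/-- A lower bound for the perimeter of a limit. -/
lemma perimeter_le_of_tendsto {ι : Type*} {l : Filter ι} [l.NeBot] {A : ι → Set M} {B U : Set M}
    (hA : ∀ i, MeasurableSet (A i)) (hB : MeasurableSet B)
    (h : ∀ C ⊆ U, IsCompact C →
      Filter.Tendsto (fun i => riemannianVolume n (symmDiff (A i) B ∩ C)) l (𝓝 0))
    {R : ℝ≥0∞} (hR : ∀ᶠ i in l, perimeter n (A i) U ≤ R) : perimeter n B U ≤ R := by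
  refine le_of_forall_lt fun a ha => ?_
  obtain ⟨i, h1, h2⟩ := ((eventually_lt_perimeter hA hB h ha).and hR).exists
  exact h1.trans_le h2

/-- `E` has finite perimeter in all open sets which are compactly contained in `Ω`. -/
def LocallyFinitePerimeter (n : ℕ) {M : Type*} [EMetricSpace M] [ChartedSpace (Coord n) M]
    [RiemannianBundle (fun x : M => TangentSpace (𝓡 n) x)] [IsManifold (𝓡 n) ∞ M]
    [MeasurableSpace M] (Ω E : Set M) : Prop :=
  ∀ V, IsCompact (closure V) → closure V ⊆ Ω → perimeter n E V < ⊤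

lemma locallyFinitePerimeter_of_forall {Ω E : Set M}
    (h : ∀ x ∈ Ω, ∃ N, IsOpen N ∧ x ∈ N ∧ perimeter n E N < ⊤) :
    LocallyFinitePerimeter n Ω E := by
  intro V hV hVΩ
  obtain ⟨O, -, hO, hf⟩ := exists_isOpen_perimeter_lt_top hV fun x hx => h x (hVΩ hx)
  exact (perimeter_mono E (subset_closure.trans hO)).trans_lt hf

variable [IsRiemannianManifold (𝓡 n) M]

lemma exists_gradNorm_le {Ω : Set M} (hΩ : IsOpen Ω) {u : M → ℝ} (hu : LipLoc Ω u) {Q : Set M}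
    (hQ : IsCompact Q) (hQΩ : Q ⊆ Ω) : ∃ L : ℝ≥0, ∀ x ∈ Q, gradNorm n u x ≤ L := by
  refine hQ.induction_on (p := fun T => ∃ L : ℝ≥0, ∀ x ∈ T, gradNorm n u x ≤ L) ?_ ?_ ?_ ?_
  · exact ⟨0, fun x hx => hx.elim⟩
  · rintro s t hst ⟨L, h⟩
    exact ⟨L, fun x hx => h x (hst hx)⟩
  · rintro s t ⟨L, h⟩ ⟨L', h'⟩
    refine ⟨max L L', fun x hx => ?_⟩
    rcases hx with hx | hx
    · exact (h x hx).trans (by exact_mod_cast le_max_left _ _)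
    · exact (h' x hx).trans (by exact_mod_cast le_max_right _ _)
  · intro x hx
    obtain ⟨C, hC⟩ := eventually_gradNorm_le (n := n) hΩ hu (hQΩ hx)
    exact ⟨_, mem_nhdsWithin_of_mem_nhds hC, C, fun y hy => hy⟩

lemma setLIntegral_gradNorm_ne_top {Ω : Set M} (hΩ : IsOpen Ω) {u : M → ℝ} (hu : LipLoc Ω u)
    {A : Set M} (hA : IsCompact (closure A)) (hAΩ : closure A ⊆ Ω) :
    ∫⁻ x in A, gradNorm n u x ∂(riemannianVolume n) ≠ ⊤ := by
  obtain ⟨L, hL⟩ := exists_gradNorm_le (n := n) hΩ hu hA hAΩ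
  have h1 : ∫⁻ x in A, gradNorm n u x ∂(riemannianVolume n)
      ≤ ∫⁻ _x in closure A, (L : ℝ≥0∞) ∂(riemannianVolume n) :=
    (lintegral_mono_set subset_closure).trans (setLIntegral_mono measurable_const hL)
  refine (h1.trans_lt ?_).ne
  rw [setLIntegral_const]
  exact ENNReal.mul_lt_top ENNReal.coe_lt_top hA.measure_lt_top

lemma symmDiff_eq_sdiff_of_subset {X : Type*} {E F : Set X} (h : E ⊆ F) :
    symmDiff E F = F \ E := by
  ext x
  rw [mem_symmDiff, mem_sdiff]
  have := @h x
  tauto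

variable {Ω : Set M} {u : M → ℝ}

/-- The comparison inequality in a compactly contained subdomain. -/
lemma perimeter_subLevel_add_le_of_domain (hΩ : IsOpen Ω) (hu : IsSubsolution n Ω u) (t : ℝ)
    {F K : Set M} (hF : MeasurableSet F) (hEF : subLevel Ω u t ⊆ F) (hFΩ : F ⊆ Ω)
    (hK : IsDomainSet K) (hKΩ : CompactlyContained K Ω)
    (hFc : IsCompact (closure (F \ subLevel Ω u t))) (hFK : closure (F \ subLevel Ω u t) ⊆ K) :
    perimeter n (subLevel Ω u t) K
      + ∫⁻ x in F \ subLevel Ω u t, gradNorm n u x ∂(riemannianVolume n) ≤ perimeter n F K := by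
  have : LocallyCompactSpace M := ChartedSpace.locallyCompactSpace (Coord n) M
  have hE : MeasurableSet (subLevel Ω u t) := (isOpen_subLevel hΩ hu.1 t).measurableSet
  have h := hu.2 t F K hF.nullMeasurableSet hFΩ hEF hK
    (by rw [symmDiff_eq_sdiff_of_subset hEF]; exact ⟨hFc, hFK⟩) hKΩ
  -- Since `K ⋐ Ω`, the gradient is bounded on `K`, so the bulk terms are finite and the common part
  -- over the sub-level set can be cancelled.
  have hfin : ∀ A : Set M, bulk n u K A ≠ ⊤ := fun A => by
    have hs : closure (A ∩ K) ⊆ closure K := closure_mono inter_subset_right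
    exact setLIntegral_gradNorm_ne_top hΩ hu.1 (hKΩ.1.of_isClosed_subset isClosed_closure hs)
      (hs.trans hKΩ.2)
  have h1 := add_le_add_of_coe_sub_le (hfin _) (hfin _) h
  have h2 : bulk n u K F = bulk n u K (subLevel Ω u t)
      + ∫⁻ x in F \ subLevel Ω u t, gradNorm n u x ∂(riemannianVolume n) := by
    unfold bulk
    rw [← lintegral_inter_add_sdiff _ (F ∩ K) hE]
    congr 2
    · rw [inter_right_comm, inter_eq_self_of_subset_right hEF]
    · congr 1
      ext x
      constructor
      · exact fun hx => ⟨hx.1.1, hx.2⟩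
      · exact fun hx => ⟨⟨hx.1, hFK (subset_closure hx)⟩, hx.2⟩
  rw [h2, ← add_assoc, add_right_comm] at h1
  exact (ENNReal.add_le_add_iff_right (hfin _)).1 h1

/-- The comparison inequality in an arbitrary open set. -/
lemma perimeter_subLevel_add_le (hΩ : IsDomainSet Ω) (hu : IsSubsolution n Ω u) {t : ℝ}
    (ht : LocallyFinitePerimeter n Ω (subLevel Ω u t))
    {F K : Set M} (hF : MeasurableSet F) (hEF : subLevel Ω u t ⊆ F) (hFΩ : F ⊆ Ω)
    (hK : IsOpen K) (hFc : IsCompact (closure (F \ subLevel Ω u t)))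
    (hFcΩ : closure (F \ subLevel Ω u t) ⊆ Ω) (hFK : closure (F \ subLevel Ω u t) ⊆ K) :
    perimeter n (subLevel Ω u t) K
      + ∫⁻ x in F \ subLevel Ω u t, gradNorm n u x ∂(riemannianVolume n) ≤ perimeter n F K := by
  have : LocallyCompactSpace M := ChartedSpace.locallyCompactSpace (Coord n) M
  have : LocallyConnectedSpace M := ChartedSpace.locallyConnectedSpace (Coord n) M
  set E := subLevel Ω u t with hEdef
  set I := ∫⁻ x in F \ E, gradNorm n u x ∂(riemannianVolume n) with hI
  have hE : MeasurableSet E := (isOpen_subLevel hΩ.1 hu.1 t).measurableSet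
  obtain ⟨D, hD, hCD, hDΩ⟩ := exists_isDomainSet_subset hΩ hFc hFcΩ
  have h0 : perimeter n E D + I ≤ perimeter n F D :=
    perimeter_subLevel_add_le_of_domain hΩ.1 hu t hF hEF hFΩ hD hDΩ hFc hCD
  have hoff : ∀ x ∉ closure (F \ E), (x ∈ E ↔ x ∈ F) := by
    intro x hx
    refine ⟨fun h => hEF h, fun h => ?_⟩
    by_contra h'
    exact hx (subset_closure ⟨h, h'⟩)
  set V := K ∩ D with hV
  have hVo : IsOpen V := hK.inter hD.1
  have hCV : closure (F \ E) ⊆ V := subset_inter hFK hCD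
  have fD : perimeter n E D ≠ ⊤ := (ht D hDΩ.1 hDΩ.2).ne
  -- The inequality known on `D` is carried over to `V = K ∩ D` and then to `K`, since the
  -- difference of the two perimeters is localized near `F \ E`. Each transfer cancels a perimeter
  -- of `E`, which must be finite.
  have fV : perimeter n E V ≠ ⊤ := ((perimeter_mono E inter_subset_right).trans_lt fD.lt_top).ne
  have l1 := perimeter_add_perimeter_le (n := n) (U := D) hF hE hFc hVo hCV inter_subset_right
    fun x hx => (hoff x hx).symm
  have l2 := perimeter_add_perimeter_le (n := n) (U := K) hE hF hFc hVo hCV inter_subset_left hoff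
  have l3 : I + perimeter n E V ≤ perimeter n F V := by
    rw [← ENNReal.add_le_add_iff_left fD, ← add_assoc]
    exact (add_le_add_left h0 _).trans l1
  rw [← ENNReal.add_le_add_iff_right fV]
  calc perimeter n E K + I + perimeter n E V = perimeter n E K + (I + perimeter n E V) :=
        add_assoc _ _ _
    _ ≤ perimeter n E K + perimeter n F V := by gcongr
    _ ≤ _ := l2

/-- A sub-level set intersects a set compactly contained in the domain in a set of smaller
perimeter. -/
lemma perimeter_subLevel_inter_le (hΩ : IsDomainSet Ω) (hu : IsSubsolution n Ω u) {t : ℝ}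
    (ht : LocallyFinitePerimeter n Ω (subLevel Ω u t)) {A : Set M} (hA : MeasurableSet A)
    (hAc : IsCompact (closure A)) (hAΩ : closure A ⊆ Ω) :
    perimeter n (subLevel Ω u t ∩ A) univ ≤ perimeter n A univ := by
  have : LocallyCompactSpace M := ChartedSpace.locallyCompactSpace (Coord n) M
  have : LocallyConnectedSpace M := ChartedSpace.locallyConnectedSpace (Coord n) M
  set E := subLevel Ω u t with hEdef
  have hE : MeasurableSet E := (isOpen_subLevel hΩ.1 hu.1 t).measurableSet
  obtain ⟨D, hD, hAD, hDΩ⟩ := exists_isDomainSet_subset hΩ hAc hAΩ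
  have hcl : closure ((E ∪ A) \ E) ⊆ closure A := closure_mono (by
    rintro x ⟨h | h, h'⟩
    · exact (h' h).elim
    · exact h)
  -- Minimality against the competitor `E ∪ A`; with submodularity `P(E)` cancels and `P(E ∩ A) ≤
  -- P(A)` remains.
  have h1 : perimeter n E D ≤ perimeter n (E ∪ A) D := le_self_add.trans
    (perimeter_subLevel_add_le hΩ hu ht (hE.union hA) subset_union_left
      (union_subset (fun x hx => hx.1) (subset_closure.trans hAΩ)) hD.1
      (hAc.of_isClosed_subset isClosed_closure hcl) (hcl.trans hAΩ) (hcl.trans hAD))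
  have h2 := perimeter_union_add_perimeter_inter_le (n := n) hD.1 hE hA
  have fD : perimeter n E D ≠ ⊤ := (ht D hDΩ.1 hDΩ.2).ne
  have h3 : perimeter n (E ∩ A) D ≤ perimeter n A D := by
    rw [← ENNReal.add_le_add_iff_left fD]
    exact (add_le_add_left h1 _).trans h2
  calc _ ≤ perimeter n (E ∩ A) D := perimeter_le_of_compact (hE.inter hA) hAc hD.1
        (inter_subset_right.trans subset_closure) hAD
    _ ≤ perimeter n A D := h3
    _ ≤ _ := perimeter_mono A (subset_univ D)

/-- Almost every sub-level set has locally finite perimeter. -/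
lemma ae_locallyFinitePerimeter (hΩ : IsOpen Ω) (hu : LipLoc Ω u) :
    ∀ᵐ t : ℝ, LocallyFinitePerimeter n Ω (subLevel Ω u t) := by
  choose! N hNo hxN hNΩ hN using fun x (hx : x ∈ Ω) =>
    exists_ae_perimeter_subLevel_lt_top (n := n) hΩ hu hx
  obtain ⟨T, hTΩ, hT, hcov⟩ := TopologicalSpace.countable_cover_nhdsWithin (s := Ω) (f := N)
    fun x hx => mem_nhdsWithin_of_mem_nhds ((hNo x hx).mem_nhds (hxN x hx))
  have h : ∀ᵐ t : ℝ, ∀ x ∈ T, perimeter n (subLevel Ω u t) (N x) < ⊤ :=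
    (ae_ball_iff hT).2 fun x hx => hN x (hTΩ hx)
  filter_upwards [h] with t ht
  refine locallyFinitePerimeter_of_forall fun x hx => ?_
  obtain ⟨y, hy, hxy⟩ := mem_iUnion₂.1 (hcov hx)
  exact ⟨N y, hNo y (hTΩ hy), hxy, ht y hy⟩

/-- All sub-level sets of a subsolution have locally finite perimeter. -/
theorem locallyFinitePerimeter_subLevel (hΩ : IsDomainSet Ω) (hu : IsSubsolution n Ω u) (t : ℝ) :
    LocallyFinitePerimeter n Ω (subLevel Ω u t) := by
  have : LocallyCompactSpace M := ChartedSpace.locallyCompactSpace (Coord n) M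
  have hEm : ∀ s, MeasurableSet (subLevel Ω u s) := fun s =>
    (isOpen_subLevel hΩ.1 hu.1 s).measurableSet
  have hae := ae_locallyFinitePerimeter (n := n) hΩ.1 hu.1
  -- Good levels have full measure, so they accumulate at `t` from below.
  have hex : ∀ j : ℕ, ∃ s ∈ Ioo (t - 1 / ((j : ℝ) + 1)) t,
      LocallyFinitePerimeter n Ω (subLevel Ω u s) := by
    intro j
    have h2 : ∃ᵐ r : ℝ, r ∈ Ioo (t - 1 / ((j : ℝ) + 1)) t := by
      rw [frequently_ae_mem_iff, Real.volume_Ioo]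
      have : (0 : ℝ) < 1 / ((j : ℝ) + 1) := by positivity
      simpa using this
    exact (h2.and_eventually hae).exists.imp fun r h => h
  choose s hs hsf using hex
  have hst : Filter.Tendsto s Filter.atTop (𝓝 t) := by
    have h1 : Filter.Tendsto (fun j : ℕ => t - 1 / ((j : ℝ) + 1)) Filter.atTop (𝓝 (t - 0)) :=
      tendsto_const_nhds.sub tendsto_one_div_add_atTop_nhds_zero_nat
    rw [sub_zero] at h1
    exact tendsto_of_tendsto_of_tendsto_of_le_of_le h1 tendsto_const_nhds
      (fun j => (hs j).1.le) fun j => (hs j).2.le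
  refine locallyFinitePerimeter_of_forall fun x hx => ?_
  obtain ⟨B, hB, hxB, hBc, hBΩ, hBf⟩ := exists_perimeter_lt_top n x (hΩ.1.mem_nhds hx)
  -- The bound is independent of the level, so lower semicontinuity carries it to `t`.
  have hbd : ∀ j, perimeter n (subLevel Ω u (s j) ∩ B) univ ≤ perimeter n B univ := fun j =>
    perimeter_subLevel_inter_le hΩ hu (hsf j) hB.measurableSet hBc hBΩ
  have hlim : perimeter n (subLevel Ω u t ∩ B) univ ≤ perimeter n B univ := by
    refine perimeter_le_of_tendsto (l := Filter.atTop) (fun j => (hEm (s j)).inter hB.measurableSet)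
      ((hEm t).inter hB.measurableSet) (fun C _ _ => ?_) (Filter.Eventually.of_forall hbd)
    have hBfin : riemannianVolume n B ≠ ⊤ :=
      ((measure_mono subset_closure).trans_lt hBc.measure_lt_top).ne
    have h1 : Filter.Tendsto (fun j => ∫⁻ y, (symmDiff (subLevel Ω u (s j) ∩ B)
        (subLevel Ω u t ∩ B)).indicator 1 y ∂(riemannianVolume n)) Filter.atTop
        (𝓝 (∫⁻ _y : M, 0 ∂(riemannianVolume n))) := by
      refine tendsto_lintegral_of_dominated_convergence (B.indicator 1) (fun j => ?_) (fun j => ?_)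
        ?_ (Filter.Eventually.of_forall fun y => ?_)
      · exact measurable_one.indicator (((hEm (s j)).inter hB.measurableSet).symmDiff
          ((hEm t).inter hB.measurableSet))
      · refine Filter.Eventually.of_forall fun y => indicator_le_indicator_of_subset ?_
          (fun _ => zero_le_one) y
        rintro z (h | h)
        · exact h.1.2
        · exact h.1.2
      · rw [lintegral_indicator_one hB.measurableSet]
        exact hBfin
      · refine tendsto_const_nhds.congr' ?_
        -- The strict inequality defining sub-level sets makes `{u < t}` the limit of `{u < s j}`
        -- along levels from below.
        have hev : ∀ᶠ j in Filter.atTop, (u y < t → u y < s j) := by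
          by_cases hy : u y < t
          · filter_upwards [hst.eventually (lt_mem_nhds hy)] with j hj
            exact fun _ => hj
          · exact Filter.Eventually.of_forall fun j h => (hy h).elim
        filter_upwards [hev] with j hj
        rw [indicator_of_notMem]
        rintro (⟨⟨⟨h1, h2⟩, h3⟩, h4⟩ | ⟨⟨⟨h1, h2⟩, h3⟩, h4⟩)
        · exact h4 ⟨⟨h1, h2.trans (hs j).2⟩, h3⟩
        · exact h4 ⟨⟨h1, hj h2⟩, h3⟩
    rw [lintegral_zero] at h1
    refine tendsto_of_tendsto_of_tendsto_of_le_of_le tendsto_const_nhds h1 (fun _ => bot_le)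
      fun j => ?_
    simp only
    rw [lintegral_indicator_one (((hEm (s j)).inter hB.measurableSet).symmDiff
          ((hEm t).inter hB.measurableSet))]
    exact measure_mono inter_subset_left
  refine ⟨B, hB, hxB, ?_⟩
  rw [perimeter_congr (hEm t) ((hEm t).inter hB.measurableSet) (U := B)
    fun y hy => ⟨fun h => ⟨h, hy⟩, fun h => h.1⟩]
  exact (perimeter_mono _ (subset_univ B)).trans_lt (hlim.trans_lt hBf)

end Interior

end WeakIMCF
end

noncomputable section

namespace WeakIMCF

/-! ### Competitors touching the boundary -/

section Boundary

variable {n : ℕ} {M : Type*} [EMetricSpace M] [ChartedSpace (Coord n) M]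
  [RiemannianBundle (fun x : M => TangentSpace (𝓡 n) x)] [IsManifold (𝓡 n) ∞ M]
  [IsContMDiffRiemannianBundle (𝓡 n) ∞ (Coord n) (fun x : M => TangentSpace (𝓡 n) x)]
  [MeasurableSpace M] [BorelSpace M] [SecondCountableTopology M]

lemma tendsto_volume_of_symmDiff_subset {A G : ℕ → Set M} {B F : Set M}
    (h : ∀ j, symmDiff (A j) B ⊆ symmDiff (G j) F)
    (hG : Filter.Tendsto (fun j => riemannianVolume n (symmDiff (G j) F)) Filter.atTop (𝓝 0))
    (C : Set M) :
    Filter.Tendsto (fun j => riemannianVolume n (symmDiff (A j) B ∩ C)) Filter.atTop (𝓝 0) :=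
  tendsto_of_tendsto_of_tendsto_of_le_of_le tendsto_const_nhds hG (fun _ => bot_le)
    fun j => measure_mono (inter_subset_left.trans (h j))

/-- Lower semicontinuity in additive form. A zero limit perimeter is treated apart, because then `P
- ε < P` fails. -/
lemma eventually_perimeter_le_add {A G : ℕ → Set M} {B F U : Set M} (hA : ∀ j, MeasurableSet (A j))
    (hB : MeasurableSet B) (h : ∀ j, symmDiff (A j) B ⊆ symmDiff (G j) F)
    (hG : Filter.Tendsto (fun j => riemannianVolume n (symmDiff (G j) F)) Filter.atTop (𝓝 0))
    (hBf : perimeter n B U ≠ ⊤) {ε : ℝ≥0∞} (hε : ε ≠ 0) :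
    ∀ᶠ j in Filter.atTop, perimeter n B U ≤ perimeter n (A j) U + ε := by
  rcases eq_or_ne (perimeter n B U) 0 with h0 | h0
  · simp [h0]
  filter_upwards [eventually_lt_perimeter hA hB (U := U)
    (fun C _ _ => tendsto_volume_of_symmDiff_subset h hG C)
    (ENNReal.sub_lt_self hBf h0 hε)] with j hj
  exact tsub_le_iff_right.1 hj.le

variable [IsRiemannianManifold (𝓡 n) M] {Ω : Set M} {u : M → ℝ}

lemma frontier_of_mem_closure {X : Type*} [TopologicalSpace X] {U S : Set X} (hU : IsOpen U)
    (hS : S ⊆ U) {x : X} (hx : x ∈ closure S) (hxU : x ∉ U) : x ∈ frontier U := by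
  rw [hU.frontier_eq]
  exact ⟨closure_mono hS hx, hxU⟩

/-- The sub-level set has finite perimeter in `K` if it has a competitor of finite perimeter. -/
lemma perimeter_subLevel_lt_top (hΩ : IsLocallyLipschitzDomain (n := n) Ω)
    (hu : IsSubsolution n Ω u) (t : ℝ) {F K : Set M} (hF : MeasurableSet F)
    (hEF : subLevel Ω u t ⊆ F) (hFΩ : F ⊆ Ω) (hK : IsOpen K)
    (hFc : IsCompact (closure (F \ subLevel Ω u t))) (hFK : closure (F \ subLevel Ω u t) ⊆ K)
    (hFf : perimeter n F K < ⊤) : perimeter n (subLevel Ω u t) K < ⊤ := by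
  have : LocallyCompactSpace M := ChartedSpace.locallyCompactSpace (Coord n) M
  have ht := locallyFinitePerimeter_subLevel hΩ.1 hu t
  set E := subLevel Ω u t with hEdef
  have hE : MeasurableSet E := (isOpen_subLevel hΩ.1.1 hu.1 t).measurableSet
  -- Inside `Ω` local finiteness is known. At a boundary point the sets `F ∩ G j ∩ B` are compactly
  -- contained in `Ω`, so intersecting them with `E` does not increase the perimeter. The resulting
  -- bounds are uniform in `j`, and the intersections tend to `E ∩ B`.
  have key : ∀ x ∈ closure (F \ E), ∃ N, IsOpen N ∧ x ∈ N ∧ perimeter n E N < ⊤ := by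
    intro x hx
    by_cases hxΩ : x ∈ Ω
    · obtain ⟨B, hB, hxB, hBc, hBΩ, -⟩ := exists_perimeter_lt_top n x (hΩ.1.1.mem_nhds hxΩ)
      exact ⟨B, hB, hxB, ht B hBc hBΩ⟩
    have hxf := frontier_of_mem_closure hΩ.1.1 (sdiff_subset.trans hFΩ) hx hxΩ
    obtain ⟨V, hV, C₀, _, _, hpush⟩ := exists_push hΩ hxf hK (hFK hx)
    obtain ⟨G, hG, -, hGΩ, hGt, hGp⟩ := hpush F hFΩ hF
    obtain ⟨B, hB, hxB, hBc, hBV, hBf⟩ := exists_perimeter_lt_top n x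
      (Filter.inter_mem hV (hK.mem_nhds (hFK hx)))
    have hA : ∀ j, MeasurableSet (F ∩ G j ∩ B) := fun j => (hF.inter (hG j)).inter hB.measurableSet
    have hAcl : ∀ j, closure (F ∩ G j ∩ B) ⊆ closure B := fun j => closure_mono inter_subset_right
    have hAc : ∀ j, IsCompact (closure (F ∩ G j ∩ B)) := fun j =>
      hBc.of_isClosed_subset isClosed_closure (hAcl j)
    have hAΩ : ∀ j, closure (F ∩ G j ∩ B) ⊆ Ω := fun j => by
      refine (closure_mono ?_).trans (hGΩ j)
      exact fun y hy => ⟨hy.1.2, (hBV (subset_closure hy.2)).1⟩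
    have hAK : ∀ j, closure (F ∩ G j ∩ B) ⊆ K := fun j =>
      (hAcl j).trans (hBV.trans inter_subset_right)
    have hbd : ∀ᶠ j in Filter.atTop, perimeter n (E ∩ (F ∩ G j ∩ B)) univ
        ≤ perimeter n F K + ENNReal.ofReal (1 + 1) * perimeter n F K + perimeter n B univ := by
      filter_upwards [hGp 1 one_pos] with j hj
      calc _ ≤ perimeter n (F ∩ G j ∩ B) univ :=
            perimeter_subLevel_inter_le hΩ.1 hu ht (hA j) (hAc j) (hAΩ j)
        _ ≤ perimeter n (F ∩ G j ∩ B) K :=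
            perimeter_le_of_compact (hA j) (hAc j) hK subset_closure (hAK j)
        _ ≤ perimeter n (F ∩ G j) K + perimeter n B K :=
            perimeter_inter_le hK (hF.inter (hG j)) hB.measurableSet
        _ ≤ perimeter n F K + perimeter n (G j) K + perimeter n B K := by
            gcongr
            exact perimeter_inter_le hK hF (hG j)
        _ ≤ _ := by
            gcongr
            exact perimeter_mono B (subset_univ K)
    have hlim := perimeter_le_of_tendsto (fun j => hE.inter (hA j)) (hE.inter hB.measurableSet)
      (fun C _ _ => tendsto_volume_of_symmDiff_subset (F := F) (G := G) (fun j => ?_) hGt C) hbd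
    · refine ⟨B, hB, hxB, ?_⟩
      rw [perimeter_congr hE (hE.inter hB.measurableSet) (U := B)
        fun y hy => ⟨fun h => ⟨h, hy⟩, fun h => h.1⟩]
      refine (perimeter_mono _ (subset_univ B)).trans_lt (hlim.trans_lt ?_)
      exact ENNReal.add_lt_top.2 ⟨ENNReal.add_lt_top.2
        ⟨hFf, ENNReal.mul_lt_top ENNReal.ofReal_lt_top hFf⟩, hBf⟩
    · rintro y (⟨⟨h1, ⟨h2, h3⟩, h4⟩, h5⟩ | ⟨⟨h1, h2⟩, h3⟩)
      · exact (h5 ⟨h1, h4⟩).elim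
      · refine Or.inr ⟨hEF h1, fun h => h3 ⟨h1, ⟨hEF h1, h⟩, h2⟩⟩
  obtain ⟨O, hO, hCO, hOf⟩ := exists_isOpen_perimeter_lt_top hFc key
  -- Off `closure (F \ E)` the sets `E` and `F` coincide, so the perimeter of `E` there is that of
  -- `F`.
  have hsub : K ⊆ O ∪ K \ closure (F \ E) := fun y hy => by
    by_cases h : y ∈ closure (F \ E)
    · exact Or.inl (hCO h)
    · exact Or.inr ⟨hy, h⟩
  have hKo : IsOpen (K \ closure (F \ E)) := hK.sdiff isClosed_closure
  have h1 : perimeter n E (K \ closure (F \ E)) = perimeter n F (K \ closure (F \ E)) := by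
    refine perimeter_congr hE hF fun y hy => ⟨fun h => hEF h, fun h => ?_⟩
    by_contra h'
    exact hy.2 (subset_closure ⟨h, h'⟩)
  refine ((perimeter_mono E hsub).trans (perimeter_union_open_le hO hKo)).trans_lt ?_
  rw [h1]
  exact ENNReal.add_lt_top.2 ⟨hOf, (perimeter_mono F sdiff_subset).trans_lt hFf⟩

/-- A competitor may be pushed away from the boundary near finitely many boundary points. -/
lemma exists_pushed_competitor {ι : Type*} {E K : Set M} (hE : MeasurableSet E) (hK : IsOpen K)
    (hEf : perimeter n E K ≠ ⊤) {V : ι → Set M}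
    (hV : ∀ i, ∀ F ⊆ Ω, MeasurableSet F → ∃ G : ℕ → Set M, (∀ j, MeasurableSet (G j)) ∧
      (∀ j, closure (G j ∩ V i) ⊆ Ω) ∧
      Filter.Tendsto (fun j => riemannianVolume n (symmDiff (G j) F)) Filter.atTop (𝓝 0) ∧
      ∀ δ : ℝ, 0 < δ → ∀ᶠ j in Filter.atTop,
        perimeter n (G j) K ≤ ENNReal.ofReal (1 + δ) * perimeter n F K) (s : Finset ι) :
    ∀ F : Set M, MeasurableSet F → E ⊆ F → F ⊆ Ω → perimeter n F K ≠ ⊤ → ∀ ε : ℝ≥0∞, ε ≠ 0 →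
      ε ≠ ⊤ → ∃ F', MeasurableSet F' ∧ E ⊆ F' ∧ F' ⊆ F ∧ perimeter n F' K ≤ perimeter n F K + ε ∧
        riemannianVolume n (F \ F') ≤ ε ∧ ∀ i ∈ s, closure ((F' \ E) ∩ V i) ⊆ Ω := by
  classical
  induction s using Finset.induction_on with
  | empty =>
    intro F hF hEF _ _ ε _ _
    exact ⟨F, hF, hEF, Subset.rfl, le_self_add, by simp, by simp⟩
  | insert i s hi ih =>
    intro F hF hEF hFΩ hFf ε hε hεt
    have hε2 : ε / 2 ≠ 0 := (ENNReal.div_pos hε (by norm_num)).ne'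
    have hε2t : ε / 2 ≠ ⊤ := ENNReal.div_ne_top hεt (by norm_num)
    obtain ⟨F₁, hF₁, hEF₁, hF₁F, hF₁p, hF₁v, hF₁V⟩ := ih F hF hEF hFΩ hFf (ε / 2) hε2 hε2t
    have hF₁f : perimeter n F₁ K ≠ ⊤ :=
      (hF₁p.trans_lt (ENNReal.add_lt_top.2 ⟨hFf.lt_top, hε2t.lt_top⟩)).ne
    obtain ⟨G, hG, hGΩ, hGt, hGp⟩ := hV i F₁ (hF₁F.trans hFΩ) hF₁
    set P := perimeter n F₁ K with hP
    -- Half of `ε` was spent on the earlier points. The other half covers three errors: the factor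
    -- `1 + δ` of the shear and two uses of lower semicontinuity.
    set d := ε / 2 / 3 with hd
    have hd0 : d ≠ 0 := (ENNReal.div_pos hε2 (by norm_num)).ne'
    obtain ⟨δ, hδ, hδP⟩ : ∃ δ : ℝ, 0 < δ ∧ ENNReal.ofReal δ * P ≤ d := by
      have hlim : Filter.Tendsto (fun δ : ℝ => ENNReal.ofReal δ * P) (𝓝[>] 0)
          (𝓝 (ENNReal.ofReal 0 * P)) :=
        ENNReal.Tendsto.mul_const (ENNReal.tendsto_ofReal nhdsWithin_le_nhds) (Or.inr hF₁f)
      rw [ENNReal.ofReal_zero, zero_mul] at hlim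
      obtain ⟨δ, h1, h2⟩ := ((hlim.eventually (gt_mem_nhds (pos_iff_ne_zero.2 hd0))).and
        self_mem_nhdsWithin).exists
      exact ⟨δ, h2, h1.le⟩
    -- `F₁ ∪ G j` tends to `F₁`, so by submodularity `F₁ ∩ G j` has hardly more perimeter than `F₁`.
    have ev1 := eventually_perimeter_le_add (U := K) (fun j => hF₁.union (hG j)) hF₁ (fun j => by
      rintro y (⟨h1 | h1, h2⟩ | ⟨h1, h2⟩)
      · exact (h2 h1).elim
      · exact Or.inl ⟨h1, h2⟩
      · exact (h2 (Or.inl h1)).elim) hGt hF₁f hd0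
    -- `E ∩ G j` tends to `E`, so adding `E` back to `F₁ ∩ G j` hardly increases its perimeter.
    have ev2 := eventually_perimeter_le_add (U := K) (fun j => hE.inter (hG j)) hE (fun j => by
      rintro y (⟨h1, h2⟩ | ⟨h1, h2⟩)
      · exact (h2 h1.1).elim
      · exact Or.inr ⟨hEF₁ h1, fun h => h2 ⟨h1, h⟩⟩) hGt hEf hd0
    have ev3 := hGt.eventually (gt_mem_nhds (pos_iff_ne_zero.2 hε2))
    obtain ⟨j, h1, h2, h3, h4⟩ := (ev1.and (ev2.and (ev3.and (hGp δ hδ)))).exists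
    have hFG := hF₁.inter (hG j)
    have fFG : perimeter n (F₁ ∪ G j) K ≠ ⊤ ∧ perimeter n (F₁ ∩ G j) K ≠ ⊤ := by
      have hGf : perimeter n (G j) K < ⊤ :=
        h4.trans_lt (ENNReal.mul_lt_top ENNReal.ofReal_lt_top hF₁f.lt_top)
      have := (perimeter_union_add_perimeter_inter_le (n := n) hK hF₁ (hG j)).trans_lt
        (ENNReal.add_lt_top.2 ⟨hF₁f.lt_top, hGf⟩)
      exact ⟨(ENNReal.add_lt_top.1 this).1.ne, (ENNReal.add_lt_top.1 this).2.ne⟩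
    have p1 : perimeter n (F₁ ∩ G j) K ≤ P + d + d := by
      have a1 := perimeter_union_add_perimeter_inter_le (n := n) hK hF₁ (hG j)
      have a2 : perimeter n (G j) K ≤ P + d := by
        refine h4.trans ?_
        rw [ENNReal.ofReal_add zero_le_one hδ.le, ENNReal.ofReal_one, add_mul, one_mul]
        gcongr
      rw [← ENNReal.add_le_add_iff_left fFG.1]
      calc _ ≤ P + perimeter n (G j) K := a1
        _ ≤ (perimeter n (F₁ ∪ G j) K + d) + (P + d) := add_le_add h1 a2
        _ = _ := by ring
    have p2 : perimeter n (E ∪ F₁ ∩ G j) K ≤ P + d + d + d := by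
      have a1 := perimeter_union_add_perimeter_inter_le (n := n) hK hE hFG
      have a3 : E ∩ (F₁ ∩ G j) = E ∩ G j := by
        rw [← inter_assoc, inter_eq_self_of_subset_left hEF₁]
      rw [a3] at a1
      have fEG : perimeter n (E ∩ G j) K ≠ ⊤ := ((le_add_self.trans a1).trans_lt
        (ENNReal.add_lt_top.2 ⟨hEf.lt_top, fFG.2.lt_top⟩)).ne
      rw [← ENNReal.add_le_add_iff_right fEG]
      calc _ ≤ perimeter n E K + perimeter n (F₁ ∩ G j) K := a1
        _ ≤ (perimeter n (E ∩ G j) K + d) + (P + d + d) := add_le_add h2 p1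
        _ = _ := by ring
    have d3 : d + d + d = ε / 2 := by
      rw [hd]
      exact ENNReal.add_thirds _
    have hsub : E ∪ F₁ ∩ G j ⊆ F₁ := union_subset hEF₁ inter_subset_left
    refine ⟨E ∪ F₁ ∩ G j, hE.union hFG, subset_union_left, hsub.trans hF₁F, ?_, ?_, ?_⟩
    · calc _ ≤ P + (d + d + d) := p2.trans_eq (by ring)
        _ ≤ perimeter n F K + ε / 2 + ε / 2 := by rw [d3]; gcongr
        _ = perimeter n F K + ε := by rw [add_assoc, ENNReal.add_halves]
    · have hs : F \ (E ∪ F₁ ∩ G j) ⊆ F \ F₁ ∪ symmDiff (G j) F₁ := by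
        rintro y ⟨h5, h6⟩
        by_cases h7 : y ∈ F₁
        · exact Or.inr (Or.inr ⟨h7, fun h => h6 (Or.inr ⟨h7, h⟩)⟩)
        · exact Or.inl ⟨h5, h7⟩
      calc _ ≤ riemannianVolume n (F \ F₁) + riemannianVolume n (symmDiff (G j) F₁) :=
            (measure_mono hs).trans (measure_union_le _ _)
        _ ≤ ε / 2 + ε / 2 := add_le_add hF₁v h3.le
        _ = ε := ENNReal.add_halves ε
    · intro k hk
      rcases Finset.mem_insert.1 hk with rfl | hk
      · refine (closure_mono ?_).trans (hGΩ j)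
        rintro y ⟨⟨h5 | h5, h6⟩, h7⟩
        · exact (h6 h5).elim
        · exact ⟨h5.2, h7⟩
      -- The new competitor is contained in `F₁`, so the property gained at earlier points persists.
      · refine (closure_mono ?_).trans (hF₁V k hk)
        rintro y ⟨⟨h5, h6⟩, h7⟩
        exact ⟨⟨hsub h5, h6⟩, h7⟩

/-- Competitors may be approximated by competitors which do not touch the boundary. -/
lemma exists_interior_competitor (hΩ : IsLocallyLipschitzDomain (n := n) Ω) {E F K : Set M}
    (hE : MeasurableSet E) (hF : MeasurableSet F) (hEF : E ⊆ F) (hFΩ : F ⊆ Ω) (hK : IsOpen K)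
    (hFc : IsCompact (closure (F \ E))) (hFK : closure (F \ E) ⊆ K) (hEf : perimeter n E K ≠ ⊤)
    (hFf : perimeter n F K ≠ ⊤) {ε : ℝ≥0∞} (hε : ε ≠ 0) (hεt : ε ≠ ⊤) :
    ∃ F', MeasurableSet F' ∧ E ⊆ F' ∧ F' ⊆ F ∧ perimeter n F' K ≤ perimeter n F K + ε ∧
      riemannianVolume n (F \ F') ≤ ε ∧ closure (F' \ E) ⊆ Ω := by
  have hD : IsCompact (closure (F \ E) \ Ω) := hFc.diff hΩ.1.1
  have hDf : ∀ x ∈ closure (F \ E) \ Ω, x ∈ frontier Ω := fun x hx =>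
    frontier_of_mem_closure hΩ.1.1 (sdiff_subset.trans hFΩ) hx.1 hx.2
  choose V hV _ _ _ hpush using fun x : ↥(closure (F \ E) \ Ω) =>
    exists_push hΩ (hDf x x.2) hK (hFK x.2.1)
  -- Interiors are used for the cover because a limit point of `F' \ E` in an open set is a limit of
  -- points of `F' \ E` in that set.
  obtain ⟨s, hs⟩ := hD.elim_nhds_subcover' (fun x hx => interior (V ⟨x, hx⟩))
    fun x hx => interior_mem_nhds.2 (hV ⟨x, hx⟩)
  obtain ⟨F', hF', hEF', hF'F, hp, hv, hV'⟩ := exists_pushed_competitor (Ω := Ω) hE hK hEf (V := V)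
    (fun x S hS hSm => (hpush x S hS hSm).imp fun G hG => ⟨hG.1, hG.2.2⟩) s F hF hEF hFΩ hFf ε hε hεt
  refine ⟨F', hF', hEF', hF'F, hp, hv, fun y hy => ?_⟩
  by_contra hyΩ
  have hyD : y ∈ closure (F \ E) \ Ω := ⟨closure_mono (sdiff_subset_sdiff_left hF'F) hy, hyΩ⟩
  obtain ⟨x, hxs, hyx⟩ := mem_iUnion₂.1 (hs hyD)
  exact hyΩ (hV' x hxs (closure_mono (inter_subset_inter_right _ interior_subset)
    (isOpen_interior.closure_inter ⟨hy, hyx⟩)))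

/-- The comparison inequality for competitors touching the boundary. -/
theorem perimeter_subLevel_add_le_obstacle (hΩ : IsLocallyLipschitzDomain (n := n) Ω)
    (hu : IsSubsolution n Ω u) (t : ℝ) {F K : Set M} (hF : MeasurableSet F)
    (hEF : subLevel Ω u t ⊆ F) (hFΩ : F ⊆ Ω) (hK : IsOpen K)
    (hFc : IsCompact (closure (F \ subLevel Ω u t))) (hFK : closure (F \ subLevel Ω u t) ⊆ K)
    (hFf : perimeter n F K < ⊤) :
    perimeter n (subLevel Ω u t) K
      + ∫⁻ x in F \ subLevel Ω u t, gradNorm n u x ∂(riemannianVolume n) ≤ perimeter n F K := by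
  have : LocallyCompactSpace M := ChartedSpace.locallyCompactSpace (Coord n) M
  have ht := locallyFinitePerimeter_subLevel hΩ.1 hu t
  have hEf := perimeter_subLevel_lt_top hΩ hu t hF hEF hFΩ hK hFc hFK hFf
  set E := subLevel Ω u t with hEdef
  have hE : MeasurableSet E := (isOpen_subLevel hΩ.1.1 hu.1 t).measurableSet
  set ν : Measure M := (riemannianVolume n).withDensity (gradNorm n u) with hν
  have hνm : ∀ S, MeasurableSet S →
      ν S = ∫⁻ x in S, gradNorm n u x ∂(riemannianVolume n) := fun S hS =>
    withDensity_apply _ hS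
  -- The gradient may be unbounded near `∂Ω`, so a small volume of `F \ F'` does not make the lost
  -- bulk term small. On a compact subset of `Ω` it does.
  have hcompact : ∀ Q, IsCompact Q → Q ⊆ Ω →
      perimeter n E K + ν ((F \ E) ∩ Q) ≤ perimeter n F K := by
    intro Q hQ hQΩ
    obtain ⟨L, hL⟩ := exists_gradNorm_le (n := n) hΩ.1.1 hu.1 hQ hQΩ
    have key : ∀ ε : ℝ, 0 < ε → perimeter n E K + ν ((F \ E) ∩ Q)
        ≤ perimeter n F K + ENNReal.ofReal ε + L * ENNReal.ofReal ε := by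
      intro ε hε
      obtain ⟨F', hF', hEF', hF'F, hp, hv, hcl⟩ := exists_interior_competitor hΩ hE hF hEF hFΩ hK
        hFc hFK hEf.ne hFf.ne (ENNReal.ofReal_pos.2 hε).ne' ENNReal.ofReal_ne_top
      have hsub : closure (F' \ E) ⊆ closure (F \ E) :=
        closure_mono (sdiff_subset_sdiff_left hF'F)
      have h1 := perimeter_subLevel_add_le hΩ.1 hu ht hF' hEF' (hF'F.trans hFΩ) hK
        (hFc.of_isClosed_subset isClosed_closure hsub) hcl (hsub.trans hFK)
      rw [← hνm _ (hF'.diff hE)] at h1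
      have h2 : ν ((F \ E) ∩ Q) ≤ ν (F' \ E) + ν ((F \ F') ∩ Q) := by
        refine (measure_mono ?_).trans (measure_union_le _ _)
        rintro y ⟨⟨h3, h4⟩, h5⟩
        by_cases h6 : y ∈ F'
        · exact Or.inl ⟨h6, h4⟩
        · exact Or.inr ⟨⟨h3, h6⟩, h5⟩
      have h3 : ν ((F \ F') ∩ Q) ≤ L * ENNReal.ofReal ε := by
        rw [hνm _ ((hF.diff hF').inter hQ.isClosed.measurableSet)]
        calc _ ≤ ∫⁻ _x in (F \ F') ∩ Q, (L : ℝ≥0∞) ∂(riemannianVolume n) :=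
              setLIntegral_mono measurable_const fun x hx => hL x hx.2
          _ ≤ _ := by
              rw [setLIntegral_const]
              gcongr
              exact (measure_mono inter_subset_left).trans hv
      calc _ ≤ perimeter n E K + (ν (F' \ E) + L * ENNReal.ofReal ε) := by
            gcongr
            exact h2.trans (by gcongr)
        _ = perimeter n E K + ν (F' \ E) + L * ENNReal.ofReal ε := (add_assoc _ _ _).symm
        _ ≤ _ := add_le_add (h1.trans hp) le_rfl
    have hlim : Filter.Tendsto (fun ε : ℝ => perimeter n F K + ENNReal.ofReal ε
        + L * ENNReal.ofReal ε) (𝓝[>] 0)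
        (𝓝 (perimeter n F K + ENNReal.ofReal 0 + L * ENNReal.ofReal 0)) := by
      have h0 : Filter.Tendsto (fun ε : ℝ => ENNReal.ofReal ε) (𝓝[>] 0) (𝓝 (ENNReal.ofReal 0)) :=
        ENNReal.tendsto_ofReal nhdsWithin_le_nhds
      exact (tendsto_const_nhds.add h0).add
        (ENNReal.Tendsto.const_mul h0 (Or.inr ENNReal.coe_ne_top))
    rw [ENNReal.ofReal_zero, mul_zero, add_zero, add_zero] at hlim
    exact ge_of_tendsto hlim (eventually_nhdsWithin_of_forall fun ε hε => key ε hε)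
  -- An exhaustion of `Ω` by compact sets recovers the whole bulk term by monotone convergence.
  obtain ⟨T, hTc, hTΩ, hTU, hTm⟩ := hΩ.1.1.exists_iUnion_isClosed
  have hQ : ∀ j, IsCompact (T j ∩ compactCovering M j) := fun j =>
    (isCompact_compactCovering M j).inter_left (hTc j)
  have hmono : Monotone fun j => (F \ E) ∩ (T j ∩ compactCovering M j) := fun i j hij =>
    inter_subset_inter_right _ (inter_subset_inter (hTm hij) (compactCovering_subset M hij))
  have hU : ⋃ j, (F \ E) ∩ (T j ∩ compactCovering M j) = F \ E := by
    rw [← inter_iUnion, iUnion_inter_of_monotone hTm (compactCovering_subset M), hTU,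
      iUnion_compactCovering, inter_univ]
    exact inter_eq_self_of_subset_left (sdiff_subset.trans hFΩ)
  rw [← hνm _ (hF.diff hE), ← hU, hmono.measure_iUnion, ENNReal.add_iSup]
  exact iSup_le fun j => hcompact _ (hQ j) (inter_subset_left.trans (hTΩ j))

theorem minimizesFromOutsideObstacle_subLevel (hΩ : IsLocallyLipschitzDomain (n := n) Ω)
    (hu : IsSubsolution n Ω u) (t : ℝ) :
    MinimizesFromOutsideObstacle n Ω u (subLevel Ω u t) := by
  have : LocallyCompactSpace M := ChartedSpace.locallyCompactSpace (Coord n) M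
  intro F₀ K hF₀ hFΩ₀ hEF₀ hK hsymm hKM hdE hdF
  have hE : MeasurableSet (subLevel Ω u t) := (isOpen_subLevel hΩ.1.1 hu.1 t).measurableSet
  set E := subLevel Ω u t with hEdef
  -- `F₀` is only null-measurable. A measurable subset of full measure, with `E` added back, is an
  -- honest competitor with the same perimeter and bulk term.
  obtain ⟨F₁, hF₁F, hF₁, hae⟩ := hF₀.exists_measurable_subset_ae_eq
  set F := F₁ ∪ E with hFdef
  have hF : MeasurableSet F := hF₁.union hE
  have hEF : E ⊆ F := subset_union_right
  have hFF₀ : F ⊆ F₀ := union_subset hF₁F hEF₀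
  have haeF : F =ᵐ[riemannianVolume n] F₀ := by
    have h : F₁ ≤ᵐ[riemannianVolume n] F :=
      Filter.Eventually.of_forall fun x (hx : x ∈ F₁) => (Or.inl hx : x ∈ F)
    have h' : F ≤ᵐ[riemannianVolume n] F₀ :=
      Filter.Eventually.of_forall fun x (hx : x ∈ F) => hFF₀ hx
    exact h'.antisymm (hae.symm.le.trans h)
  have hP : perimeter n F₀ K = perimeter n F K := perimeter_congr_ae haeF.symm K
  have hB : bulk n u K F₀ = bulk n u K F :=
    setLIntegral_congr ((haeF.symm).inter (Filter.EventuallyEq.refl _ K))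
  unfold EnergyDefined at hdE hdF
  unfold energy
  rw [hP, hB] at hdF ⊢
  rw [symmDiff_eq_sdiff_of_subset hEF₀] at hsymm
  have hcl : closure (F \ E) ⊆ closure (F₀ \ E) := closure_mono (sdiff_subset_sdiff_left hFF₀)
  -- In this case the bulk term of `F` is finite, as the energy is defined, and the energy of `F` is
  -- `⊤`.
  by_cases hFf : perimeter n F K = ⊤
  · have hb : bulk n u K F ≠ ⊤ := fun h => hdF ⟨hFf, h⟩
    lift bulk n u K F to ℝ≥0 using hb with b
    rw [hFf, EReal.coe_ennreal_top, EReal.coe_nnreal_eq_coe_real, EReal.top_sub_coe]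
    exact le_top
  have hmain := perimeter_subLevel_add_le_obstacle hΩ hu t hF hEF (hFF₀.trans hFΩ₀) hK.1
    (hsymm.1.of_isClosed_subset isClosed_closure hcl) (hcl.trans hsymm.2) (lt_top_iff_ne_top.2 hFf)
  have hbulk : bulk n u K F = bulk n u K E
      + ∫⁻ x in F \ E, gradNorm n u x ∂(riemannianVolume n) := by
    unfold bulk
    rw [← lintegral_inter_add_sdiff _ (F ∩ K) hE]
    congr 2
    · rw [inter_right_comm, inter_eq_self_of_subset_right hEF]
    · congr 1
      ext x
      constructor
      · exact fun hx => ⟨hx.1.1, hx.2⟩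
      · exact fun hx => ⟨⟨hx.1, hsymm.2 (hcl (subset_closure hx))⟩, hx.2⟩
  -- In this case the energy of `E` is `⊥`. Otherwise the bulk term over `E` is finite and occurs on
  -- both sides.
  by_cases hbE : bulk n u K E = ⊤
  · have hPE : perimeter n E K ≠ ⊤ := fun h => hdE ⟨h, hbE⟩
    lift perimeter n E K to ℝ≥0 using hPE with p
    rw [hbE, EReal.coe_ennreal_top, EReal.coe_nnreal_eq_coe_real, sub_eq_add_neg,
      EReal.neg_top, EReal.add_bot]
    exact bot_le
  rw [hbulk]
  exact coe_sub_le_of_add_le hbE hFf hmain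

end Boundary

end WeakIMCF
end

theorem mainTheorem8 {n : ℕ} (hn : 2 ≤ n) {M : Type*} [EMetricSpace M]
    [ChartedSpace (EuclideanSpace ℝ (Fin n)) M] [IsManifold (𝓡 n) ∞ M]
    [RiemannianBundle (fun x : M => TangentSpace (𝓡 n) x)]
    [IsContMDiffRiemannianBundle (𝓡 n) ∞ (EuclideanSpace ℝ (Fin n))
      (fun x : M => TangentSpace (𝓡 n) x)]
    [IsRiemannianManifold (𝓡 n) M]
    [SecondCountableTopology M] [ConnectedSpace M] [MeasurableSpace M] [BorelSpace M]
    (Ω : Set M) (hΩ : WeakIMCF.IsLocallyLipschitzDomain (n := n) Ω)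
    (u : M → ℝ) (hu : WeakIMCF.IsSubsolution n Ω u) :
    WeakIMCF.IsSubsolutionWithObstacle n Ω u := by
  exact ⟨hu.1, fun t => WeakIMCF.minimizesFromOutsideObstacle_subLevel hΩ hu t⟩
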